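/- Let $\mathcal K$ be a 2-category, $\mathcal A$ a 0-cell, and $B,F:\mathcal A\to\mathcal A$ 1-cells. Horizontal composition is written by juxtaposition (the factors of $XY$ are the strands from left to right), vertical composition from right to left, and $X$ also denotes the identity 2-cell of a 1-cell $X$; for instance $X\alpha$ is $\mathrm{id}_X$ juxtaposed with $\alpha$. Throughout, let $\mu_B:BB\to B$, $\eta_B:1\to B$, $\Delta_B:B\to BB$, $\varepsilon_B:B\to1$, $\mu_F:FF\to F$, $\eta_F:1\to F$, $\Delta_F:F\to FF$, $\varepsilon_F:F\to1$, $\triangleright:BF\to F$, $\triangleleft:BF\to B$, $\lambda_F:F\to BF$, $\rho_B:B\to BF$, $\sigma:FF\to B$, $\rho':F\to BB$, $\tau_{X,Y}:XY\to YX$ for $X,Y\in\{B,F\}$ be 2-cells, and put $$\psi=(\triangleright\,\triangleleft)(B\,\tau_{B,F}\,F)(\Delta_B\Delta_F):BF\to FB,\qquad \phi=(\mu_B\mu_F)(B\,\tau_{F,B}\,F)(\lambda_F\,\rho_B):FB\to BF,$$ $$\lambda^F=(\mu_FF)(F{\triangleright}F)(FB\tau_{F,F})(F\lambda_FF)(\Delta_FF):FF\to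 FF,\qquad \lambda^B=(B\mu_B)(B{\triangleleft}B)(\tau_{B,B}FB)(B\rho_BB)(B\Delta_B):BB\to BB,$$ $$\mu_M=(F\sigma)(\lambda^FF)(F\Delta_F):FF\to FB,\quad \Delta_C=(\mu_BB)(B\lambda^B)(\rho'B):FB\to BB,\quad \eta_M=\eta_F\eta_B,\quad \varepsilon_C=\varepsilon_F\varepsilon_B .$$ Let $\Delta_F^{2}=(\Delta_FF)\Delta_F$. **Distributive laws.** For 1-cells $X,Y$ with such (co)multiplications and (co)units, $\tau:XY\to YX$ is a *left and right (co)monadic distributive law* if $\tau(\mu_XY)=(Y\mu_X)(\tau X)(X\tau)$, $\tau(\eta_XY)=Y\eta_X$, $(Y\Delta_X)\tau=(\tau X)(X\tau)(\Delta_XY)$, $(Y\varepsilon_X)\tau=\varepsilon_XY$, and $\tau(X\mu_Y)=(\mu_YX)(Y\tau)(\tau Y)$, $\tau(X\eta_Y)=\eta_YX$, $(\Delta_YX)\tau=(Y\tau)(\tau Y)(X\Delta_Y)$, $(\varepsilon_YX)\tau=X\varepsilon_Y$. **$\tau$-bimonad.** $(X,\mu,\eta,\Delta,\varepsilon)$ with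 $\tau:XX\to XX$ is a *$\tau$-bimonad* if $(X,\mu,\eta)$ is a monad, $(X,\Delta,\varepsilon)$ a comonad, $\tau$ a left and right (co)monadic distributive law, $\varepsilon\mu=\varepsilon\varepsilon$, $\Delta\eta=\eta\eta$, $\varepsilon\eta=1$ and $\Delta\mu=(\mu\mu)(X\tau X)(\Delta\Delta)$. **Hopf datum.** $(B,F)$ with the 2-cells above is a *Hopf datum* if: 1. $(B,\mu_B,\eta_B)$ is a monad; $(F,\Delta_F,\varepsilon_F)$ is a comonad; for $X\in\{B,F\}$: $\varepsilon_X\mu_X=\varepsilon_X\varepsilon_X$, $\Delta_X\eta_X=\eta_X\eta_X$, $\varepsilon_X\eta_X=1$. 2. $(F,\triangleright)$ is a left $B$-module and $(B,\rho_B)$ a right $F$-comodule (both (co)associative and (co)unital); $\varepsilon_F\triangleright=\varepsilon_B\varepsilon_F$, $\varepsilon_B\triangleleft=\varepsilon_B\varepsilon_F$, $\rho_B\eta_B=\eta_B\eta_F$, $\lambda_F\eta_F=\eta_B\eta_F$, $\varepsilon_B\sigma=\varepsilon_F\varepsilon_F$, $\rho'\eta_F=\eta_B\eta_B$. 3. Each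 of $\tau_{B,F},\tau_{F,B},\tau_{B,B},\tau_{F,F}$ is a left and right (co)monadic distributive law. 4. (module monad, comodule comonad) $\triangleright(B\mu_F)=\mu_F(F{\triangleright})(\psi F)$, $\triangleright(B\eta_F)=\eta_F\varepsilon_B$; $(\Delta_BF)\rho_B=(B\phi)(\rho_BB)\Delta_B$, $(\varepsilon_BF)\rho_B=\eta_F\varepsilon_B$; $\triangleleft(\mu_BF)=\mu_B(\triangleleft B)(B\psi)$, $\triangleleft(\eta_BF)=\eta_B\varepsilon_F$; $(B\Delta_F)\lambda_F=(\phi F)(F\lambda_F)\Delta_F$, $(B\varepsilon_F)\lambda_F=\eta_B\varepsilon_F$. 5. (weak (co)associativity and (co)unity) $\mu_F(F\mu_F)=\mu_F(F{\triangleright})(\mu_MF)$ (on $FFF$), $\mu_F(F{\triangleright})(\eta_MF)=F=\mu_F(F\eta_F)$; $(\Delta_BB)\Delta_B=(B\Delta_C)(\rho_BB)\Delta_B$, $(B\varepsilon_C)(\rho_BB)\Delta_B=B=(\varepsilon_BB)\Delta_B$. 6. (twisted (co)action) $\mu_B(\sigma B)(F\psi)(\psi F)=\mu_B(\triangleleft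 B)(B\mu_M)$, $\mu_B(\varepsilon_FBB)(\eta_MB)=\mu_B(\triangleleft B)(B\eta_M)$; $(\Delta_CF)(F\lambda_F)\Delta_F=(B\phi)(\phi B)(F\rho')\Delta_F$, $(\varepsilon_CF)(F\lambda_F)\Delta_F=(F\varepsilon_C)(FF\eta_B)\Delta_F$. 7. (2-cocycle and 2-cycle) $\mu_B(\sigma B)(F\mu_M)=\mu_B(\sigma B)(F\psi)(\mu_MF)$, $\mu_B(\sigma B)(F\psi)(\eta_MF)=\eta_B\varepsilon_F=\mu_B(\sigma B)(F\eta_M)$; $(B\Delta_C)(\phi B)(F\rho')\Delta_F=(\Delta_CB)(F\rho')\Delta_F$, $(B\varepsilon_C)(\phi B)(F\rho')\Delta_F=\eta_B\varepsilon_F=(\varepsilon_CB)(F\rho')\Delta_F$. 8. (compatibilities) - $\phi\psi=(\mu_B\mu_F)(BBF{\triangleright})(B\tau_{F,B}BF)({\triangleleft}FBBF)(BFF\tau_{B,B}F)(B\tau_{F,F}B\lambda_F)(\rho_B\tau_{B,F}F)(\Delta_B\Delta_F)$; - $\Delta_C\psi=(B\mu_B)(BB\mu_B)(B\sigma BB)(\mu_BFFBB)(BBF\psi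 B)(B\tau_{F,B}BFB)({\triangleleft}FBBFB)(BFF\tau_{B,B}FB)(B\tau_{F,F}BBFB)(BFFB\phi B)(\rho_B\tau_{B,F}FBB)(BBFF\rho')(\Delta_B\Delta_F^2)$; - $\Delta_F{\triangleright}=({\triangleright}\mu_F)(BFF{\triangleright})(B\tau_{F,F}BF)(\rho_B\tau_{B,F}F)(\Delta_B\Delta_F)$; - $\phi\mu_M=(\mu_B\mu_F)(B\mu_BFF)(\sigma BBFF)(FFBBF{\triangleright})(FFB\tau_{F,B}BF)(F\psi FBBF)(FBFF\tau_{B,B}F)(FB\tau_{F,F}BBF)(FBFFB\lambda_F)(FBF\tau_{B,F}F)(F\phi BFF)(FF\rho'FF)(\Delta_F^2\Delta_F)$; - $\Delta_C\mu_M=(B\mu_B)(\mu_BBB)(BBB\mu_B)(BB\sigma BB)(B\mu_BFFBB)(\sigma BBFFBB)(FFBBF\psi B)(FFB\tau_{F,B}BFB)(F\psi FBBFB)(FBFF\tau_{B,B}FB)(FB\tau_{F,F}BBFB)(FBFFB\phi B)(FBF\tau_{B,F}FBB)(F\phi BFFBB)(FFBBFF\rho')(FF\rho'\Delta_FF)(\Delta_F^2\Delta_F)$;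 - $\rho_B\mu_B=(\mu_B\mu_F)(BBF{\triangleright})(B\tau_{F,B}BF)(BF\tau_{B,B}F)(\rho_BBBF)(\Delta_B\rho_B)$; - $\Delta_B\mu_B=(\mu_BB)\,\Xi_B\,(\Delta_BB)=(\mu_BB)(B\lambda^B)(\Delta_BB)$, where $\Xi_B=(BB\mu_B)(BB\mu_BB)(BB\sigma BB)(BBF\psi B)(B\tau_{F,B}BFB)(BF\tau_{B,B}FB)(BFB\rho_BB)(\rho_BBBB)(BB\Delta_B):BBB\to BBB$; - $\Delta_F\mu_F=(F\mu_F)\,(\lambda^FF)(F\Delta_F)=\Xi_F\,(F\Delta_F)$, where $\Xi_F=(\mu_FF)(FF\mu_F)(F{\triangleright}FF)(FBFF{\triangleright})(FB\tau_{F,F}BF)(FBF\tau_{B,F}F)(F\phi BFF)(FF\rho'FF)(\Delta_F^2FF):FFF\to FF$. (In the formula with $\Xi_B$ the outer $\mu_B$ multiplies the first two of the three $B$'s.) **Conditions.** A Hopf datum is called *trivalent* here if $\sigma$ and $\rho'$ are trivial, $\sigma=\eta_B\varepsilon_F\varepsilon_F$, $\rho'=\eta_B\eta_B\varepsilon_F$,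 and at most three of the four 2-cells $\triangleright,\triangleleft,\lambda_F,\rho_B$ are non-trivial (trivial means $\triangleright=\varepsilon_BF$, $\triangleleft=B\varepsilon_F$, $\lambda_F=\eta_BF$, $\rho_B=B\eta_F$, respectively); that is, its type $((i,j),0),((\bar k,\bar l),\bar 0)$ has $i+j+k+l\le3$. It satisfies the *naturality conditions* if for each $\alpha\in\{\triangleright,\triangleleft,\sigma\}$, $\alpha:XY\to Z$, each $\beta\in\{\lambda_F,\rho_B,\rho'\}$, $\beta:Z\to XY$, and each $W\in\{B,F\}$ $$\tau_{Z,W}(\alpha W)=(W\alpha)(\tau_{X,W}Y)(X\tau_{Y,W}),\qquad \tau_{W,Z}(W\alpha)=(\alpha W)(X\tau_{W,Y})(\tau_{W,X}Y),$$ $$(W\beta)\tau_{Z,W}=(\tau_{X,W}Y)(X\tau_{Y,W})(\beta W),\qquad (\beta W)\tau_{W,Z}=(X\tau_{W,Y})(\tau_{W,X}Y)(W\beta),$$ and the *Yang–Baxter equations* if $(Z\tau_{X,Y})(\tau_{X,Z}Y)(X\tau_{Y,Z})=(\tau_{Y,Z}X)(Y\tau_{X,Z})(\tau_{X,Y}Z)$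 for all $X,Y,Z\in\{B,F\}$. **Paired wreath.** A *paired wreath* consists of 2-cells $\mu_B,\eta_B,\varepsilon_B,\Delta_F,\varepsilon_F,\eta_F$, $\psi:BF\to FB$, $\mu_M:FF\to FB$, $\eta_M:1\to FB$, $\phi:FB\to BF$, $\Delta_C:FB\to BB$, $\varepsilon_C:FB\to1$, the four $\tau$'s, $\lambda^B:BB\to BB$ and $\lambda^F:FF\to FF$. Its *canonical restrictions* are $$\triangleright=(F\varepsilon_B)\psi,\ \ \triangleleft=(\varepsilon_FB)\psi,\ \ \mu_F=(F\varepsilon_B)\mu_M,\ \ \sigma=(\varepsilon_FB)\mu_M,\ \ \lambda_F=\phi(F\eta_B),\ \ \rho_B=\phi(\eta_FB),\ \ \Delta_B=\Delta_C(\eta_FB),\ \ \rho'=\Delta_C(F\eta_B).$$ The axioms are: 1. $(B,\mu_B,\eta_B)$ is a monad, $(F,\Delta_F,\varepsilon_F)$ a comonad; for $X\in\{B,F\}$, $\varepsilon_X\mu_X=\varepsilon_X\varepsilon_X$, $\Delta_X\eta_X=\eta_X\eta_X$, $\varepsilon_X\eta_X=1$. 2. $F$ is a left wreath around the monad $B$: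 $\psi(\mu_BF)=(F\mu_B)(\psi B)(B\psi)$, $\psi(\eta_BF)=F\eta_B$; $(F\mu_B)(\mu_MB)(F\psi)(\psi F)=(F\mu_B)(\psi B)(B\mu_M)$, $(F\mu_B)(\eta_MB)=(F\mu_B)(\psi B)(B\eta_M)$; $(F\mu_B)(\mu_MB)(F\mu_M)=(F\mu_B)(\mu_MB)(F\psi)(\mu_MF)$, $(F\mu_B)(\mu_MB)(F\psi)(\eta_MF)=F\eta_B=(F\mu_B)(\mu_MB)(F\eta_M)$. 3. $B$ is a right cowreath around the comonad $F$: $(B\Delta_F)\phi=(\phi F)(F\phi)(\Delta_FB)$, $(B\varepsilon_F)\phi=\varepsilon_FB$; $(\Delta_CF)(F\phi)(\Delta_FB)=(B\phi)(\phi B)(F\Delta_C)(\Delta_FB)$, $(\varepsilon_CF)(F\phi)(\Delta_FB)=(F\varepsilon_C)(\Delta_FB)$; $(B\Delta_C)(\phi B)(F\Delta_C)(\Delta_FB)=(\Delta_CB)(F\Delta_C)(\Delta_FB)$, $(B\varepsilon_C)(\phi B)(F\Delta_C)(\Delta_FB)=\varepsilon_FB=(\varepsilon_CB)(F\Delta_C)(\Delta_FB)$.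 4. The (co)units are canonical: $\eta_M=\eta_F\eta_B$, $\varepsilon_C=\varepsilon_F\varepsilon_B$ (so $\eta_F=(F\varepsilon_B)\eta_M$, $\varepsilon_B=\varepsilon_C(\eta_FB)$). 5. $\varepsilon_F\varepsilon_B\psi=\varepsilon_B\varepsilon_F$, $\phi\,\eta_F\eta_B=\eta_B\eta_F$; $\psi=(\triangleright\,\triangleleft)(B\tau_{B,F}F)(\Delta_B\Delta_F)$, $\phi=(\mu_B\mu_F)(B\tau_{F,B}F)(\lambda_F\rho_B)$, and the four $\tau$'s are left and right (co)monadic distributive laws. 6. $(B\lambda^B)(\Delta_BB)=\Xi_B(\Delta_BB)$ and $(F\mu_F)(\lambda^FF)=\Xi_F$ with $\Xi_B,\Xi_F$ given by the formulas above; $\mu_M=(F\sigma)(\lambda^FF)(F\Delta_F)$, $\Delta_C=(\mu_BB)(B\lambda^B)(\rho'B)$. 7. $FB$ is a $\tau_{FB,FB}$-bimonad, with the wreath product $\nabla_{FB}=(F\mu_B)(FB\mu_B)(\mu_MBB)(F\psi B)$, $\eta_M$, the cowreath coproduct $\Delta_{FB}=(F\phi B)(FF\Delta_C)(\Delta_FFB)(\Delta_FB)$,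 $\varepsilon_C$, and $\tau_{FB,FB}=(F\tau_{F,B}B)(\tau_{F,F}\tau_{B,B})(F\tau_{B,F}B)$. **Theorem.** (i) Let $(B,F)$ be a trivalent Hopf datum in $\mathcal K$ whose $\tau$'s satisfy the naturality conditions and the Yang–Baxter equations. Then $FB$, with $\nabla_{FB},\eta_M,\Delta_{FB},\varepsilon_C$ formed from $\psi,\mu_M,\eta_M,\phi,\Delta_C,\varepsilon_C$, is a $\tau_{FB,FB}$-bimonad. (ii) Consequently these trivalent Hopf data are paired wreaths, and in these cases the two notions are equivalent: $\psi,\mu_M,\eta_M,\phi,\Delta_C,\varepsilon_C,\lambda^B,\lambda^F$ turn each Hopf datum as in (i) into a paired wreath; the canonical restrictions turn each paired wreath, whose canonical restrictions are trivalent and whose $\tau$'s satisfy the naturality conditions and the Yang–Baxter equations, into a Hopf datum; and these two assignments are mutually inverse. -/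

import Mathlib

open CategoryTheory Bicategory

universe w v u

namespace HopfPair

/-! Horizontal juxtaposition `XY` of 1-cells over a fixed 0-cell `a` is written `X ≫ Y`, so that
string diagrams are read with the strands of `X ≫ Y` from left to right and from top to bottom.
The symbol `⊗≫` is vertical composition up to the structural isomorphisms of `K`
(which are identities when `K` is a strict 2-category). -/

section General

variable {K : Type u} [Bicategory.{w, v} K] {a : K}

/-- `α : XY ⟶ Z` slides through the crossings with a strand `W` on its right. -/
def NatRight₂₁ {X Y Z W : a ⟶ a} (α : X ≫ Y ⟶ Z) (tX : X ≫ W ⟶ W ≫ X)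
    (tY : Y ≫ W ⟶ W ≫ Y) (tZ : Z ≫ W ⟶ W ≫ Z) : Prop :=
  α ▷ W ≫ tZ = 𝟙 ((X ≫ Y) ≫ W) ⊗≫ X ◁ tY ⊗≫ tX ▷ Y ⊗≫ W ◁ α

/-- `α : XY ⟶ Z` slides through the crossings with a strand `W` on its left. -/
def NatLeft₂₁ {X Y Z W : a ⟶ a} (α : X ≫ Y ⟶ Z) (tX : W ≫ X ⟶ X ≫ W)
    (tY : W ≫ Y ⟶ Y ≫ W) (tZ : W ≫ Z ⟶ Z ≫ W) : Prop :=
  W ◁ α ≫ tZ = 𝟙 (W ≫ X ≫ Y) ⊗≫ tX ▷ Y ⊗≫ X ◁ tY ⊗≫ α ▷ W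

/-- `β : Z ⟶ XY` slides through the crossings with a strand `W` on its right. -/
def NatRight₁₂ {X Y Z W : a ⟶ a} (β : Z ⟶ X ≫ Y) (tX : X ≫ W ⟶ W ≫ X)
    (tY : Y ≫ W ⟶ W ≫ Y) (tZ : Z ≫ W ⟶ W ≫ Z) : Prop :=
  tZ ≫ W ◁ β = β ▷ W ⊗≫ X ◁ tY ⊗≫ tX ▷ Y ⊗≫ 𝟙 (W ≫ X ≫ Y)

/-- `β : Z ⟶ XY` slides through the crossings with a strand `W` on its left. -/
def NatLeft₁₂ {X Y Z W : a ⟶ a} (β : Z ⟶ X ≫ Y) (tX : W ≫ X ⟶ X ≫ W)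
    (tY : W ≫ Y ⟶ Y ≫ W) (tZ : W ≫ Z ⟶ Z ≫ W) : Prop :=
  tZ ≫ β ▷ W = W ◁ β ⊗≫ tX ▷ Y ⊗≫ X ◁ tY ⊗≫ 𝟙 ((X ≫ Y) ≫ W)

/-- The Yang–Baxter equation on the strands `X`, `Y`, `Z`. -/
def YangBaxterEq {X Y Z : a ⟶ a} (tXY : X ≫ Y ⟶ Y ≫ X) (tXZ : X ≫ Z ⟶ Z ≫ X)
    (tYZ : Y ≫ Z ⟶ Z ≫ Y) : Prop :=
  X ◁ tYZ ⊗≫ tXZ ▷ Y ⊗≫ Z ◁ tXY =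
    𝟙 (X ≫ Y ≫ Z) ⊗≫ tXY ▷ Z ⊗≫ Y ◁ tXZ ⊗≫ tYZ ▷ X ⊗≫ 𝟙 (Z ≫ Y ≫ X)

/-- 2-cells of the shape of a (co)multiplication and a (co)unit on `X`, with no axioms. -/
structure PreBimonad (X : a ⟶ a) where
  mul : X ≫ X ⟶ X
  unit : 𝟙 a ⟶ X
  comul : X ⟶ X ≫ X
  counit : X ⟶ 𝟙 a

namespace PreBimonad

variable {X Y : a ⟶ a}

/-- `(X, mul, unit)` is a monad. -/
structure IsMonad (P : PreBimonad X) : Prop where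
  assoc : P.mul ▷ X ≫ P.mul = 𝟙 ((X ≫ X) ≫ X) ⊗≫ X ◁ P.mul ≫ P.mul
  unit_mul : P.unit ▷ X ≫ P.mul = (λ_ X).hom
  mul_unit : X ◁ P.unit ≫ P.mul = (ρ_ X).hom

/-- `(X, comul, counit)` is a comonad. -/
structure IsComonad (P : PreBimonad X) : Prop where
  coassoc : P.comul ≫ P.comul ▷ X = (P.comul ≫ X ◁ P.comul) ⊗≫ 𝟙 ((X ≫ X) ≫ X)
  comul_counit : P.comul ≫ X ◁ P.counit = (ρ_ X).inv
  counit_comul : P.comul ≫ P.counit ▷ X = (λ_ X).inv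

def CounitMul (P : PreBimonad X) : Prop :=
  P.mul ≫ P.counit = P.counit ▷ X ≫ (λ_ X).hom ≫ P.counit

def UnitComul (P : PreBimonad X) : Prop :=
  P.unit ≫ P.comul = P.unit ≫ (λ_ X).inv ≫ P.unit ▷ X

def UnitCounit (P : PreBimonad X) : Prop :=
  P.unit ≫ P.counit = 𝟙 (𝟙 a)

/-- `τ : XY ⟶ YX` is a left and right monadic and comonadic distributive law with respect to the
(co)multiplications and (co)units of `X` and `Y`. -/
structure IsDistributive (P : PreBimonad X) (Q : PreBimonad Y) (τ : X ≫ Y ⟶ Y ≫ X) : Prop where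
  mul_left : NatRight₂₁ P.mul τ τ τ
  unit_left : P.unit ▷ Y ≫ τ = 𝟙 (𝟙 a ≫ Y) ⊗≫ Y ◁ P.unit
  mul_right : NatLeft₂₁ Q.mul τ τ τ
  unit_right : X ◁ Q.unit ≫ τ = 𝟙 (X ≫ 𝟙 a) ⊗≫ Q.unit ▷ X
  comul_left : NatRight₁₂ P.comul τ τ τ
  counit_left : τ ≫ Y ◁ P.counit = P.counit ▷ Y ⊗≫ 𝟙 (Y ≫ 𝟙 a)
  comul_right : NatLeft₁₂ Q.comul τ τ τ
  counit_right : τ ≫ Q.counit ▷ X = X ◁ Q.counit ⊗≫ 𝟙 (𝟙 a ≫ X)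

/-- The monad and comonad `X` is a `τ`-bimonad, for the given `τ : XX ⟶ XX`. -/
structure IsTauBimonad (P : PreBimonad X) (τ : X ≫ X ⟶ X ≫ X) : Prop where
  monad : P.IsMonad
  comonad : P.IsComonad
  distributive : IsDistributive P P τ
  counit_mul : P.CounitMul
  unit_comul : P.UnitComul
  unit_counit : P.UnitCounit
  mul_comul : P.mul ≫ P.comul =
    P.comul ▷ X ≫ (X ≫ X) ◁ P.comul ⊗≫ X ◁ τ ▷ X ⊗≫ P.mul ▷ (X ≫ X) ≫ X ◁ P.mul

end PreBimonad

end General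

/-! ### Left wreaths and right cowreaths -/

section Wreaths

variable {K : Type u} [Bicategory.{w, v} K] {a : K} {B F : a ⟶ a}

/-- `(F, psi, muM, etaM)` is a left wreath around the monad `(B, mulB, unitB)`. -/
structure IsLeftWreath (mulB : B ≫ B ⟶ B) (unitB : 𝟙 a ⟶ B) (psi : B ≫ F ⟶ F ≫ B)
    (muM : F ≫ F ⟶ F ≫ B) (etaM : 𝟙 a ⟶ F ≫ B) : Prop where
  psi_mul : NatRight₂₁ mulB psi psi psi
  psi_unit : unitB ▷ F ≫ psi = 𝟙 (𝟙 a ≫ F) ⊗≫ F ◁ unitB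
  mu_two_cell :
    psi ▷ F ⊗≫ F ◁ psi ⊗≫ muM ▷ B ⊗≫ F ◁ mulB =
      𝟙 ((B ≫ F) ≫ F) ⊗≫ B ◁ muM ⊗≫ psi ▷ B ⊗≫ F ◁ mulB
  eta_two_cell :
    etaM ▷ B ⊗≫ F ◁ mulB = 𝟙 (𝟙 a ≫ B) ⊗≫ B ◁ etaM ⊗≫ psi ▷ B ⊗≫ F ◁ mulB
  mu_assoc :
    𝟙 ((F ≫ F) ≫ F) ⊗≫ F ◁ muM ⊗≫ muM ▷ B ⊗≫ F ◁ mulB =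
      muM ▷ F ⊗≫ F ◁ psi ⊗≫ muM ▷ B ⊗≫ F ◁ mulB
  eta_mu :
    etaM ▷ F ⊗≫ F ◁ psi ⊗≫ muM ▷ B ⊗≫ F ◁ mulB = 𝟙 (𝟙 a ≫ F) ⊗≫ F ◁ unitB
  mu_eta :
    F ◁ etaM ⊗≫ muM ▷ B ⊗≫ F ◁ mulB = F ◁ unitB

/-- `(B, phi, deltaC, epsC)` is a right cowreath around the comonad `(F, comulF, counitF)`. -/
structure IsRightCowreath (comulF : F ⟶ F ≫ F) (counitF : F ⟶ 𝟙 a) (phi : F ≫ B ⟶ B ≫ F)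
    (deltaC : F ≫ B ⟶ B ≫ B) (epsC : F ≫ B ⟶ 𝟙 a) : Prop where
  phi_comul : NatRight₁₂ comulF phi phi phi
  phi_counit : phi ≫ B ◁ counitF = counitF ▷ B ⊗≫ 𝟙 (B ≫ 𝟙 a)
  delta_two_cell :
    comulF ▷ B ⊗≫ F ◁ phi ⊗≫ deltaC ▷ F =
      comulF ▷ B ⊗≫ F ◁ deltaC ⊗≫ phi ▷ B ⊗≫ B ◁ phi ⊗≫ 𝟙 ((B ≫ B) ≫ F)
  eps_two_cell :
    comulF ▷ B ⊗≫ F ◁ phi ⊗≫ epsC ▷ F = comulF ▷ B ⊗≫ F ◁ epsC ⊗≫ 𝟙 (𝟙 a ≫ F)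
  delta_coassoc :
    comulF ▷ B ⊗≫ F ◁ deltaC ⊗≫ phi ▷ B ⊗≫ B ◁ deltaC =
      comulF ▷ B ⊗≫ F ◁ deltaC ⊗≫ deltaC ▷ B ⊗≫ 𝟙 (B ≫ B ≫ B)
  delta_eps :
    comulF ▷ B ⊗≫ F ◁ deltaC ⊗≫ phi ▷ B ⊗≫ B ◁ epsC = counitF ▷ B ⊗≫ 𝟙 (B ≫ 𝟙 a)
  eps_delta :
    comulF ▷ B ⊗≫ F ◁ deltaC ⊗≫ epsC ▷ B = counitF ▷ B

end Wreaths

/-! ### Hopf data -/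

/-- The 2-cells that make up a Hopf datum on the 1-cells `B` and `F`, with no axioms. -/
structure HopfData {K : Type u} [Bicategory.{w, v} K] {a : K} (B F : a ⟶ a) where
  mulB : B ≫ B ⟶ B
  unitB : 𝟙 a ⟶ B
  comulB : B ⟶ B ≫ B
  counitB : B ⟶ 𝟙 a
  mulF : F ≫ F ⟶ F
  unitF : 𝟙 a ⟶ F
  comulF : F ⟶ F ≫ F
  counitF : F ⟶ 𝟙 a
  /-- left action of `B` on `F` -/
  actL : B ≫ F ⟶ F
  /-- right coaction of `F` on `B` -/
  coactR : B ⟶ B ≫ F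
  /-- right action of `F` on `B` -/
  actR : B ≫ F ⟶ B
  /-- left coaction of `B` on `F` -/
  coactL : F ⟶ B ≫ F
  /-- the 2-cocycle -/
  sigma : F ≫ F ⟶ B
  /-- the 2-cycle -/
  rho : F ⟶ B ≫ B
  tauBF : B ≫ F ⟶ F ≫ B
  tauFB : F ≫ B ⟶ B ≫ F
  tauBB : B ≫ B ⟶ B ≫ B
  tauFF : F ≫ F ⟶ F ≫ F

namespace HopfData

variable {K : Type u} [Bicategory.{w, v} K] {a : K} {B F : a ⟶ a} (D : HopfData B F)

def cellsB : PreBimonad B := ⟨D.mulB, D.unitB, D.comulB, D.counitB⟩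

def cellsF : PreBimonad F := ⟨D.mulF, D.unitF, D.comulF, D.counitF⟩

def psi : B ≫ F ⟶ F ≫ B :=
  D.comulB ▷ F ≫ (B ≫ B) ◁ D.comulF ⊗≫ B ◁ D.tauBF ▷ F ⊗≫ D.actL ▷ (B ≫ F) ≫ F ◁ D.actR

def phi : F ≫ B ⟶ B ≫ F :=
  D.coactL ▷ B ≫ (B ≫ F) ◁ D.coactR ⊗≫ B ◁ D.tauFB ▷ F ⊗≫ D.mulB ▷ (F ≫ F) ≫ B ◁ D.mulF

def muM : F ≫ F ⟶ F ≫ B :=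
  D.comulF ▷ F ≫ (F ≫ F) ◁ D.comulF ⊗≫ F ◁ D.coactL ▷ (F ≫ F) ⊗≫
    F ◁ B ◁ D.tauFF ▷ F ⊗≫ F ◁ D.actL ▷ (F ≫ F) ⊗≫ D.mulF ▷ (F ≫ F) ≫ F ◁ D.sigma

def deltaC : F ≫ B ⟶ B ≫ B :=
  D.rho ▷ B ≫ (B ≫ B) ◁ D.comulB ⊗≫ (B ≫ B) ◁ D.coactR ▷ B ⊗≫
    B ◁ D.tauBB ▷ (F ≫ B) ⊗≫ (B ≫ B) ◁ D.actR ▷ B ⊗≫ D.mulB ▷ (B ≫ B) ≫ B ◁ D.mulB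

/-- the canonical `η_M`, namely `η_F η_B` -/
def etaM : 𝟙 a ⟶ F ≫ B := D.unitF ≫ (ρ_ F).inv ≫ F ◁ D.unitB

/-- the canonical `ε_C'`, namely `ε_F ε_B` -/
def epsC : F ≫ B ⟶ 𝟙 a := D.counitF ▷ B ≫ (λ_ B).hom ≫ D.counitB

def lamB : B ≫ B ⟶ B ≫ B :=
  B ◁ D.comulB ⊗≫ B ◁ D.coactR ▷ B ⊗≫ D.tauBB ▷ (F ≫ B) ⊗≫ B ◁ D.actR ▷ B ⊗≫ B ◁ D.mulB

def lamF : F ≫ F ⟶ F ≫ F :=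
  D.comulF ▷ F ⊗≫ F ◁ D.coactL ▷ F ⊗≫ F ◁ B ◁ D.tauFF ⊗≫ F ◁ D.actL ▷ F ⊗≫ D.mulF ▷ F

/-- The axioms of a Hopf datum. -/
structure IsHopfDatum : Prop where
  -- (co)monads, (co)units
  monadB : D.cellsB.IsMonad
  comonadF : D.cellsF.IsComonad
  counit_mulB : D.cellsB.CounitMul
  unit_comulB : D.cellsB.UnitComul
  unit_counitB : D.cellsB.UnitCounit
  counit_mulF : D.cellsF.CounitMul
  unit_comulF : D.cellsF.UnitComul
  unit_counitF : D.cellsF.UnitCounit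
  -- `F` is a left `B`-module, `B` is a right `F`-comodule
  actL_mul : D.mulB ▷ F ≫ D.actL = 𝟙 ((B ≫ B) ≫ F) ⊗≫ B ◁ D.actL ≫ D.actL
  actL_unit : D.unitB ▷ F ≫ D.actL = (λ_ F).hom
  coactR_comul : D.coactR ≫ B ◁ D.comulF = D.coactR ≫ D.coactR ▷ F ⊗≫ 𝟙 (B ≫ F ≫ F)
  coactR_counit : D.coactR ≫ B ◁ D.counitF = (ρ_ B).inv
  actL_counit : D.actL ≫ D.counitF = D.counitB ▷ F ≫ (λ_ F).hom ≫ D.counitF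
  unit_coactR : D.unitB ≫ D.coactR = D.unitB ≫ (ρ_ B).inv ≫ B ◁ D.unitF
  actR_counit : D.actR ≫ D.counitB = D.counitB ▷ F ≫ (λ_ F).hom ≫ D.counitF
  unit_coactL : D.unitF ≫ D.coactL = D.unitB ≫ (ρ_ B).inv ≫ B ◁ D.unitF
  -- distributive laws
  tauBF : PreBimonad.IsDistributive D.cellsB D.cellsF D.tauBF
  tauFB : PreBimonad.IsDistributive D.cellsF D.cellsB D.tauFB
  tauBB : PreBimonad.IsDistributive D.cellsB D.cellsB D.tauBB
  tauFF : PreBimonad.IsDistributive D.cellsF D.cellsF D.tauFF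
  -- `F` as a module monad
  module_monad :
    D.psi ▷ F ⊗≫ F ◁ D.actL ≫ D.mulF = 𝟙 ((B ≫ F) ≫ F) ⊗≫ B ◁ D.mulF ≫ D.actL
  module_monad_unit : B ◁ D.unitF ≫ D.actL = (ρ_ B).hom ≫ D.counitB ≫ D.unitF
  -- `B` as a comodule comonad
  comodule_comonad :
    D.comulB ≫ D.coactR ▷ B ⊗≫ B ◁ D.phi = D.coactR ≫ D.comulB ▷ F ⊗≫ 𝟙 (B ≫ B ≫ F)
  comodule_comonad_counit : D.coactR ≫ D.counitB ▷ F = D.counitB ≫ D.unitF ≫ (λ_ F).inv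
  -- weak (co)associativity and (co)unity
  weak_assoc :
    𝟙 ((F ≫ F) ≫ F) ⊗≫ F ◁ D.mulF ≫ D.mulF = D.muM ▷ F ⊗≫ F ◁ D.actL ≫ D.mulF
  weak_unit_left : D.etaM ▷ F ⊗≫ F ◁ D.actL ≫ D.mulF = (λ_ F).hom
  weak_unit_right : F ◁ D.unitF ≫ D.mulF = (ρ_ F).hom
  weak_coassoc :
    D.comulB ≫ D.comulB ▷ B ⊗≫ 𝟙 (B ≫ B ≫ B) = D.comulB ≫ D.coactR ▷ B ⊗≫ B ◁ D.deltaC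
  weak_counit_right : D.comulB ≫ D.coactR ▷ B ⊗≫ B ◁ D.epsC = (ρ_ B).inv
  weak_counit_left : D.comulB ≫ D.counitB ▷ B = (λ_ B).inv
  -- `B` as a module monad
  right_module_monad :
    𝟙 ((B ≫ B) ≫ F) ⊗≫ B ◁ D.psi ⊗≫ D.actR ▷ B ≫ D.mulB = D.mulB ▷ F ≫ D.actR
  right_module_monad_unit : D.unitB ▷ F ≫ D.actR = (λ_ F).hom ≫ D.counitF ≫ D.unitB
  -- `F` as a comodule comonad
  left_comodule_comonad :
    D.comulF ≫ F ◁ D.coactL ⊗≫ D.phi ▷ F ⊗≫ 𝟙 (B ≫ F ≫ F) = D.coactL ≫ B ◁ D.comulF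
  left_comodule_comonad_counit : D.coactL ≫ B ◁ D.counitF = D.counitF ≫ D.unitB ≫ (ρ_ B).inv
  -- twisted action and coaction
  twisted_action :
    D.psi ▷ F ⊗≫ F ◁ D.psi ⊗≫ D.sigma ▷ B ≫ D.mulB =
      𝟙 ((B ≫ F) ≫ F) ⊗≫ B ◁ D.muM ⊗≫ D.actR ▷ B ≫ D.mulB
  twisted_action_unit :
    D.etaM ▷ B ⊗≫ D.counitF ▷ (B ≫ B) ⊗≫ D.mulB =
      𝟙 (𝟙 a ≫ B) ⊗≫ B ◁ D.etaM ⊗≫ D.actR ▷ B ≫ D.mulB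
  twisted_coaction :
    D.comulF ≫ F ◁ D.coactL ⊗≫ D.deltaC ▷ F ⊗≫ 𝟙 (B ≫ B ≫ F) =
      D.comulF ≫ F ◁ D.rho ⊗≫ D.phi ▷ B ⊗≫ B ◁ D.phi
  twisted_coaction_counit :
    D.comulF ≫ F ◁ D.coactL ⊗≫ D.epsC ▷ F ⊗≫ 𝟙 F =
      D.comulF ⊗≫ F ◁ F ◁ D.unitB ⊗≫ F ◁ D.epsC ⊗≫ 𝟙 F
  -- 2-cocycle and 2-cycle
  cocycle :
    𝟙 ((F ≫ F) ≫ F) ⊗≫ F ◁ D.muM ⊗≫ D.sigma ▷ B ≫ D.mulB =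
      D.muM ▷ F ⊗≫ F ◁ D.psi ⊗≫ D.sigma ▷ B ≫ D.mulB
  cocycle_unit_left :
    D.etaM ▷ F ⊗≫ F ◁ D.psi ⊗≫ D.sigma ▷ B ≫ D.mulB = (λ_ F).hom ≫ D.counitF ≫ D.unitB
  cocycle_unit_right :
    F ◁ D.etaM ⊗≫ D.sigma ▷ B ≫ D.mulB = (ρ_ F).hom ≫ D.counitF ≫ D.unitB
  cycle :
    D.comulF ≫ F ◁ D.rho ⊗≫ D.phi ▷ B ⊗≫ B ◁ D.deltaC =
      D.comulF ≫ F ◁ D.rho ⊗≫ D.deltaC ▷ B ⊗≫ 𝟙 (B ≫ B ≫ B)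
  cycle_counit_right :
    D.comulF ≫ F ◁ D.rho ⊗≫ D.phi ▷ B ⊗≫ B ◁ D.epsC = D.counitF ≫ D.unitB ≫ (ρ_ B).inv
  cycle_counit_left :
    D.comulF ≫ F ◁ D.rho ⊗≫ D.epsC ▷ B = D.counitF ≫ D.unitB ≫ (λ_ B).inv
  sigma_counit : D.sigma ≫ D.counitB = D.counitF ▷ F ≫ (λ_ F).hom ≫ D.counitF
  unit_rho : D.unitF ≫ D.rho = D.unitB ≫ (ρ_ B).inv ≫ B ◁ D.unitB
  -- the compatibilities of the monadic with the comonadic structures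
  psi_phi :
    D.psi ≫ D.phi =
      D.comulB ▷ F ≫ (B ≫ B) ◁ D.comulF ⊗≫
        D.coactR ▷ (B ≫ F ≫ F) ⊗≫ B ◁ F ◁ D.tauBF ▷ F ⊗≫ B ◁ F ◁ F ◁ B ◁ D.coactL ⊗≫
        B ◁ D.tauFF ▷ (B ≫ B ≫ F) ⊗≫ B ◁ F ◁ F ◁ D.tauBB ▷ F ⊗≫
        D.actR ▷ (F ≫ B ≫ B ≫ F) ⊗≫ B ◁ D.tauFB ▷ (B ≫ F) ⊗≫ B ◁ B ◁ F ◁ D.actL ⊗≫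
        D.mulB ▷ (F ≫ F) ≫ B ◁ D.mulF
  psi_delta :
    D.psi ≫ D.deltaC =
      D.comulB ▷ F ≫ (B ≫ B) ◁ D.comulF ⊗≫ B ◁ B ◁ D.comulF ▷ F ⊗≫ B ◁ B ◁ F ◁ F ◁ D.rho ⊗≫
        D.coactR ▷ (B ≫ F ≫ F ≫ B ≫ B) ⊗≫ B ◁ F ◁ D.tauBF ▷ (F ≫ B ≫ B) ⊗≫
        B ◁ F ◁ F ◁ B ◁ D.phi ▷ B ⊗≫
        B ◁ D.tauFF ▷ (B ≫ B ≫ F ≫ B) ⊗≫ B ◁ F ◁ F ◁ D.tauBB ▷ (F ≫ B) ⊗≫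
        D.actR ▷ (F ≫ B ≫ B ≫ F ≫ B) ⊗≫ B ◁ D.tauFB ▷ (B ≫ F ≫ B) ⊗≫ B ◁ B ◁ F ◁ D.psi ▷ B ⊗≫
        D.mulB ▷ (F ≫ F ≫ B ≫ B) ⊗≫ B ◁ D.sigma ▷ (B ≫ B) ⊗≫ B ◁ B ◁ D.mulB ⊗≫ B ◁ D.mulB
  actL_comul :
    D.actL ≫ D.comulF =
      D.comulB ▷ F ≫ (B ≫ B) ◁ D.comulF ⊗≫
        D.coactR ▷ (B ≫ F ≫ F) ⊗≫ B ◁ F ◁ D.tauBF ▷ F ⊗≫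
        B ◁ D.tauFF ▷ (B ≫ F) ⊗≫ B ◁ F ◁ F ◁ D.actL ⊗≫
        D.actL ▷ (F ≫ F) ≫ F ◁ D.mulF
  mu_phi :
    D.muM ≫ D.phi =
      D.comulF ▷ F ≫ (F ≫ F) ◁ D.comulF ⊗≫ D.comulF ▷ (F ≫ F ≫ F) ⊗≫
        F ◁ F ◁ D.rho ▷ (F ≫ F) ⊗≫
        F ◁ D.phi ▷ (B ≫ F ≫ F) ⊗≫ F ◁ B ◁ F ◁ D.tauBF ▷ F ⊗≫
        F ◁ B ◁ F ◁ F ◁ B ◁ D.coactL ⊗≫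
        F ◁ B ◁ D.tauFF ▷ (B ≫ B ≫ F) ⊗≫ F ◁ B ◁ F ◁ F ◁ D.tauBB ▷ F ⊗≫
        F ◁ D.psi ▷ (F ≫ B ≫ B ≫ F) ⊗≫ F ◁ F ◁ B ◁ D.tauFB ▷ (B ≫ F) ⊗≫
        F ◁ F ◁ B ◁ B ◁ F ◁ D.actL ⊗≫
        D.sigma ▷ (B ≫ B ≫ F ≫ F) ⊗≫ B ◁ D.mulB ▷ (F ≫ F) ⊗≫
        D.mulB ▷ (F ≫ F) ≫ B ◁ D.mulF
  mu_delta :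
    D.muM ≫ D.deltaC =
      D.comulF ▷ F ≫ (F ≫ F) ◁ D.comulF ⊗≫ D.comulF ▷ (F ≫ F ≫ F) ⊗≫
        F ◁ F ◁ D.rho ▷ (F ≫ F) ⊗≫
        F ◁ F ◁ B ◁ B ◁ D.comulF ▷ F ⊗≫ F ◁ F ◁ B ◁ B ◁ F ◁ F ◁ D.rho ⊗≫
        F ◁ D.phi ▷ (B ≫ F ≫ F ≫ B ≫ B) ⊗≫ F ◁ B ◁ F ◁ D.tauBF ▷ (F ≫ B ≫ B) ⊗≫
        F ◁ B ◁ F ◁ F ◁ B ◁ D.phi ▷ B ⊗≫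
        F ◁ B ◁ D.tauFF ▷ (B ≫ B ≫ F ≫ B) ⊗≫ F ◁ B ◁ F ◁ F ◁ D.tauBB ▷ (F ≫ B) ⊗≫
        F ◁ D.psi ▷ (F ≫ B ≫ B ≫ F ≫ B) ⊗≫ F ◁ F ◁ B ◁ D.tauFB ▷ (B ≫ F ≫ B) ⊗≫
        F ◁ F ◁ B ◁ B ◁ F ◁ D.psi ▷ B ⊗≫
        D.sigma ▷ (B ≫ B ≫ F ≫ F ≫ B ≫ B) ⊗≫ B ◁ D.mulB ▷ (F ≫ F ≫ B ≫ B) ⊗≫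
        B ◁ B ◁ D.sigma ▷ (B ≫ B) ⊗≫ B ◁ B ◁ B ◁ D.mulB ⊗≫
        D.mulB ▷ (B ≫ B) ≫ B ◁ D.mulB
  mul_coactR :
    D.mulB ≫ D.coactR =
      D.comulB ▷ B ≫ (B ≫ B) ◁ D.coactR ⊗≫
        D.coactR ▷ (B ≫ B ≫ F) ⊗≫ B ◁ F ◁ D.tauBB ▷ F ⊗≫
        B ◁ D.tauFB ▷ (B ≫ F) ⊗≫ B ◁ B ◁ F ◁ D.actL ⊗≫
        D.mulB ▷ (F ≫ F) ≫ B ◁ D.mulF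
  mul_comulB :
    D.mulB ≫ D.comulB =
      D.comulB ▷ B ≫ (B ≫ B) ◁ D.comulB ⊗≫
        D.coactR ▷ (B ≫ B ≫ B) ⊗≫ B ◁ F ◁ B ◁ D.coactR ▷ B ⊗≫
        B ◁ F ◁ D.tauBB ▷ (F ≫ B) ⊗≫
        B ◁ D.tauFB ▷ (B ≫ F ≫ B) ⊗≫ B ◁ B ◁ F ◁ D.psi ▷ B ⊗≫
        D.mulB ▷ (F ≫ F ≫ B ≫ B) ⊗≫ B ◁ D.sigma ▷ (B ≫ B) ⊗≫ B ◁ B ◁ D.mulB ⊗≫ B ◁ D.mulB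
  mul_comulB_lam :
    D.mulB ≫ D.comulB = D.comulB ▷ B ⊗≫ B ◁ D.lamB ⊗≫ D.mulB ▷ B
  mul_comulF :
    D.mulF ≫ D.comulF =
      D.comulF ▷ F ≫ (F ≫ F) ◁ D.comulF ⊗≫ D.comulF ▷ (F ≫ F ≫ F) ⊗≫
        F ◁ F ◁ D.rho ▷ (F ≫ F) ⊗≫
        F ◁ D.phi ▷ (B ≫ F ≫ F) ⊗≫ F ◁ B ◁ F ◁ D.tauBF ▷ F ⊗≫
        F ◁ B ◁ D.tauFF ▷ (B ≫ F) ⊗≫ F ◁ B ◁ F ◁ F ◁ D.actL ⊗≫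
        F ◁ D.actL ▷ (F ≫ F) ⊗≫ F ◁ F ◁ D.mulF ⊗≫ D.mulF ▷ F
  mul_comulF_lam :
    D.mulF ≫ D.comulF = F ◁ D.comulF ⊗≫ D.lamF ▷ F ⊗≫ F ◁ D.mulF

/-! Triviality of the 2-cells, and the naturality and Yang–Baxter conditions. -/

def ActLTrivial : Prop := D.actL = D.counitB ▷ F ≫ (λ_ F).hom

def ActRTrivial : Prop := D.actR = B ◁ D.counitF ≫ (ρ_ B).hom

def CoactLTrivial : Prop := D.coactL = (λ_ F).inv ≫ D.unitB ▷ F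

def CoactRTrivial : Prop := D.coactR = (ρ_ B).inv ≫ B ◁ D.unitF

def SigmaTrivial : Prop := D.sigma = D.counitF ▷ F ≫ (λ_ F).hom ≫ D.counitF ≫ D.unitB

def RhoTrivial : Prop := D.rho = D.counitF ≫ D.unitB ≫ (ρ_ B).inv ≫ B ◁ D.unitB

open Classical in
/-- The number `i + j + k + l` of non-trivial (co)action 2-cells. -/
noncomputable def valence : ℕ :=
  (if D.ActLTrivial then 0 else 1) + (if D.ActRTrivial then 0 else 1) +
    (if D.CoactLTrivial then 0 else 1) + (if D.CoactRTrivial then 0 else 1)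

/-- `σ` and `ρ'` are trivial and at most three of the four (co)action 2-cells are non-trivial. -/
structure IsTrivalent : Prop where
  sigma : D.SigmaTrivial
  rho : D.RhoTrivial
  valence_le : D.valence ≤ 3

/-- Naturality, with respect to the (co)actions, the 2-cocycle and the 2-cycle, of the crossings
with a strand `W` on the right and on the left. -/
structure NaturalAt {W : a ⟶ a} (tBW : B ≫ W ⟶ W ≫ B) (tFW : F ≫ W ⟶ W ≫ F)
    (tWB : W ≫ B ⟶ B ≫ W) (tWF : W ≫ F ⟶ F ≫ W) : Prop where
  actL_right : NatRight₂₁ D.actL tBW tFW tFW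
  actL_left : NatLeft₂₁ D.actL tWB tWF tWF
  actR_right : NatRight₂₁ D.actR tBW tFW tBW
  actR_left : NatLeft₂₁ D.actR tWB tWF tWB
  sigma_right : NatRight₂₁ D.sigma tFW tFW tBW
  sigma_left : NatLeft₂₁ D.sigma tWF tWF tWB
  coactL_right : NatRight₁₂ D.coactL tBW tFW tFW
  coactL_left : NatLeft₁₂ D.coactL tWB tWF tWF
  coactR_right : NatRight₁₂ D.coactR tBW tFW tBW
  coactR_left : NatLeft₁₂ D.coactR tWB tWF tWB
  rho_right : NatRight₁₂ D.rho tBW tBW tFW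
  rho_left : NatLeft₁₂ D.rho tWB tWB tWF

/-- All the naturality conditions. -/
structure IsNatural : Prop where
  atB : D.NaturalAt D.tauBB D.tauFB D.tauBB D.tauBF
  atF : D.NaturalAt D.tauBF D.tauFF D.tauFB D.tauFF

/-- The Yang–Baxter equations on the eight words of length three in `B` and `F`. -/
structure IsYangBaxter : Prop where
  BBB : YangBaxterEq D.tauBB D.tauBB D.tauBB
  BBF : YangBaxterEq D.tauBB D.tauBF D.tauBF
  BFB : YangBaxterEq D.tauBF D.tauBB D.tauFB
  BFF : YangBaxterEq D.tauBF D.tauBF D.tauFF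
  FBB : YangBaxterEq D.tauFB D.tauFB D.tauBB
  FBF : YangBaxterEq D.tauFB D.tauFF D.tauBF
  FFB : YangBaxterEq D.tauFF D.tauFB D.tauFB
  FFF : YangBaxterEq D.tauFF D.tauFF D.tauFF

end HopfData

/-! ### Paired wreaths -/

/-- The 2-cells that make up a paired wreath on the 1-cells `B` and `F`, with no axioms. -/
structure PairedData {K : Type u} [Bicategory.{w, v} K] {a : K} (B F : a ⟶ a) where
  mulB : B ≫ B ⟶ B
  unitB : 𝟙 a ⟶ B
  counitB : B ⟶ 𝟙 a
  comulF : F ⟶ F ≫ F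
  counitF : F ⟶ 𝟙 a
  unitF : 𝟙 a ⟶ F
  psi : B ≫ F ⟶ F ≫ B
  muM : F ≫ F ⟶ F ≫ B
  etaM : 𝟙 a ⟶ F ≫ B
  phi : F ≫ B ⟶ B ≫ F
  deltaC : F ≫ B ⟶ B ≫ B
  epsC : F ≫ B ⟶ 𝟙 a
  tauBF : B ≫ F ⟶ F ≫ B
  tauFB : F ≫ B ⟶ B ≫ F
  tauBB : B ≫ B ⟶ B ≫ B
  tauFF : F ≫ F ⟶ F ≫ F
  lamB : B ≫ B ⟶ B ≫ B
  lamF : F ≫ F ⟶ F ≫ F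

namespace PairedData

variable {K : Type u} [Bicategory.{w, v} K] {a : K} {B F : a ⟶ a} (P : PairedData B F)

/-- The canonical restrictions of the 2-cells of a paired wreath: the pre-multiplication of `F`, the
pre-comultiplication of `B`, the (co)actions, the 2-cocycle and the 2-cycle. -/
def toHopf : HopfData B F where
  mulB := P.mulB
  unitB := P.unitB
  comulB := (λ_ B).inv ≫ P.unitF ▷ B ≫ P.deltaC
  counitB := P.counitB
  mulF := P.muM ≫ F ◁ P.counitB ≫ (ρ_ F).hom
  unitF := P.unitF
  comulF := P.comulF
  counitF := P.counitF
  actL := P.psi ≫ F ◁ P.counitB ≫ (ρ_ F).hom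
  coactR := (λ_ B).inv ≫ P.unitF ▷ B ≫ P.phi
  actR := P.psi ≫ P.counitF ▷ B ≫ (λ_ B).hom
  coactL := (ρ_ F).inv ≫ F ◁ P.unitB ≫ P.phi
  sigma := P.muM ≫ P.counitF ▷ B ≫ (λ_ B).hom
  rho := (ρ_ F).inv ≫ F ◁ P.unitB ≫ P.deltaC
  tauBF := P.tauBF
  tauFB := P.tauFB
  tauBB := P.tauBB
  tauFF := P.tauFF

/-- The (co)multiplication and (co)unit of `FB`: wreath product and cowreath coproduct. -/
def cross : PreBimonad (F ≫ B) where
  mul := 𝟙 ((F ≫ B) ≫ F ≫ B) ⊗≫ F ◁ P.psi ▷ B ⊗≫ P.muM ▷ (B ≫ B) ⊗≫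
    F ◁ B ◁ P.mulB ⊗≫ F ◁ P.mulB
  unit := P.etaM
  comul := P.comulF ▷ B ⊗≫ P.comulF ▷ (F ≫ B) ⊗≫ F ◁ F ◁ P.deltaC ⊗≫ F ◁ P.phi ▷ B ⊗≫
    𝟙 ((F ≫ B) ≫ F ≫ B)
  counit := P.epsC

/-- The 2-cell `τ_{FB,FB}`. -/
def tauCross : (F ≫ B) ≫ F ≫ B ⟶ (F ≫ B) ≫ F ≫ B :=
  𝟙 ((F ≫ B) ≫ F ≫ B) ⊗≫ F ◁ P.tauBF ▷ B ⊗≫ P.tauFF ▷ (B ≫ B) ≫ (F ≫ F) ◁ P.tauBB ⊗≫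
    F ◁ P.tauFB ▷ B ⊗≫ 𝟙 ((F ≫ B) ≫ F ≫ B)

/-- The axioms of a paired wreath. -/
structure IsPairedWreath : Prop where
  -- (co)monads, (co)units
  monadB : P.toHopf.cellsB.IsMonad
  comonadF : P.toHopf.cellsF.IsComonad
  counit_mulB : P.toHopf.cellsB.CounitMul
  unit_counitB : P.toHopf.cellsB.UnitCounit
  unit_comulF : P.toHopf.cellsF.UnitComul
  unit_counitF : P.toHopf.cellsF.UnitCounit
  -- wreath and cowreath, with canonical (co)units
  wreath : IsLeftWreath P.mulB P.unitB P.psi P.muM P.etaM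
  cowreath : IsRightCowreath P.comulF P.counitF P.phi P.deltaC P.epsC
  etaM_restrict : P.unitF = P.etaM ≫ F ◁ P.counitB ≫ (ρ_ F).hom
  epsC_restrict : P.counitB = (λ_ B).inv ≫ P.unitF ▷ B ≫ P.epsC
  etaM_canonical : P.etaM = P.toHopf.etaM
  epsC_canonical : P.epsC = P.toHopf.epsC
  -- (co)units and pre-(co)multiplications
  unit_comulB : P.toHopf.cellsB.UnitComul
  counit_mulF : P.toHopf.cellsF.CounitMul
  -- the form of the distributive laws
  psi_counit : P.psi ≫ P.counitF ▷ B ≫ (λ_ B).hom ≫ P.counitB =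
    P.counitB ▷ F ≫ (λ_ F).hom ≫ P.counitF
  phi_unit : P.unitF ≫ (ρ_ F).inv ≫ F ◁ P.unitB ≫ P.phi = P.unitB ≫ (ρ_ B).inv ≫ B ◁ P.unitF
  psi_eq : P.psi = P.toHopf.psi
  phi_eq : P.phi = P.toHopf.phi
  tauBF : PreBimonad.IsDistributive P.toHopf.cellsB P.toHopf.cellsF P.tauBF
  tauFB : PreBimonad.IsDistributive P.toHopf.cellsF P.toHopf.cellsB P.tauFB
  tauBB : PreBimonad.IsDistributive P.toHopf.cellsB P.toHopf.cellsB P.tauBB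
  tauFF : PreBimonad.IsDistributive P.toHopf.cellsF P.toHopf.cellsF P.tauFF
  -- the 2-cells `λ_B`, `λ_F`
  proj_B :
    P.toHopf.comulB ▷ B ⊗≫ B ◁ P.lamB =
      P.toHopf.comulB ▷ B ≫ (B ≫ B) ◁ P.toHopf.comulB ⊗≫
        P.toHopf.coactR ▷ (B ≫ B ≫ B) ⊗≫ B ◁ F ◁ B ◁ P.toHopf.coactR ▷ B ⊗≫
        B ◁ F ◁ P.tauBB ▷ (F ≫ B) ⊗≫
        B ◁ P.tauFB ▷ (B ≫ F ≫ B) ⊗≫ B ◁ B ◁ F ◁ P.psi ▷ B ⊗≫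
        B ◁ B ◁ P.toHopf.sigma ▷ (B ≫ B) ⊗≫ B ◁ B ◁ P.mulB ▷ B ⊗≫ B ◁ B ◁ P.mulB
  proj_F :
    P.lamF ▷ F ⊗≫ F ◁ P.toHopf.mulF =
      𝟙 ((F ≫ F) ≫ F) ⊗≫
        P.comulF ▷ (F ≫ F) ⊗≫ F ◁ P.comulF ▷ (F ≫ F) ⊗≫ F ◁ F ◁ P.toHopf.rho ▷ (F ≫ F) ⊗≫
        F ◁ P.phi ▷ (B ≫ F ≫ F) ⊗≫ F ◁ B ◁ F ◁ P.tauBF ▷ F ⊗≫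
        F ◁ B ◁ P.tauFF ▷ (B ≫ F) ⊗≫ F ◁ B ◁ F ◁ F ◁ P.toHopf.actL ⊗≫
        F ◁ P.toHopf.actL ▷ (F ≫ F) ⊗≫ F ◁ F ◁ P.toHopf.mulF ⊗≫ P.toHopf.mulF ▷ F
  muM_eq : P.muM = F ◁ P.comulF ⊗≫ P.lamF ▷ F ⊗≫ F ◁ P.toHopf.sigma
  deltaC_eq : P.deltaC = P.toHopf.rho ▷ B ⊗≫ B ◁ P.lamB ⊗≫ P.mulB ▷ B
  -- `FB` is a bimonad
  bimonad : P.cross.IsTauBimonad P.tauCross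

end PairedData

/-- The 2-cells of a paired wreath that a Hopf datum determines. -/
def HopfData.toPaired {K : Type u} [Bicategory.{w, v} K] {a : K} {B F : a ⟶ a}
    (D : HopfData B F) : PairedData B F where
  mulB := D.mulB
  unitB := D.unitB
  counitB := D.counitB
  comulF := D.comulF
  counitF := D.counitF
  unitF := D.unitF
  psi := D.psi
  muM := D.muM
  etaM := D.etaM
  phi := D.phi
  deltaC := D.deltaC
  epsC := D.epsC
  tauBF := D.tauBF
  tauFB := D.tauFB
  tauBB := D.tauBB
  tauFF := D.tauFF
  lamB := D.lamB
  lamF := D.lamF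

end HopfPair

namespace HopfPair

/-! ### String diagrams as lists of layers -/

/-! When σ and ρ' are trivial, μ_M is μ_F followed by η_B on a new strand, and Δ_C is Δ_B with ε_F
on the discarded strand. The axioms of a Hopf datum then shrink to the list `hopf`: honest
(co)monads `B` and `F` that act and coact on each other, six mixed compatibilities
(`bialgebraRules`), the formula `psiPhi` for φψ, and naturality and Yang–Baxter for the crossings.
`hopfDatum_hopf` and `hopf_hopfDatum` pass between the two lists.

All axioms of a paired wreath but one follow from `hopf` by cancelling units and sliding cells past
each other. The exception is the equation Δ∇ = (∇∇)(1τ1)(ΔΔ) on `FB`, which becomes `bimonadRule`.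
There the comultiplications pass the products in `F` and `B`, and `phiMulMul` expands φ after these
products. What stays in the middle is ψ followed by Δ_F, Δ_B and φ; this is `psiComulPhi`. If λ_F is
trivial, φ lets a product in `F` through (`phiMulF`), so that after moving the comultiplications
past the actions only the composite φψ is left, and `psiPhi` evaluates it.

The other three cases cost nothing. Reflecting diagrams left to right while exchanging the letters,
and reflecting them top to bottom, both preserve `hopf` and `bimonadRule`, and together they permute
the four (co)actions transitively. A Hopf datum of valence at most three has at least one trivial
(co)action, so one of the four cases applies.

Conversely, closing strands of the wreath and cowreath axioms with units and counits yields the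
(co)module laws, and closing two inputs and two outputs of `bimonadRule` yields `psiPhi` and the six
compatibilities (`pairedWreath_hopf`). The cells λ^F and λ^B of a paired wreath are determined by
the other data, because a unit or counit undoes the (co)multiplication beside them in the projection
axioms (`PairedGen.axioms_lam`).

The calculations are made with formal string diagrams. `Derives` is provability of an equation from
given ones and the exchange law; a rewriting procedure, proved sound by `joins_sound`, checks the
concrete derivations by evaluation; `Model.eval_conv` transports them to every bicategory. The
classes `OneCell` and `TwoCell` translate bicategorical expressions into diagrams, so that an
equation of 2-cells amounts to the validity of a rule in a model (`TwoCell.eq_iff`). -/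

/-- A word in the two letters `B` (`false`) and `F` (`true`). -/
abbrev Word := List Bool

/-- Generating 2-cells, with their sources and targets. -/
class Signature (G : Type) where
  dom : G → Word
  cod : G → Word
  /-- a number that identifies the generator, for fast comparisons -/
  code : G → ℕ
  /-- evaluation of a generator to its normal form -/
  force {α : Type} : G → (G → α) → α
  force_eq {α : Type} (g : G) (f : G → α) : force g f = f g

open Signature

/-- A generating 2-cell between two families of vertical strands. -/
structure Layer (G : Type) where
  left : Word
  gen : G
  right : Word
deriving DecidableEq

/-- A string diagram, read from top to bottom. -/
abbrev Diagram (G : Type) := List (Layer G)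

/-- A pair of parallel string diagrams, which a model may identify. -/
structure Rule (G : Type) where
  src : Word
  tgt : Word
  lhs : Diagram G
  rhs : Diagram G
deriving DecidableEq

section Pad

variable {G : Type}

def padRight (d : Diagram G) (r : Word) : Diagram G :=
  d.map fun x => ⟨x.left, x.gen, x.right ++ r⟩

def padLeft (l : Word) (d : Diagram G) : Diagram G :=
  d.map fun x => ⟨l ++ x.left, x.gen, x.right⟩

@[simp] theorem padLeft_append (l : Word) (d e : Diagram G) :
    padLeft l (d ++ e) = padLeft l d ++ padLeft l e := List.map_append

@[simp] theorem padRight_append (d e : Diagram G) (r : Word) :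
    padRight (d ++ e) r = padRight d r ++ padRight e r := List.map_append

@[simp] theorem padLeft_cons (l : Word) (x : Layer G) (d : Diagram G) :
    padLeft l (x :: d) = ⟨l ++ x.left, x.gen, x.right⟩ :: padLeft l d := rfl

@[simp] theorem padRight_cons (x : Layer G) (d : Diagram G) (r : Word) :
    padRight (x :: d) r = ⟨x.left, x.gen, x.right ++ r⟩ :: padRight d r := rfl

@[simp] theorem padLeft_nil (l : Word) : padLeft l ([] : Diagram G) = [] := rfl

@[simp] theorem padRight_nil (r : Word) : padRight ([] : Diagram G) r = [] := rfl

theorem padLeft_padLeft (l l' : Word) (d : Diagram G) :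
    padLeft l (padLeft l' d) = padLeft (l ++ l') d := by
  simp [padLeft, Function.comp_def]

theorem padRight_padRight (r r' : Word) (d : Diagram G) :
    padRight (padRight d r) r' = padRight d (r ++ r') := by
  simp [padRight, Function.comp_def]

theorem padRight_padLeft (l r : Word) (d : Diagram G) :
    padRight (padLeft l d) r = padLeft l (padRight d r) := by
  simp [padLeft, padRight, Function.comp_def]

def Rule.symm (R : Rule G) : Rule G := ⟨R.src, R.tgt, R.rhs, R.lhs⟩

end Pad

/-! ### Typing of diagrams and the congruence generated by exchange and rules. -/

section

variable {G : Type} [Signature G]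

def Layer.src (x : Layer G) : Word := x.left ++ (dom x.gen ++ x.right)

def Layer.tgt (x : Layer G) : Word := x.left ++ (cod x.gen ++ x.right)

/-- The word on which a diagram ends, if it can be started on the given word. -/
def target : Diagram G → Word → Option Word
  | [], u => some u
  | x :: d, u => bif u == x.src then target d x.tgt else none

/-- The equivalence of diagrams generated by the exchange law and a list of rules. -/
inductive Conv (T : List (Rule G)) : Word → Diagram G → Diagram G → Prop
  | refl (u d) : Conv T u d d
  | symm {u d d'} : Conv T u d d' → Conv T u d' d
  | trans {u d d' d''} : Conv T u d d' → Conv T u d' d'' → Conv T u d d''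
  | exchange (u : Word) (pre post : Diagram G) (l : Word) (g : G) (m : Word) (h : G) (r : Word) :
      Conv T u
        (pre ++ ⟨l, g, m ++ (dom h ++ r)⟩ :: ⟨l ++ (cod g ++ m), h, r⟩ :: post)
        (pre ++ ⟨l ++ (dom g ++ m), h, r⟩ :: ⟨l, g, m ++ (cod h ++ r)⟩ :: post)
  -- The word reached by `pre` has to be checked: one side of a rule may be the empty diagram, which
  -- carries no record of the strands it sits on.
  | rule {R : Rule G} (hR : R ∈ T) (u : Word) (pre : Diagram G) (l r : Word) (post : Diagram G)
      (h : target pre u = some (l ++ (R.src ++ r))) :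
      Conv T u (pre ++ (padLeft l (padRight R.lhs r) ++ post))
        (pre ++ (padLeft l (padRight R.rhs r) ++ post))

/-- The rule `R` is a consequence of the rules `T`. -/
def Derives (T : List (Rule G)) (R : Rule G) : Prop := Conv T R.src R.lhs R.rhs

theorem target_append (d e : Diagram G) (u : Word) :
    target (d ++ e) u = (target d u).bind (target e) := by
  induction d generalizing u with
  | nil => rfl
  | cons x d ih =>
    simp only [List.cons_append, target]
    cases u == x.src <;> simp [ih]

theorem target_cons (x : Layer G) (d : Diagram G) (u : Word) :
    target (x :: d) u = if u = x.src then target d x.tgt else none := by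
  by_cases h : u = x.src
  · simp [target, h]
  · have : (u == x.src) = false := by simpa using h
    simp [target, h, this]

/-- Cancelling `l` and `r` shows that a padded diagram is ill-typed exactly where the original is,
so the equation covers failure as well as success. -/
theorem target_pad (l r : Word) (d : Diagram G) (u : Word) :
    target (padLeft l (padRight d r)) (l ++ (u ++ r)) =
      (target d u).map fun v => l ++ (v ++ r) := by
  induction d generalizing u with
  | nil => rfl
  | cons x d ih =>
    simp only [padRight_cons, padLeft_cons, target_cons]
    by_cases h : u = x.src
    · subst h
      have := ih x.tgt
      simp only [Layer.src, Layer.tgt, List.append_assoc] at this ⊢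
      simpa using this
    · have h' : ¬ l ++ (u ++ r) = (l ++ x.left) ++ (dom x.gen ++ (x.right ++ r)) := by
        intro e
        apply h
        have e' : l ++ (u ++ r) = l ++ (x.src ++ r) := by
          rw [e]; simp [Layer.src]
        exact List.append_cancel_right (List.append_cancel_left e')
      rw [if_neg h, Option.map_none]
      exact if_neg h'

namespace Conv

variable {T : List (Rule G)}

/-- Equivalent diagrams may be extended by strands on both sides, and by further layers. -/
theorem context {u : Word} {d d' : Diagram G} (c : Conv T u d d') (u₀ : Word)
    (pre : Diagram G) (l r : Word) (post : Diagram G)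
    (h : target pre u₀ = some (l ++ (u ++ r))) :
    Conv T u₀ (pre ++ (padLeft l (padRight d r) ++ post))
      (pre ++ (padLeft l (padRight d' r) ++ post)) := by
  induction c with
  | refl => exact .refl _ _
  | symm _ ih => exact (ih h).symm
  | trans _ _ ih ih' => exact (ih h).trans (ih' h)
  | exchange u pre' post' l' g m k r' =>
    have := Conv.exchange (T := T) u₀ (pre ++ padLeft l (padRight pre' r))
      (padLeft l (padRight post' r) ++ post) (l ++ l') g m k (r' ++ r)
    simpa using this
  | rule hR u pre' l' r' post' h' =>
    have := Conv.rule (T := T) hR u₀ (pre ++ padLeft l (padRight pre' r)) (l ++ l') (r' ++ r)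
      (padLeft l (padRight post' r) ++ post)
      (by rw [target_append, h, Option.bind_some, target_pad, h']; simp)
    simpa [padRight_padRight, padLeft_padLeft, padRight_padLeft] using this

theorem context' {u : Word} {d d' : Diagram G} (c : Conv T u d d')
    (pre post : Diagram G) (u₀ : Word) (h : target pre u₀ = some u) :
    Conv T u₀ (pre ++ (d ++ post)) (pre ++ (d' ++ post)) := by
  simpa [padLeft, padRight] using c.context u₀ pre [] [] post (by simpa using h)

/-- Consequences of consequences are consequences. -/
theorem cut {T' : List (Rule G)} (hT : ∀ R ∈ T, Derives T' R) {u : Word} {d d' : Diagram G}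
    (c : Conv T u d d') : Conv T' u d d' := by
  induction c with
  | refl => exact .refl _ _
  | symm _ ih => exact ih.symm
  | trans _ _ ih ih' => exact ih.trans ih'
  | exchange => exact .exchange ..
  | rule hR u pre l r post h => exact (hT _ hR).context u pre l r post h

end Conv

theorem derives_of_mem {T : List (Rule G)} {R : Rule G} (h : R ∈ T) : Derives T R := by
  simpa [padLeft, padRight, Derives] using
    Conv.rule h R.src [] [] [] [] (by simp [target])

theorem Derives.symm {T : List (Rule G)} {R : Rule G} (h : Derives T R) : Derives T R.symm :=
  Conv.symm h

theorem Derives.cut {T T' : List (Rule G)} {R : Rule G} (h : Derives T R)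
    (hT : ∀ R ∈ T, Derives T' R) : Derives T' R :=
  Conv.cut hT h

/-- Both sides of the rule are diagrams with the stated source and target. -/
def Rule.WellTyped (R : Rule G) : Prop :=
  target R.lhs R.src = some R.tgt ∧ target R.rhs R.src = some R.tgt

instance (R : Rule G) : Decidable R.WellTyped := inferInstanceAs (Decidable (_ ∧ _))

/-- An exchange keeps both outer words, and the two sides of a well-typed rule end on the same word.
This supplies the starting word of the reversed diagrams in `Conv.flip`, also at the intermediate
stages of a derivation. -/
theorem Conv.target_eq {T : List (Rule G)} (hT : ∀ R ∈ T, R.WellTyped) {u : Word}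
    {d d' : Diagram G} (c : Conv T u d d') : target d u = target d' u := by
  induction c with
  | refl => rfl
  | symm _ ih => exact ih.symm
  | trans _ _ ih ih' => exact ih.trans ih'
  | exchange u pre post l g m h r =>
    simp only [target_append]
    congr 1
    funext u
    simp [target_cons, Layer.src, Layer.tgt]
  | rule hR u pre l r post h =>
    simp only [target_append, h, Option.bind_some, target_pad, (hT _ hR).1, (hT _ hR).2]

end

section Layers

variable {G : Type} [Signature G]

/-- The diagram with the given generators at the given positions. -/
def layers : Word → List (ℕ × G) → Diagram G
  | _, [] => []
  | u, (p, g) :: d =>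
    ⟨u.take p, g, u.drop (p + (dom g).length)⟩ ::
      layers (u.take p ++ (cod g ++ u.drop (p + (dom g).length))) d

/-- The target is read off from the left-hand side. The default `[]` stands for an ill-typed one,
which the `WellTyped` checks exclude before the rule is used. -/
def mkRule (u : Word) (d d' : List (ℕ × G)) : Rule G :=
  ⟨u, (target (layers u d) u).getD [], layers u d, layers u d'⟩

def shift (n : ℕ) (d : List (ℕ × G)) : List (ℕ × G) := d.map fun x => (n + x.1, x.2)

end Layers

/-! ### Dualities of string diagrams -/

/-- A reflection of the generating 2-cells at a horizontal line. -/
class VerticalFlip (G : Type) [Signature G] where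
  flip : G → G
  dom_flip : ∀ g, dom (flip g) = cod g
  cod_flip : ∀ g, cod (flip g) = dom g

def mirrorWord (u : Word) : Word := (u.map not).reverse

/-- A reflection of the generating 2-cells at a vertical line, exchanging the two letters. -/
class Mirror (G : Type) [Signature G] where
  mirror : G → G
  dom_mirror : ∀ g, dom (mirror g) = mirrorWord (dom g)
  cod_mirror : ∀ g, cod (mirror g) = mirrorWord (cod g)

section Duality

variable {G : Type} [Signature G]

@[simp] theorem mirrorWord_append (u v : Word) :
    mirrorWord (u ++ v) = mirrorWord v ++ mirrorWord u := by
  simp [mirrorWord]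

section Mirror

variable [Mirror G]

open Mirror

def Layer.mirror (x : Layer G) : Layer G :=
  ⟨mirrorWord x.right, Mirror.mirror x.gen, mirrorWord x.left⟩

def mirrorDiagram (d : Diagram G) : Diagram G := d.map Layer.mirror

def Rule.mirror (R : Rule G) : Rule G :=
  ⟨mirrorWord R.src, mirrorWord R.tgt, mirrorDiagram R.lhs, mirrorDiagram R.rhs⟩

@[simp] theorem mirrorDiagram_append (d e : Diagram G) :
    mirrorDiagram (d ++ e) = mirrorDiagram d ++ mirrorDiagram e := List.map_append

@[simp] theorem mirrorDiagram_cons (x : Layer G) (d : Diagram G) :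
    mirrorDiagram (x :: d) = x.mirror :: mirrorDiagram d := rfl

theorem Layer.src_mirror (x : Layer G) : x.mirror.src = mirrorWord x.src := by
  simp [Layer.src, Layer.mirror, dom_mirror]

theorem Layer.tgt_mirror (x : Layer G) : x.mirror.tgt = mirrorWord x.tgt := by
  simp [Layer.tgt, Layer.mirror, cod_mirror]

theorem target_mirror {d : Diagram G} {u v : Word} (h : target d u = some v) :
    target (mirrorDiagram d) (mirrorWord u) = some (mirrorWord v) := by
  induction d generalizing u with
  | nil => simp_all [target, mirrorDiagram]
  | cons x d ih =>
    rw [target_cons] at h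
    split_ifs at h with hu
    subst hu
    rw [mirrorDiagram_cons, target_cons, Layer.src_mirror, Layer.tgt_mirror, if_pos rfl, ih h]

theorem mirrorDiagram_pad (l r : Word) (d : Diagram G) :
    mirrorDiagram (padLeft l (padRight d r)) =
      padLeft (mirrorWord r) (padRight (mirrorDiagram d) (mirrorWord l)) := by
  simp [mirrorDiagram, padLeft, padRight, Layer.mirror, Function.comp_def]

/-- Reflection turns two side-by-side generators around, so an exchange becomes an exchange read
backwards; a rule becomes a mirrored rule. -/
theorem Conv.mirror {T : List (Rule G)} {u : Word} {d d' : Diagram G} (c : Conv T u d d') :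
    Conv (T.map Rule.mirror) (mirrorWord u) (mirrorDiagram d) (mirrorDiagram d') := by
  induction c with
  | refl => exact .refl _ _
  | symm _ ih => exact ih.symm
  | trans _ _ ih ih' => exact ih.trans ih'
  | exchange u pre post l g m h r =>
    have := Conv.exchange (T := T.map Rule.mirror) (mirrorWord u) (mirrorDiagram pre)
      (mirrorDiagram post) (mirrorWord r) (Mirror.mirror h) (mirrorWord m) (Mirror.mirror g)
      (mirrorWord l)
    simpa [Layer.mirror, dom_mirror, cod_mirror] using this.symm
  | rule hR u pre l r post h =>
    simp only [mirrorDiagram_append, mirrorDiagram_pad]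
    refine Conv.rule (List.mem_map_of_mem hR) (mirrorWord u) (mirrorDiagram pre) (mirrorWord r)
      (mirrorWord l) (mirrorDiagram post) ?_
    rw [target_mirror h]
    simp [Rule.mirror]

theorem Derives.mirror {T : List (Rule G)} {R : Rule G} (h : Derives T R) :
    Derives (T.map Rule.mirror) R.mirror :=
  Conv.mirror h

end Mirror

section Flip

variable [VerticalFlip G]

open VerticalFlip

def Layer.flip (x : Layer G) : Layer G := ⟨x.left, VerticalFlip.flip x.gen, x.right⟩

def flipDiagram (d : Diagram G) : Diagram G := (d.map Layer.flip).reverse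

def Rule.flip (R : Rule G) : Rule G := ⟨R.tgt, R.src, flipDiagram R.lhs, flipDiagram R.rhs⟩

@[simp] theorem flipDiagram_append (d e : Diagram G) :
    flipDiagram (d ++ e) = flipDiagram e ++ flipDiagram d := by
  simp [flipDiagram]

@[simp] theorem flipDiagram_cons (x : Layer G) (d : Diagram G) :
    flipDiagram (x :: d) = flipDiagram d ++ [x.flip] := by
  simp [flipDiagram]

theorem Layer.src_flip (x : Layer G) : x.flip.src = x.tgt := by
  simp [Layer.src, Layer.tgt, Layer.flip, dom_flip]

theorem Layer.tgt_flip (x : Layer G) : x.flip.tgt = x.src := by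
  simp [Layer.src, Layer.tgt, Layer.flip, cod_flip]

theorem target_flip {d : Diagram G} {u v : Word} (h : target d u = some v) :
    target (flipDiagram d) v = some u := by
  induction d generalizing u with
  | nil => simp_all [target, flipDiagram]
  | cons x d ih =>
    rw [target_cons] at h
    split_ifs at h with hu
    subst hu
    rw [flipDiagram_cons, target_append, ih h]
    simp [Layer.src_flip, Layer.tgt_flip, target]

theorem flipDiagram_pad (l r : Word) (d : Diagram G) :
    flipDiagram (padLeft l (padRight d r)) = padLeft l (padRight (flipDiagram d) r) := by
  simp [flipDiagram, padLeft, padRight, Layer.flip, Function.comp_def]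

/-- A flipped diagram starts where the original ended. Hence typing enters here, in contrast to
`Conv.mirror`: the end word `v` has to be the same for all diagrams of the derivation. -/
theorem Conv.flip {T : List (Rule G)} (hT : ∀ R ∈ T, R.WellTyped) {u v : Word}
    {d d' : Diagram G} (c : Conv T u d d') (hd : target d u = some v) :
    Conv (T.map Rule.flip) v (flipDiagram d) (flipDiagram d') := by
  induction c with
  | refl => exact .refl _ _
  | symm c ih => exact (ih ((c.target_eq hT).trans hd)).symm
  | trans c _ ih ih' => exact (ih hd).trans (ih' ((c.target_eq hT).symm.trans hd))
  | exchange u pre post l g m h r =>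
    have := Conv.exchange (T := T.map Rule.flip) v (flipDiagram post)
      (flipDiagram pre) l (VerticalFlip.flip g) m (VerticalFlip.flip h) r
    simpa [Layer.flip, dom_flip, cod_flip] using this.symm
  | @rule R hR u pre l r post h =>
    have := Conv.rule (List.mem_map_of_mem (f := Rule.flip) hR) v (flipDiagram post) l r
      (flipDiagram pre) (by
        rw [target_append, h, Option.bind_some, target_append, target_pad, (hT _ hR).1,
          Option.map_some, Option.bind_some] at hd
        exact target_flip hd)
    simpa [flipDiagram_pad, Rule.flip] using this

theorem Derives.flip {T : List (Rule G)} (hT : ∀ R ∈ T, R.WellTyped) {R : Rule G}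
    (hR : R.WellTyped) (h : Derives T R) : Derives (T.map Rule.flip) R.flip :=
  Conv.flip hT h hR.1

end Flip

end Duality

end HopfPair

namespace HopfPair
open Signature

/-! ### A verified rewriting procedure for string diagrams -/

/-- `strip p u` is `m` if `u = p ++ m`. -/
def strip : Word → Word → Option Word
  | [], u => some u
  | _ :: _, [] => none
  | a :: p, b :: u => bif a then bif b then strip p u else none
    else bif b then none else strip p u

theorem strip_eq_some {p u m : Word} : strip p u = some m ↔ u = p ++ m := by
  induction p generalizing u with
  | nil => simp [strip]
  | cons a p ih =>
    cases u with
    | nil => simp [strip]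
    | cons b u => cases a <;> cases b <;> simp [strip, ih]

/-! ### Diagrams recorded only by positions and generators. -/

section Sequences

variable {G : Type} [Signature G]

/-- The word on which a sequence of generators at the given positions ends. -/
def after : List (ℕ × G) → Word → Option Word
  | [], u => some u
  | x :: d, u => match strip (dom x.2) (u.drop x.1) with
    | none => none
    -- The bound matters for generators with empty source: such a source would also match the empty
    -- remainder at a position beyond the end of the word.
    | some r => bif x.1.ble u.length then after d (u.take x.1 ++ (cod x.2 ++ r)) else none

theorem after_cons {x : ℕ × G} {d : List (ℕ × G)} {u v : Word} :
    after (x :: d) u = some v ↔ ∃ l r, u = l ++ (dom x.2 ++ r) ∧ x.1 = l.length ∧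
      after d (l ++ (cod x.2 ++ r)) = some v := by
  constructor
  · intro h
    unfold after at h
    split at h
    · simp at h
    · rename_i r hr
      rw [strip_eq_some] at hr
      cases hx : x.1.ble u.length
      · simp [hx] at h
      · rw [hx, cond_true] at h
        refine ⟨u.take x.1, r, by rw [← hr, List.take_append_drop], ?_, h⟩
        have := Nat.le_of_ble_eq_true hx
        simp [this]
  · rintro ⟨l, r, rfl, hl, h⟩
    have hx : x.1.ble (l ++ (dom x.2 ++ r)).length = true := by
      simp [hl, Nat.ble_eq]
    unfold after
    rw [hx, hl, List.drop_left, strip_eq_some.2 rfl, List.take_left]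
    exact h

theorem after_append (d e : List (ℕ × G)) (u : Word) :
    after (d ++ e) u = (after d u).bind (after e) := by
  induction d generalizing u with
  | nil => rfl
  | cons x d ih =>
    simp only [List.cons_append, after]
    cases strip (dom x.2) (u.drop x.1) <;> cases x.1.ble u.length <;> simp [ih]

theorem layers_cons {x : ℕ × G} (d : List (ℕ × G)) {l : Word} (r : Word) (hl : x.1 = l.length) :
    layers (l ++ (dom x.2 ++ r)) (x :: d) = ⟨l, x.2, r⟩ :: layers (l ++ (cod x.2 ++ r)) d := by
  have h : (l ++ (dom x.2 ++ r)).drop (x.1 + (dom x.2).length) = r := by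
    rw [hl, ← List.append_assoc, ← List.length_append, List.drop_left]
  rw [layers, h, hl, List.take_left]

theorem target_layers {d : List (ℕ × G)} {u v : Word} (h : after d u = some v) :
    target (layers u d) u = some v := by
  induction d generalizing u with
  | nil => simpa [layers, target, after] using h
  | cons x d ih =>
    obtain ⟨l, r, hu, hl, h'⟩ := after_cons.1 h
    subst hu
    rw [layers_cons d r hl, target_cons]
    exact (if_pos rfl).trans (ih h')

theorem layers_append {d : List (ℕ × G)} (e : List (ℕ × G)) {u v : Word}
    (h : after d u = some v) : layers u (d ++ e) = layers u d ++ layers v e := by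
  induction d generalizing u with
  | nil =>
    obtain rfl : u = v := by simpa [after] using h
    rfl
  | cons x d ih =>
    obtain ⟨l, r, hu, hl, h'⟩ := after_cons.1 h
    subst hu
    rw [List.cons_append, layers_cons _ r hl, layers_cons d r hl, ih h', List.cons_append]

/-- The positions of the generators in a diagram. -/
def unlayer (d : Diagram G) : List (ℕ × G) := d.map fun x => (x.left.length, x.gen)

/-- In a typed diagram the strands beside a generator are determined by its position and the
starting word, so forgetting them loses nothing. -/
theorem layers_unlayer {d : Diagram G} {u v : Word} (h : target d u = some v) :
    after (unlayer d) u = some v ∧ layers u (unlayer d) = d := by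
  induction d generalizing u with
  | nil => simpa [target, after, unlayer, layers] using h
  | cons x d ih =>
    rw [target_cons] at h
    split_ifs at h with hu
    obtain ⟨h₁, h₂⟩ := ih h
    refine ⟨after_cons.2 ⟨x.left, x.right, hu, rfl, h₁⟩, ?_⟩
    have := layers_cons (x := (x.left.length, x.gen)) (unlayer d) x.right rfl
    subst hu
    exact this.trans (congrArg _ h₂)

theorem after_shift {d : List (ℕ × G)} {u v : Word} (h : after d u = some v) (l r : Word) :
    after (shift l.length d) (l ++ (u ++ r)) = some (l ++ (v ++ r)) ∧
      layers (l ++ (u ++ r)) (shift l.length d) = padLeft l (padRight (layers u d) r) := by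
  induction d generalizing u with
  | nil =>
    obtain rfl : u = v := by simpa [after] using h
    exact ⟨rfl, rfl⟩
  | cons x d ih =>
    obtain ⟨l', r', hu, hl, h'⟩ := after_cons.1 h
    subst hu
    obtain ⟨h₁, h₂⟩ := ih h'
    have e : l ++ ((l' ++ (dom x.2 ++ r')) ++ r) = (l ++ l') ++ (dom x.2 ++ (r' ++ r)) := by simp
    have e' : l ++ ((l' ++ (cod x.2 ++ r')) ++ r) = (l ++ l') ++ (cod x.2 ++ (r' ++ r)) := by simp
    have hx : (l.length + x.1, x.2).1 = (l ++ l').length := by simp [hl]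
    refine ⟨after_cons.2 ⟨l ++ l', r' ++ r, e, hx, by rw [← e']; exact h₁⟩, ?_⟩
    rw [layers_cons d r' hl, e]
    refine (layers_cons (x := (l.length + x.1, x.2)) (shift l.length d) _ hx).trans ?_
    rw [padRight_cons, padLeft_cons, ← h₂, e']

/-- If the sequence `d` leads from `u` to `v`, then so does `e`, and they represent equivalent
diagrams. -/
def Reduces (T : List (Rule G)) (u : Word) (d e : List (ℕ × G)) : Prop :=
  ∀ v, after d u = some v → after e u = some v ∧ Conv T u (layers u d) (layers u e)

namespace Reduces

variable {T : List (Rule G)} {u : Word} {d e f : List (ℕ × G)}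

theorem refl (T : List (Rule G)) (u : Word) (d : List (ℕ × G)) : Reduces T u d d :=
  fun _ h => ⟨h, .refl _ _⟩

theorem trans (h : Reduces T u d e) (h' : Reduces T u e f) : Reduces T u d f := fun v hd =>
  let ⟨he, c⟩ := h v hd
  let ⟨hf, c'⟩ := h' v he
  ⟨hf, c.trans c'⟩

theorem context {w : Word} (pre post : List (ℕ × G)) (hw : after pre u = some w)
    (h : Reduces T w d e) : Reduces T u (pre ++ (d ++ post)) (pre ++ (e ++ post)) := by
  intro v hv
  simp only [after_append, hw, Option.bind_some] at hv ⊢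
  obtain ⟨w', hd⟩ : ∃ w', after d w = some w' := by
    cases hd : after d w
    · simp [hd] at hv
    · exact ⟨_, rfl⟩
  obtain ⟨he, c⟩ := h w' hd
  rw [hd] at hv
  refine ⟨by rw [he]; exact hv, ?_⟩
  rw [layers_append _ hw, layers_append _ hw, layers_append _ hd, layers_append _ he]
  exact c.context' _ _ u (target_layers hw)

/-- Exchanges are valid over every word, so nothing need be known about the word reached after
`pre`; if there is none, the hypothesis in `Reduces` fails. -/
theorem of_forall (pre post : List (ℕ × G)) (h : ∀ w, Reduces T w d e) :
    Reduces T u (pre ++ (d ++ post)) (pre ++ (e ++ post)) := by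
  intro v hv
  obtain ⟨w, hw⟩ : ∃ w, after pre u = some w := by
    cases hd : after pre u
    · simp [after_append, hd] at hv
    · exact ⟨_, rfl⟩
  exact (h w).context pre post hw v hv

theorem exchange_right (x y : ℕ × G) (h : x.1 + (cod x.2).length ≤ y.1) (u : Word) :
    Reduces T u [x, y] [(y.1 - (cod x.2).length + (dom x.2).length, y.2), x] := by
  intro v hv
  obtain ⟨l, r, rfl, hl, hv⟩ := after_cons.1 hv
  obtain ⟨l', r', e, hl', hv⟩ := after_cons.1 hv
  obtain rfl : l' ++ (cod y.2 ++ r') = v := by simpa [after] using hv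
  -- `m` is the family of strands between the two generators. The inequality of positions makes it
  -- exist; in the second alternative below the generators touch and `m` is empty.
  obtain ⟨m, rfl, rfl⟩ : ∃ m, l' = l ++ (cod x.2 ++ m) ∧ r = m ++ (dom y.2 ++ r') := by
    rw [← List.append_assoc] at e
    rcases List.append_eq_append_iff.1 e with ⟨m, h₁, h₂⟩ | ⟨m, h₁, h₂⟩
    · exact ⟨m, by simpa using h₁, h₂⟩
    · have : m = [] := by
        have := congrArg List.length h₁
        simp only [List.length_append] at this
        exact List.eq_nil_of_length_eq_zero (by omega)
      subst this
      exact ⟨[], by simpa using h₁.symm, by simpa using h₂.symm⟩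
  have a₁ : l ++ (dom x.2 ++ (m ++ (dom y.2 ++ r'))) =
    (l ++ (dom x.2 ++ m)) ++ (dom y.2 ++ r') := by simp
  have a₂ : (l ++ (dom x.2 ++ m)) ++ (cod y.2 ++ r') =
    l ++ (dom x.2 ++ (m ++ (cod y.2 ++ r'))) := by simp
  have a₃ : (l ++ (cod x.2 ++ m)) ++ (cod y.2 ++ r') =
    l ++ (cod x.2 ++ (m ++ (cod y.2 ++ r'))) := by simp
  have a₄ : l ++ (cod x.2 ++ (m ++ (dom y.2 ++ r'))) =
    (l ++ (cod x.2 ++ m)) ++ (dom y.2 ++ r') := by simp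
  have hp : (y.1 - (cod x.2).length + (dom x.2).length, y.2).1 =
      (l ++ (dom x.2 ++ m)).length := by
    simp only [List.length_append] at hl' ⊢
    omega
  have h₁ : layers (l ++ (dom x.2 ++ (m ++ (dom y.2 ++ r'))))
      [(y.1 - (cod x.2).length + (dom x.2).length, y.2), x] =
      [⟨l ++ (dom x.2 ++ m), y.2, r'⟩, ⟨l, x.2, m ++ (cod y.2 ++ r')⟩] := by
    rw [a₁]
    refine (layers_cons (x := (y.1 - (cod x.2).length + (dom x.2).length, y.2)) [x] r' hp).trans ?_
    rw [a₂, layers_cons [] _ hl]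
    rfl
  have h₂ : layers (l ++ (dom x.2 ++ (m ++ (dom y.2 ++ r')))) [x, y] =
      [⟨l, x.2, m ++ (dom y.2 ++ r')⟩, ⟨l ++ (cod x.2 ++ m), y.2, r'⟩] := by
    rw [layers_cons [y] _ hl, a₄, layers_cons [] _ hl']
    rfl
  refine ⟨after_cons.2 ⟨_, _, a₁, hp, ?_⟩, ?_⟩
  · rw [a₂]
    exact after_cons.2 ⟨_, _, rfl, hl, by rw [a₃]; rfl⟩
  · rw [h₁, h₂]
    exact Conv.exchange _ [] [] l x.2 m y.2 r'

theorem exchange_left (x y : ℕ × G) (h : y.1 + (dom y.2).length ≤ x.1) (u : Word) :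
    Reduces T u [x, y] [y, (x.1 - (dom y.2).length + (cod y.2).length, x.2)] := by
  intro v hv
  obtain ⟨l, r, rfl, hl, hv⟩ := after_cons.1 hv
  obtain ⟨l', r', e, hl', hv⟩ := after_cons.1 hv
  obtain rfl : l' ++ (cod y.2 ++ r') = v := by simpa [after] using hv
  obtain ⟨m, rfl, rfl⟩ : ∃ m, l = l' ++ (dom y.2 ++ m) ∧ r' = m ++ (cod x.2 ++ r) := by
    have e' := e.symm
    rw [← List.append_assoc] at e'
    rcases List.append_eq_append_iff.1 e' with ⟨m, h₁, h₂⟩ | ⟨m, h₁, h₂⟩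
    · exact ⟨m, by simpa using h₁, h₂⟩
    · have : m = [] := by
        have := congrArg List.length h₁
        simp only [List.length_append] at this
        exact List.eq_nil_of_length_eq_zero (by omega)
      subst this
      exact ⟨[], by simpa using h₁.symm, by simpa using h₂.symm⟩
  have a₁ : (l' ++ (dom y.2 ++ m)) ++ (dom x.2 ++ r) =
    l' ++ (dom y.2 ++ (m ++ (dom x.2 ++ r))) := by simp
  have a₂ : l' ++ (cod y.2 ++ (m ++ (dom x.2 ++ r))) =
    (l' ++ (cod y.2 ++ m)) ++ (dom x.2 ++ r) := by simp
  have a₃ : l' ++ (cod y.2 ++ (m ++ (cod x.2 ++ r))) =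
    (l' ++ (cod y.2 ++ m)) ++ (cod x.2 ++ r) := by simp
  have a₄ : (l' ++ (dom y.2 ++ m)) ++ (cod x.2 ++ r) =
    l' ++ (dom y.2 ++ (m ++ (cod x.2 ++ r))) := by simp
  have hp : (x.1 - (dom y.2).length + (cod y.2).length, x.2).1 =
      (l' ++ (cod y.2 ++ m)).length := by
    simp only [List.length_append] at hl ⊢
    omega
  have h₁ : layers ((l' ++ (dom y.2 ++ m)) ++ (dom x.2 ++ r))
      [y, (x.1 - (dom y.2).length + (cod y.2).length, x.2)] =
      [⟨l', y.2, m ++ (dom x.2 ++ r)⟩, ⟨l' ++ (cod y.2 ++ m), x.2, r⟩] := by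
    rw [a₁, layers_cons _ _ hl', a₂]
    refine congrArg _ ((layers_cons (x := (x.1 - (dom y.2).length + (cod y.2).length, x.2))
      [] r hp).trans ?_)
    rfl
  have h₂ : layers ((l' ++ (dom y.2 ++ m)) ++ (dom x.2 ++ r)) [x, y] =
      [⟨l' ++ (dom y.2 ++ m), x.2, r⟩, ⟨l', y.2, m ++ (cod x.2 ++ r)⟩] := by
    rw [layers_cons [y] _ hl, a₄, layers_cons [] _ hl']
    rfl
  refine ⟨?_, ?_⟩
  · rw [a₁]
    refine after_cons.2 ⟨_, _, rfl, hl', ?_⟩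
    rw [a₂]
    exact after_cons.2 ⟨_, _, rfl, hp, by rw [a₃]; rfl⟩
  · rw [h₁, h₂]
    exact (Conv.exchange _ [] [] l' y.2 m x.2 r).symm

theorem rule {R : Rule G} (hR : Derives T R) (hT : R.WellTyped) (l r : Word) :
    Reduces T (l ++ (R.src ++ r)) (shift l.length (unlayer R.lhs))
      (shift l.length (unlayer R.rhs)) := by
  obtain ⟨h₁, h₂⟩ := layers_unlayer hT.1
  obtain ⟨h₃, h₄⟩ := layers_unlayer hT.2
  obtain ⟨h₅, h₆⟩ := after_shift h₁ l r
  obtain ⟨h₇, h₈⟩ := after_shift h₃ l r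
  intro v hv
  refine ⟨h₇.trans (h₅.symm.trans hv), ?_⟩
  rw [h₆, h₈, h₂, h₄]
  simpa using Conv.context hR (l ++ (R.src ++ r)) [] l r [] rfl

end Reduces

end Sequences

end HopfPair

namespace HopfPair
open Signature

/-! ### Matching up to exchange, rewriting, and the test for isotopy. -/

section Rewriting

variable {G : Type} [Signature G]

/-- Exchange two consecutive generators, if they act on disjoint strands. -/
def exchange (x y : ℕ × G) : Option ((ℕ × G) × (ℕ × G)) :=
  bif (x.1 + (cod x.2).length).ble y.1 then
    some ((y.1 - (cod x.2).length + (dom x.2).length, y.2), x)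
  else bif (y.1 + (dom y.2).length).ble x.1 then
    some (y, (x.1 - (dom y.2).length + (cod y.2).length, x.2))
  else none

theorem exchange_sound {T : List (Rule G)} {x y x' y' : ℕ × G}
    (h : exchange x y = some (y', x')) (u : Word) : Reduces T u [x, y] [y', x'] := by
  unfold exchange at h
  cases h₁ : (x.1 + (cod x.2).length).ble y.1
  · rw [h₁, cond_false] at h
    cases h₂ : (y.1 + (dom y.2).length).ble x.1
    · simp [h₂] at h
    · simp only [h₂, cond_true, Option.some.injEq, Prod.mk.injEq] at h
      obtain ⟨rfl, rfl⟩ := h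
      exact .exchange_left x y (Nat.le_of_ble_eq_true h₂) u
  · simp only [h₁, cond_true, Option.some.injEq, Prod.mk.injEq] at h
    obtain ⟨rfl, rfl⟩ := h
    exact .exchange_right x y (Nat.le_of_ble_eq_true h₁) u

/-- Move the generator `y`, which follows the sequence `d`, to the front of `d`. -/
def pull : List (ℕ × G) → ℕ × G → Option ((ℕ × G) × List (ℕ × G))
  | [], y => some (y, [])
  | x :: d, y => match pull d y with
    | none => none
    | some (y', d') => match exchange x y' with
      | none => none
      | some (y'', x') => some (y'', x' :: d')

theorem pull_sound {T : List (Rule G)} {d d' : List (ℕ × G)} {y y' : ℕ × G}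
    (h : pull d y = some (y', d')) (u : Word) (pre post : List (ℕ × G)) :
    Reduces T u (pre ++ (d ++ y :: post)) (pre ++ y' :: (d' ++ post)) := by
  induction d generalizing y' d' pre with
  | nil =>
    simp only [pull, Option.some.injEq, Prod.mk.injEq] at h
    obtain ⟨rfl, rfl⟩ := h
    exact .refl _ _ _
  | cons x d ih =>
    unfold pull at h
    split at h
    · simp at h
    · rename_i z e hz
      split at h
      · simp at h
      · rename_i y'' x' hx
        simp only [Option.some.injEq, Prod.mk.injEq] at h
        obtain ⟨rfl, rfl⟩ := h
        have h₁ := ih hz (pre ++ [x])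
        have h₂ := Reduces.of_forall (T := T) (u := u) pre (e ++ post) (exchange_sound hx)
        simp only [List.append_assoc, List.cons_append, List.nil_append] at h₁ h₂ ⊢
        exact h₁.trans h₂

/-- Collect the generators of a pattern below the generators `block` already found. The generators
passed over that depend on `block` are kept in `wait`, the others are moved to `pre`. -/
def gather : List (ℕ × G) → ℕ → List (ℕ × G) → List (ℕ × G) → List (ℕ × G) → List (ℕ × G) →
    Option (List (ℕ × G) × List (ℕ × G) × List (ℕ × G))
  | pat, off, pre, block, wait, post =>
    match pat with
    | [] => some (pre, block, wait ++ post)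
    | q :: pat' => match post with
      | [] => none
      | x :: post' => match pull wait x with
        | none => gather (q :: pat') off pre block (wait ++ [x]) post'
        | some (y, wait') =>
          -- The offset of `y` from the head of the block is compared with that of `q` from the head
          -- of the pattern; the equation is written with sums because subtraction truncates.
          bif (code y.2).beq (code q.2) && (y.1 + off).beq (q.1 + (block.headD y).1) then
            gather pat' off pre (block ++ [y]) wait' post'
          else match pull block y with
            | none => gather (q :: pat') off pre block (wait ++ [x]) post'
            | some (z, block') => gather (q :: pat') off (pre ++ [z]) block' wait' post'
termination_by structural _ _ _ _ _ post => post

theorem gather_sound {T : List (Rule G)} (u : Word) (pat : List (ℕ × G)) (off : ℕ)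
    (pre block wait post p b q : List (ℕ × G))
    (h : gather pat off pre block wait post = some (p, b, q)) :
    Reduces T u (pre ++ (block ++ (wait ++ post))) (p ++ (b ++ q)) := by
  induction post generalizing pat pre block wait with
  | nil =>
    cases pat with
    | nil =>
      simp only [gather, Option.some.injEq, Prod.mk.injEq] at h
      obtain ⟨rfl, rfl, rfl⟩ := h
      exact .refl _ _ _
    | cons => simp [gather] at h
  | cons x post ih =>
    cases pat with
    | nil =>
      simp only [gather, Option.some.injEq, Prod.mk.injEq] at h
      obtain ⟨rfl, rfl, rfl⟩ := h
      exact .refl _ _ _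
    | cons k pat =>
      unfold gather at h
      simp only at h
      split at h
      · simpa using ih _ _ _ _ h
      · rename_i y wait' hy
        have h₁ := pull_sound (T := T) hy u (pre ++ block) post
        generalize ((code y.2).beq (code k.2) && (y.1 + off).beq (k.1 + (block.headD y).1)) = c
          at h
        cases c
        · simp only [cond_false] at h
          split at h
          · simpa using ih _ _ _ _ h
          · rename_i z block' hz
            have h₂ := pull_sound (T := T) hz u pre (wait' ++ post)
            have h₃ := ih _ _ _ _ h
            simp only [List.append_assoc, List.cons_append, List.nil_append] at h₁ h₂ h₃ ⊢
            exact h₁.trans (h₂.trans h₃)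
        · simp only [cond_true] at h
          have h₃ := ih _ _ _ _ h
          simp only [List.append_assoc, List.cons_append, List.nil_append] at h₁ h₃ ⊢
          exact h₁.trans h₃

/-- Evaluate a number. -/
def forceNat {α : Type} : ℕ → (ℕ → α) → α
  | 0, f => f 0
  | n + 1, f => f n.succ

/-- The forcing functions are evaluations in continuation style: matching on the argument makes it
be computed before it is passed on, without altering the result. -/
theorem forceNat_eq {α : Type} (n : ℕ) (f : ℕ → α) : forceNat n f = f n := by
  cases n <;> rfl

/-- Evaluate all entries of a list. -/
def forceList {α : Type} : List (ℕ × G) → (List (ℕ × G) → α) → α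
  | [], f => f []
  | x :: d, f => forceNat x.1 fun p => force x.2 fun g => forceList d fun e => f ((p, g) :: e)

theorem forceList_eq {α : Type} (d : List (ℕ × G)) (f : List (ℕ × G) → α) :
    forceList d f = f d := by
  induction d generalizing f with
  | nil => rfl
  | cons x d ih => simp [forceList, forceNat_eq, force_eq, ih]

/-- The set of generators that occur in a sequence, as a number in binary notation. -/
def mask : List (ℕ × G) → ℕ
  | [] => 0
  | x :: d => (Nat.shiftLeft 1 (code x.2)).lor (mask d)

/-- Evaluate the left-hand sides of rules, and the sets of generators in them. -/
def prepare {α : Type} :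
    List (Rule G) → (List (ℕ × List (ℕ × G) × Rule G) → α) → α
  | [], f => f []
  | R :: Rs, f => forceList (unlayer R.lhs) fun l => forceNat (mask l) fun m =>
    prepare Rs fun cs => f ((m, l, R) :: cs)

theorem prepare_eq {α : Type} (Rs : List (Rule G)) (f : List (ℕ × List (ℕ × G) × Rule G) → α) :
    prepare Rs f = f (Rs.map fun R => (mask (unlayer R.lhs), unlayer R.lhs, R)) := by
  induction Rs generalizing f with
  | nil => rfl
  | cons R Rs ih => simp [prepare, forceList_eq, forceNat_eq, ih]

variable [DecidableEq G]

/-- Rewrite with the rule `R` at the `n`-th place where it applies. -/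
def rewriteFrom (R : Rule G) (lhs : List (ℕ × G)) (u : Word) (x₀ : ℕ × G) (pat : List (ℕ × G)) :
    ℕ → List (ℕ × G) → List (ℕ × G) → Option (List (ℕ × G))
  | _, _, [] => none
  | n, pre, x :: post =>
    bif (code x.2).beq (code x₀.2) then
      match gather pat x₀.1 pre [x] [] post with
      | none => rewriteFrom R lhs u x₀ pat n (pre ++ [x]) post
      | some (p, b, q) =>
        forceNat ((b.headD x).1 - x₀.1) fun k =>
        -- Soundness rests on this exact comparison and on the check of the source word below. The
        -- preceding search compares only codes and offsets, and nothing need be proved about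
        -- whether it finds a match.
        bif decide (b = shift k lhs) then
          match after p u with
          | none => rewriteFrom R lhs u x₀ pat n (pre ++ [x]) post
          | some w => match strip R.src (w.drop k) with
            | none => rewriteFrom R lhs u x₀ pat n (pre ++ [x]) post
            | some _ => bif k.ble w.length then
                match n with
                | 0 => some (p ++ (shift k (unlayer R.rhs) ++ q))
                | n + 1 => rewriteFrom R lhs u x₀ pat n (pre ++ [x]) post
              else rewriteFrom R lhs u x₀ pat n (pre ++ [x]) post
        else rewriteFrom R lhs u x₀ pat n (pre ++ [x]) post
    else rewriteFrom R lhs u x₀ pat n (pre ++ [x]) post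

theorem rewriteFrom_sound {T : List (Rule G)} {R : Rule G} (hR : Derives T R) (hT : R.WellTyped)
    (u : Word) (x₀ : ℕ × G) (pat : List (ℕ × G)) (n : ℕ) (pre post e : List (ℕ × G))
    (h : rewriteFrom R (unlayer R.lhs) u x₀ pat n pre post = some e) :
    Reduces T u (pre ++ post) e := by
  induction post generalizing pre n with
  | nil => simp [rewriteFrom] at h
  | cons x post ih =>
    have skip : ∀ n, rewriteFrom R (unlayer R.lhs) u x₀ pat n (pre ++ [x]) post = some e →
        Reduces T u (pre ++ x :: post) e := fun n h => by simpa using ih _ _ h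
    unfold rewriteFrom at h
    cases hx : (code x.2).beq (code x₀.2)
    · rw [hx, cond_false] at h
      exact skip _ h
    · rw [hx, cond_true] at h
      split at h
      · exact skip _ h
      · rename_i p b q hg
        rw [forceNat_eq] at h
        generalize (b.headD x).1 - x₀.1 = k at h
        by_cases hb : b = shift k (unlayer R.lhs)
        · rw [decide_eq_true hb, cond_true] at h
          split at h
          · exact skip _ h
          · rename_i w hw
            split at h
            · exact skip _ h
            · rename_i r hr
              rw [strip_eq_some] at hr
              cases hk : k.ble w.length
              · rw [hk, cond_false] at h
                exact skip _ h
              · rw [hk, cond_true] at h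
                split at h
                · simp only [Option.some.injEq] at h
                  have h₁ := gather_sound (T := T) u _ _ _ _ _ _ _ _ _ hg
                  have hl : (w.take k).length = k := by
                    simpa using Nat.le_of_ble_eq_true hk
                  have h₂ := Reduces.rule hR hT (w.take k) r
                  rw [← hr, List.take_append_drop, hl] at h₂
                  have h₃ := h₂.context p q hw
                  subst h
                  rw [hb] at h₁
                  simp only [List.cons_append, List.nil_append] at h₁
                  exact h₁.trans h₃
                · exact skip _ h
        · rw [decide_eq_false hb, cond_false] at h
          exact skip _ h

/-- Rewrite with the rule `R`, whose left-hand side is `lhs`, at the `n`-th place. -/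
def rewriteWith (R : Rule G) (lhs : List (ℕ × G)) (n : ℕ) (u : Word) (d : List (ℕ × G)) :
    Option (List (ℕ × G)) :=
  match lhs with
  | [] => none
  | x₀ :: pat => rewriteFrom R (x₀ :: pat) u x₀ pat n [] d

theorem rewriteWith_sound {T : List (Rule G)} {R : Rule G} (hR : Derives T R) (hT : R.WellTyped)
    {u : Word} {n : ℕ} {d e : List (ℕ × G)} (h : rewriteWith R (unlayer R.lhs) n u d = some e) :
    Reduces T u d e := by
  unfold rewriteWith at h
  split at h
  · simp at h
  · rename_i x₀ pat hl
    rw [← hl] at h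
    exact rewriteFrom_sound hR hT u _ _ n [] d e h

/-- Rewrite with the rule `R` as long as possible, but at most `n` times. -/
def exhaust (R : Rule G) (lhs : List (ℕ × G)) (u : Word) : ℕ → List (ℕ × G) → List (ℕ × G)
  | 0, d => d
  | n + 1, d => match rewriteWith R lhs 0 u d with
    | none => d
    | some e => forceList e (exhaust R lhs u n)

theorem exhaust_sound {T : List (Rule G)} {R : Rule G} (hR : Derives T R) (hT : R.WellTyped)
    (u : Word) (n : ℕ) (d : List (ℕ × G)) :
    Reduces T u d (exhaust R (unlayer R.lhs) u n d) := by
  induction n generalizing d with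
  | zero => exact .refl _ _ _
  | succ n ih =>
    unfold exhaust
    split
    · exact .refl _ _ _
    · rename_i e he
      rw [forceList_eq]
      exact (rewriteWith_sound hR hT he).trans (ih e)

/-- Rewrite with each of the prepared rules in turn, where `m` is the set of generators in the
sequence. -/
def sweep (u : Word) : List (ℕ × List (ℕ × G) × Rule G) → ℕ → List (ℕ × G) → List (ℕ × G)
  | [], _, d => d
  | c :: cs, m, d =>
    -- A rule can apply only if every generator of its left-hand side occurs in the sequence; the
    -- bit sets decide this at once.
    bif (m.land c.1).beq c.1 then
      -- The number 50, like the 20 sweeps in `Step.run`, bounds the search. Too small a bound could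
      -- make a comparison fail, but never make it unsound.
      forceList (exhaust c.2.2 c.2.1 u 50 d) fun e => forceNat (mask e) fun m' => sweep u cs m' e
    else sweep u cs m d

theorem sweep_sound {T : List (Rule G)} {u : Word} {Rs : List (Rule G)}
    (hR : ∀ R ∈ Rs, Derives T R ∧ R.WellTyped) (m : ℕ) (d : List (ℕ × G)) :
    Reduces T u d
      (sweep u (Rs.map fun R => (mask (unlayer R.lhs), unlayer R.lhs, R)) m d) := by
  induction Rs generalizing d m with
  | nil => exact .refl _ _ _
  | cons R Rs ih =>
    have h := hR R (by simp)
    have ih := ih fun R hR' => hR R (by simp [hR'])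
    rw [List.map_cons, sweep]
    cases (m.land (mask (unlayer R.lhs))).beq (mask (unlayer R.lhs))
    · exact ih _ _
    · rw [cond_true, forceList_eq, forceNat_eq]
      exact (exhaust_sound h.1 h.2 u 50 d).trans (ih _ _)

/-- Rewrite as long as possible, with at most `n` sweeps. -/
def normalize (cs : List (ℕ × List (ℕ × G) × Rule G)) (u : Word) :
    ℕ → List (ℕ × G) → List (ℕ × G)
  | 0, d => d
  | n + 1, d => forceNat (mask d) fun m => forceList (sweep u cs m d) fun e =>
    bif decide (e = d) then d else normalize cs u n e

theorem normalize_sound {T : List (Rule G)} {u : Word} {Rs : List (Rule G)}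
    (hR : ∀ R ∈ Rs, Derives T R ∧ R.WellTyped) (n : ℕ) (d : List (ℕ × G)) :
    Reduces T u d
      (normalize (Rs.map fun R => (mask (unlayer R.lhs), unlayer R.lhs, R)) u n d) := by
  induction n generalizing d with
  | zero => exact .refl _ _ _
  | succ n ih =>
    rw [normalize, forceNat_eq, forceList_eq]
    cases decide (sweep u _ (mask d) d = d)
    · exact (sweep_sound hR _ d).trans (ih _)
    · exact .refl _ _ _

/-- A step of a proof by rewriting. -/
inductive Step (G : Type)
  | rw (R : Rule G) (n : ℕ)
  | norm (Rs : List (Rule G))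

def Step.rules : Step G → List (Rule G)
  | .rw R _ => [R]
  | .norm Rs => Rs

def Step.run (u : Word) (d : List (ℕ × G)) : Step G → Option (List (ℕ × G))
  | .rw R n => rewriteWith R (unlayer R.lhs) n u d
  | .norm Rs => some (prepare Rs fun cs => normalize cs u 20 d)

def run (u : Word) : List (Step G) → List (ℕ × G) → Option (List (ℕ × G))
  | [], d => some d
  | s :: S, d => match s.run u d with
    | none => none
    | some e => forceList e (run u S)

theorem run_sound {T : List (Rule G)} {u : Word} {S : List (Step G)}
    (hS : ∀ s ∈ S, ∀ R ∈ s.rules, Derives T R ∧ R.WellTyped) {d e : List (ℕ × G)}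
    (h : run u S d = some e) : Reduces T u d e := by
  induction S generalizing d with
  | nil =>
    obtain rfl : d = e := by simpa [run] using h
    exact .refl _ _ _
  | cons s S ih =>
    unfold run at h
    split at h
    · simp at h
    · rename_i e' he
      rw [forceList_eq] at h
      refine Reduces.trans ?_ (ih (fun s hs => hS s (by simp [hs])) h)
      have hs := hS s (by simp)
      cases s with
      | rw R n =>
        have := hs R (by simp [Step.rules])
        exact rewriteWith_sound this.1 this.2 he
      | norm Rs =>
        simp only [Step.run, prepare_eq, Option.some.injEq] at he
        subst he
        exact normalize_sound hs _ _

/-- The generators equal to `y` that can be moved to the front of `pre ++ post`, with the rest of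
the sequence, given the part `pre` passed over. -/
def fronts (y : ℕ × G) : List (ℕ × G) → List (ℕ × G) → List (List (ℕ × G))
  | _, [] => []
  | pre, x :: post =>
    bif (code x.2).beq (code y.2) then
      match pull pre x with
      | none => fronts y (pre ++ [x]) post
      | some (z, pre') => bif decide (z = y) then (pre' ++ post) :: fronts y (pre ++ [x]) post
        else fronts y (pre ++ [x]) post
    else fronts y (pre ++ [x]) post

theorem fronts_sound {T : List (Rule G)} {y : ℕ × G} {pre post e : List (ℕ × G)}
    (h : e ∈ fronts y pre post) (u : Word) : Reduces T u (pre ++ post) (y :: e) := by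
  induction post generalizing pre with
  | nil => simp [fronts] at h
  | cons x post ih =>
    have skip : e ∈ fronts y (pre ++ [x]) post → Reduces T u (pre ++ x :: post) (y :: e) :=
      fun h => by simpa using ih h
    unfold fronts at h
    cases hx : (code x.2).beq (code y.2)
    · rw [hx, cond_false] at h
      exact skip h
    · rw [hx, cond_true] at h
      split at h
      · exact skip h
      · rename_i z pre' hz
        by_cases hzy : z = y
        · rw [decide_eq_true hzy, cond_true] at h
          rcases List.mem_cons.1 h with rfl | h
          · subst hzy
            simpa using pull_sound (T := T) hz u [] post
          · exact skip h
        · rw [decide_eq_false hzy, cond_false] at h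
          exact skip h

/-- Equality of sequences up to the exchange law. -/
def isotopic : List (ℕ × G) → List (ℕ × G) → Bool
  | d, [] => d.isEmpty
  -- Several copies of the same generator may be movable to the front, with different remainders, so
  -- every choice is tried.
  | d, y :: e => (fronts y [] d).any fun d' => forceList d' fun d' => isotopic d' e

theorem isotopic_sound {T : List (Rule G)} {d e : List (ℕ × G)} (h : isotopic d e = true)
    (u : Word) : Reduces T u d e := by
  induction e generalizing d u with
  | nil =>
    obtain rfl : d = [] := by simpa [isotopic] using h
    exact .refl _ _ _
  | cons y e ih =>
    simp only [isotopic, forceList_eq, List.any_eq_true] at h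
    obtain ⟨d', hd, hi⟩ := h
    have h₁ : Reduces T u d (y :: d') := by simpa using fronts_sound (T := T) hd u
    have h₂ := Reduces.of_forall (T := T) (u := u) [y] [] (ih hi)
    simp only [List.append_nil, List.cons_append, List.nil_append] at h₂
    exact h₁.trans h₂

/-- The steps `S` and `S'` transform the two sides of a rule into isotopic diagrams. -/
def joins (S S' : List (Step G)) (u : Word) (d d' : List (ℕ × G)) : Bool :=
  match run u S d, run u S' d' with
  | some e, some e' => isotopic e e'
  | _, _ => false

/-- Both sides are rewritten and the results compared up to exchange. Typing of the two sides is
assumed because `Reduces` asserts nothing about ill-typed sequences. -/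
theorem joins_sound {T : List (Rule G)} {S S' : List (Step G)} {u v : Word} {d d' : Diagram G}
    (hS : ∀ s ∈ S ++ S', ∀ R ∈ s.rules, Derives T R ∧ R.WellTyped)
    (hd : target d u = some v) (hd' : target d' u = some v)
    (h : joins S S' u (unlayer d) (unlayer d') = true) : Conv T u d d' := by
  unfold joins at h
  split at h
  · rename_i e e' he he'
    have h₁ := (run_sound (T := T) (fun s hs => hS s (by simp [hs])) he).trans
      (isotopic_sound h u)
    have h₂ := run_sound (T := T) (fun s hs => hS s (by simp [hs])) he'
    obtain ⟨a, b⟩ := layers_unlayer hd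
    obtain ⟨a', b'⟩ := layers_unlayer hd'
    have c := (h₁ v a).2.trans (h₂ v a').2.symm
    rwa [b, b'] at c
  · simp at h

end Rewriting

end HopfPair

namespace HopfPair
open Signature

/-! ### The reduced axioms of a Hopf datum with trivial cocycles -/

/-- The generating 2-cells of a Hopf datum with trivial cocycles. -/
inductive Gen
  | mul (x : Bool)
  | unit (x : Bool)
  | comul (x : Bool)
  | counit (x : Bool)
  /-- the left action (`true`) and the right action (`false`) -/
  | act (x : Bool)
  /-- the left coaction (`true`) and the right coaction (`false`) -/
  | coact (x : Bool)
  | tau (x y : Bool)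
  | psi
  | phi
deriving DecidableEq

namespace Gen

instance : Signature Gen where
  dom
    | mul x => [x, x]
    | unit _ => []
    | comul x => [x]
    | counit x => [x]
    | act _ => [false, true]
    | coact x => [x]
    | tau x y => [x, y]
    | psi => [false, true]
    | phi => [true, false]
  cod
    | mul x => [x]
    | unit x => [x]
    | comul x => [x, x]
    | counit _ => []
    | act x => [x]
    | coact _ => [false, true]
    | tau x y => [y, x]
    | psi => [true, false]
    | phi => [false, true]
  code
    | mul x => bif x then 0 else 1
    | unit x => bif x then 2 else 3
    | comul x => bif x then 4 else 5
    | counit x => bif x then 6 else 7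
    | act x => bif x then 8 else 9
    | coact x => bif x then 10 else 11
    | tau x y => bif x then bif y then 12 else 13 else bif y then 14 else 15
    | psi => 16
    | phi => 17
  force
    | mul x, f => bif x then f (mul true) else f (mul false)
    | unit x, f => bif x then f (unit true) else f (unit false)
    | comul x, f => bif x then f (comul true) else f (comul false)
    | counit x, f => bif x then f (counit true) else f (counit false)
    | act x, f => bif x then f (act true) else f (act false)
    | coact x, f => bif x then f (coact true) else f (coact false)
    | tau x y, f => bif x then bif y then f (tau true true) else f (tau true false)
        else bif y then f (tau false true) else f (tau false false)
    | psi, f => f psi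
    | phi, f => f phi
  force_eq g f := by
    cases g with
    | tau x y => cases x <;> cases y <;> rfl
    | psi => rfl
    | phi => rfl
    | _ x => cases x <;> rfl

instance : VerticalFlip Gen where
  flip
    | mul x => comul x
    | unit x => counit x
    | comul x => mul x
    | counit x => unit x
    | act x => coact x
    | coact x => act x
    | tau x y => tau y x
    | psi => phi
    | phi => psi
  dom_flip g := by cases g <;> rfl
  cod_flip g := by cases g <;> rfl

instance : Mirror Gen where
  mirror
    | mul x => mul !x
    | unit x => unit !x
    | comul x => comul !x
    | counit x => counit !x
    | act x => act !x
    | coact x => coact !x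
    | tau x y => tau (!y) (!x)
    | psi => psi
    | phi => phi
  dom_mirror g := by cases g <;> rfl
  cod_mirror g := by cases g <;> rfl

end Gen

namespace Axioms
open Gen

local notation "B" => false
local notation "F" => true

/-- The strand `w` crosses the strands `u` from the right to the left. -/
def crossRight : Word → Bool → List (ℕ × Gen)
  | [], _ => []
  | x :: u, w => shift 1 (crossRight u w) ++ [(0, tau x w)]

/-- The strand `w` crosses the strands `u` from the left to the right. -/
def crossLeft (w : Bool) : Word → List (ℕ × Gen)
  | [] => []
  | x :: u => (0, tau w x) :: shift 1 (crossLeft w u)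

/-- One formula serves every arity: for an empty source or target the corresponding family of
crossings is empty, which gives the unit and counit laws of a distributive law. Read forwards, the
rule moves `g` below the crossings. -/
def natRight (g : Gen) (w : Bool) : Rule Gen :=
  mkRule (dom g ++ [w]) ((0, g) :: crossRight (cod g) w) (crossRight (dom g) w ++ [(1, g)])

def natLeft (g : Gen) (w : Bool) : Rule Gen :=
  mkRule (w :: dom g) ((1, g) :: crossLeft w (cod g)) (crossLeft w (dom g) ++ [(0, g)])

def nats (g : Gen) : List (Rule Gen) := [natRight g B, natRight g F, natLeft g B, natLeft g F]

def yangBaxter (x y z : Bool) : Rule Gen :=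
  mkRule [x, y, z] [(0, tau x y), (1, tau x z), (0, tau y z)]
    [(1, tau y z), (0, tau x z), (1, tau x y)]

def psiForm : List (ℕ × Gen) := [(0, comul B), (2, comul F), (1, tau B F), (0, act F), (1, act B)]
def phiForm : List (ℕ × Gen) := [(0, coact F), (2, coact B), (1, tau F B), (0, mul B), (1, mul F)]

/-- Keeping ψ and φ as generators with defining rules allows them to be slid as whole cells,
expanded, or recognised again inside a larger diagram. -/
def psiDef : Rule Gen := mkRule [B, F] [(0, psi)] psiForm
def phiDef : Rule Gen := mkRule [F, B] [(0, phi)] phiForm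

def assoc (x : Bool) := mkRule [x, x, x] [(0, mul x), (0, mul x)] [(1, mul x), (0, mul x)]
def unitMul (x : Bool) := mkRule [x] [(0, unit x), (0, mul x)] []
def mulUnit (x : Bool) := mkRule [x] [(1, unit x), (0, mul x)] []
def coassoc (x : Bool) := mkRule [x] [(0, comul x), (0, comul x)] [(0, comul x), (1, comul x)]
def counitComul (x : Bool) := mkRule [x] [(0, comul x), (0, counit x)] []
def comulCounit (x : Bool) := mkRule [x] [(0, comul x), (1, counit x)] []
def mulCounit (x : Bool) :=
  mkRule [x, x] [(0, mul x), (0, counit x)] [(0, counit x), (0, counit x)]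
def unitComul (x : Bool) := mkRule [] [(0, unit x), (0, comul x)] [(0, unit x), (0, unit x)]
def unitCounit (x : Bool) := mkRule [] [(0, unit x), (0, counit x)] []

def actLMul := mkRule [B, B, F] [(0, mul B), (0, act F)] [(1, act F), (0, act F)]
def actRMul := mkRule [B, F, F] [(1, mul F), (0, act B)] [(0, act B), (0, act B)]
def coactLComul := mkRule [F] [(0, coact F), (0, comul B)] [(0, coact F), (1, coact F)]
def coactRComul := mkRule [B] [(0, coact B), (1, comul F)] [(0, coact B), (0, coact B)]
def actLUnit := mkRule [F] [(0, unit B), (0, act F)] []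
def actRUnit := mkRule [B] [(1, unit F), (0, act B)] []
def coactLCounit := mkRule [F] [(0, coact F), (0, counit B)] []
def coactRCounit := mkRule [B] [(0, coact B), (1, counit F)] []

def actCounit (x : Bool) :=
  mkRule [B, F] [(0, act x), (0, counit x)] [(0, counit B), (0, counit F)]
def unitCoact (x : Bool) :=
  mkRule [] [(0, unit x), (0, coact x)] [(0, unit B), (1, unit F)]

def actLOnUnit := mkRule [B] [(1, unit F), (0, act F)] [(0, counit B), (0, unit F)]
def actROnUnit := mkRule [F] [(0, unit B), (0, act B)] [(0, counit F), (0, unit B)]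
def counitCoactL := mkRule [F] [(0, coact F), (1, counit F)] [(0, counit F), (0, unit B)]
def counitCoactR := mkRule [B] [(0, coact B), (0, counit B)] [(0, counit B), (0, unit F)]

def actLOnMul := mkRule [B, F, F] [(1, mul F), (0, act F)] [(0, psi), (1, act F), (0, mul F)]
def actROnMul := mkRule [B, B, F] [(0, mul B), (0, act B)] [(1, psi), (0, act B), (0, mul B)]
def comulCoactL := mkRule [F] [(0, coact F), (1, comul F)] [(0, comul F), (1, coact F), (0, phi)]
def comulCoactR := mkRule [B] [(0, coact B), (0, comul B)] [(0, comul B), (0, coact B), (1, phi)]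

def actLComul := mkRule [B, F] [(0, act F), (0, comul F)]
  [(0, comul B), (2, comul F), (0, coact B), (2, tau B F), (1, tau F F), (3, act F),
    (0, act F), (1, mul F)]
-- With trivial cocycles this is what the compatibility of Δ_C with ψ says; likewise `mulCoactL` is
-- what remains of the compatibility of φ with μ_M.
def actRComul := mkRule [B, F] [(0, act B), (0, comul B)]
  [(0, comul B), (2, comul F), (3, coact F), (1, tau B F), (2, tau B B), (0, act B),
    (2, act B), (0, mul B)]
def mulCoactL := mkRule [F, F] [(0, mul F), (0, coact F)]
  [(0, coact F), (2, comul F), (3, coact F), (1, tau F F), (2, tau F B), (0, act B), (0, mul B),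
    (1, mul F)]
def mulCoactR := mkRule [B, B] [(0, mul B), (0, coact B)]
  [(0, comul B), (2, coact B), (0, coact B), (2, tau B B), (1, tau F B), (3, act F), (0, mul B),
    (1, mul F)]
def mulComulB := mkRule [B, B] [(0, mul B), (0, comul B)]
  [(0, comul B), (2, comul B), (2, coact B), (1, tau B B), (2, act B), (0, mul B), (1, mul B)]
def mulComulF := mkRule [F, F] [(0, mul F), (0, comul F)]
  [(0, comul F), (2, comul F), (1, coact F), (2, tau F F), (1, act F), (0, mul F), (1, mul F)]
def psiPhi := mkRule [B, F] [(0, psi), (0, phi)]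
  [(0, comul B), (2, comul F), (0, coact B), (2, tau B F), (4, coact F), (1, tau F F),
    (3, tau B B), (0, act B), (1, tau F B), (3, act F), (0, mul B), (1, mul F)]

/-- Rules that eliminate units and counits, except for weak units and counits. -/
def basicUnitRules : List (Rule Gen) :=
  [unitMul B, mulUnit B, counitComul F, comulCounit F, actLUnit, coactRCounit, actROnUnit,
    counitCoactL] ++
  [B, F].flatMap fun x => [mulCounit x, unitComul x, unitCounit x, actCounit x, unitCoact x] ++
    nats (unit x) ++ (nats (counit x)).map Rule.symm

/-- Rules that eliminate units and counits. -/
def unitRules : List (Rule Gen) :=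
  basicUnitRules ++ [unitMul F, mulUnit F, counitComul B, comulCounit B, actRUnit, coactLCounit,
    actLOnUnit, counitCoactR]

/-- Rules that move the crossings below the comultiplications and coactions, and above the
multiplications and actions. -/
def slideRules : List (Rule Gen) :=
  [B, F].flatMap fun x => nats (mul x) ++ nats (act x) ++
    (nats (comul x) ++ nats (coact x)).map Rule.symm

def yangBaxterRules : List (Rule Gen) :=
  [B, F].flatMap fun x => [B, F].flatMap fun y => [yangBaxter x y B, yangBaxter x y F]

def assocRules : List (Rule Gen) :=
  [assoc B, assoc F, coassoc B, coassoc F, actLMul, actRMul, coactLComul, coactRComul]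

def moduleRules : List (Rule Gen) := [actLOnMul, actROnMul, comulCoactL, comulCoactR]

def bialgebraRules : List (Rule Gen) :=
  [mulComulB, mulComulF, actLComul, actRComul, mulCoactL, mulCoactR]

/-- `psiPhi` is left out so that normalization expands ψ and φ separately; the composite is
rewritten only at a chosen place. -/
def hopfSystem : List (Rule Gen) :=
  unitRules ++ slideRules ++ assocRules ++ moduleRules ++ bialgebraRules ++ yangBaxterRules ++
    [psiDef, phiDef]

/-- The axioms of a Hopf datum with trivial cocycles. -/
def hopf : List (Rule Gen) := psiPhi :: hopfSystem

/-! ### The axioms of Hopf data and paired wreaths, with trivial cocycles -/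

/-- Trivial cocycles are composites of units and counits, so σ and ρ' need no generators of their
own, and the cells built from them become explicit diagrams. -/
def sigmaForm : List (ℕ × Gen) := [(0, counit F), (0, counit F), (0, unit B)]
def rhoForm : List (ℕ × Gen) := [(0, counit F), (0, unit B), (1, unit B)]
def etaForm : List (ℕ × Gen) := [(0, unit F), (1, unit B)]
def epsForm : List (ℕ × Gen) := [(0, counit F), (0, counit B)]
def lamBForm : List (ℕ × Gen) :=
  [(1, comul B), (1, coact B), (0, tau B B), (1, act B), (1, mul B)]
def lamFForm : List (ℕ × Gen) :=
  [(0, comul F), (1, coact F), (2, tau F F), (1, act F), (0, mul F)]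
def muForm : List (ℕ × Gen) :=
  [(0, comul F), (2, comul F), (1, coact F), (2, tau F F), (1, act F), (0, mul F)] ++
    shift 1 sigmaForm
def deltaForm : List (ℕ × Gen) :=
  rhoForm ++ [(2, comul B), (2, coact B), (1, tau B B), (2, act B), (0, mul B), (1, mul B)]

def hopfWeakRules : List (Rule Gen) := [
  mkRule [F, F, F] [(1, mul F), (0, mul F)] (muForm ++ [(1, act F), (0, mul F)]),
  mkRule [F] (etaForm ++ [(1, act F), (0, mul F)]) [],
  mulUnit F,
  mkRule [B] [(0, comul B), (0, comul B)] ([(0, comul B), (0, coact B)] ++ shift 1 deltaForm),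
  mkRule [B] ([(0, comul B), (0, coact B)] ++ shift 1 epsForm) [],
  counitComul B]

def hopfTwistRules : List (Rule Gen) := [
  mkRule [B, F, F] ([(0, psi), (1, psi)] ++ sigmaForm ++ [(0, mul B)])
    (shift 1 muForm ++ [(0, act B), (0, mul B)]),
  mkRule [B] (etaForm ++ [(0, counit F), (0, mul B)])
    (shift 1 etaForm ++ [(0, act B), (0, mul B)]),
  mkRule [F] ([(0, comul F), (1, coact F)] ++ deltaForm)
    ((0, comul F) :: shift 1 rhoForm ++ [(0, phi), (1, phi)]),
  mkRule [F] ([(0, comul F), (1, coact F)] ++ epsForm)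
    ([(0, comul F), (2, unit B)] ++ shift 1 epsForm)]

def hopfCocycleRules : List (Rule Gen) := [
  mkRule [F, F, F] (shift 1 muForm ++ sigmaForm ++ [(0, mul B)])
    (muForm ++ [(1, psi)] ++ sigmaForm ++ [(0, mul B)]),
  mkRule [F] (etaForm ++ [(1, psi)] ++ sigmaForm ++ [(0, mul B)]) [(0, counit F), (0, unit B)],
  mkRule [F] (shift 1 etaForm ++ sigmaForm ++ [(0, mul B)]) [(0, counit F), (0, unit B)],
  mkRule [F] ((0, comul F) :: shift 1 rhoForm ++ [(0, phi)] ++ shift 1 deltaForm)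
    ((0, comul F) :: shift 1 rhoForm ++ deltaForm),
  mkRule [F] ((0, comul F) :: shift 1 rhoForm ++ [(0, phi)] ++ shift 1 epsForm)
    [(0, counit F), (0, unit B)],
  mkRule [F] ((0, comul F) :: shift 1 rhoForm ++ epsForm) [(0, counit F), (0, unit B)],
  mkRule [F, F] (sigmaForm ++ [(0, counit B)]) [(0, counit F), (0, counit F)],
  mkRule [] ((0, unit F) :: rhoForm) [(0, unit B), (1, unit B)]]

def hopfCompatRules : List (Rule Gen) := [
  psiPhi,
  mkRule [B, F] ((0, psi) :: deltaForm)
    ([(0, comul B), (2, comul F), (2, comul F)] ++ shift 4 rhoForm ++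
      [(0, coact B), (2, tau B F), (4, phi), (1, tau F F), (3, tau B B), (0, act B),
        (1, tau F B), (3, psi), (0, mul B)] ++ shift 1 sigmaForm ++ [(2, mul B), (1, mul B)]),
  actLComul,
  mkRule [F, F] (muForm ++ [(0, phi)])
    ([(0, comul F), (2, comul F), (0, comul F)] ++ shift 2 rhoForm ++
      [(1, phi), (3, tau B F), (5, coact F), (2, tau F F), (4, tau B B), (1, psi),
        (3, tau F B), (5, act F)] ++ sigmaForm ++ [(1, mul B), (0, mul B), (1, mul F)]),
  mkRule [F, F] (muForm ++ deltaForm)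
    ([(0, comul F), (2, comul F), (0, comul F)] ++ shift 2 rhoForm ++ [(4, comul F)] ++
      shift 6 rhoForm ++
      [(1, phi), (3, tau B F), (5, phi), (2, tau F F), (4, tau B B), (1, psi), (3, tau F B),
        (5, psi)] ++ sigmaForm ++ [(1, mul B)] ++ shift 2 sigmaForm ++
      [(3, mul B), (0, mul B), (1, mul B)]),
  mulCoactR,
  mkRule [B, B] [(0, mul B), (0, comul B)]
    ([(0, comul B), (2, comul B), (0, coact B), (3, coact B), (2, tau B B), (1, tau F B),
      (3, psi), (0, mul B)] ++ shift 1 sigmaForm ++ [(2, mul B), (1, mul B)]),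
  mkRule [B, B] [(0, mul B), (0, comul B)] ((0, comul B) :: shift 1 lamBForm ++ [(0, mul B)]),
  mkRule [F, F] [(0, mul F), (0, comul F)]
    ([(0, comul F), (2, comul F), (0, comul F)] ++ shift 2 rhoForm ++
      [(1, phi), (3, tau B F), (2, tau F F), (4, act F), (1, act F), (2, mul F), (0, mul F)]),
  mkRule [F, F] [(0, mul F), (0, comul F)] ((1, comul F) :: lamFForm ++ [(1, mul F)])]

/-- The rules that Hopf data and paired wreaths have in common. -/
def commonRules : List (Rule Gen) := [
  assoc B, unitMul B, mulUnit B, coassoc F, comulCounit F, counitComul F,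
  mulCounit B, unitComul B, unitCounit B, mulCounit F, unitComul F, unitCounit F,
  psiDef, phiDef] ++
  [B, F].flatMap fun x => nats (mul x) ++ nats (unit x) ++ nats (comul x) ++ nats (counit x)

def distributiveRules (x y : Bool) : List (Rule Gen) := [
  natRight (mul x) y, natRight (unit x) y, natLeft (mul y) x, natLeft (unit y) x,
  natRight (comul x) y, natRight (counit x) y, natLeft (comul y) x, natLeft (counit y) x]

def hopfModuleRules : List (Rule Gen) := [
  actLMul, actLUnit, coactRComul, coactRCounit, actCounit F, unitCoact B, actCounit B,
  unitCoact F, actLOnMul, actLOnUnit, comulCoactR, counitCoactR, actROnMul, actROnUnit,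
  comulCoactL, counitCoactL]

/-- The axioms of a Hopf datum, for trivial cocycles. -/
def hopfDatumRules : List (Rule Gen) :=
  commonRules ++ hopfModuleRules ++ hopfWeakRules ++ hopfTwistRules ++ hopfCocycleRules ++
    hopfCompatRules

/-- The crossings with the strand `w` are natural with respect to the actions and coactions. -/
def naturalRulesAt (w : Bool) : List (Rule Gen) := [
  natRight (act F) w, natLeft (act F) w, natRight (act B) w, natLeft (act B) w,
  natRight (coact F) w, natLeft (coact F) w, natRight (coact B) w, natLeft (coact B) w]

/-- Naturality and Yang–Baxter. -/
def naturalRules : List (Rule Gen) :=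
  naturalRulesAt B ++ naturalRulesAt F ++ yangBaxterRules

def psiMulB := mkRule [B, B, F] [(0, mul B), (0, psi)] [(1, psi), (0, psi), (1, mul B)]

def wreathRules : List (Rule Gen) := [
  psiMulB,
  mkRule [F] [(0, unit B), (0, psi)] [(1, unit B)],
  mkRule [B, F, F] ([(0, psi), (1, psi)] ++ muForm ++ [(1, mul B)])
    (shift 1 muForm ++ [(0, psi), (1, mul B)]),
  mkRule [B] (etaForm ++ [(1, mul B)]) (shift 1 etaForm ++ [(0, psi), (1, mul B)]),
  mkRule [F, F, F] (shift 1 muForm ++ muForm ++ [(1, mul B)])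
    (muForm ++ [(1, psi)] ++ muForm ++ [(1, mul B)]),
  mkRule [F] (etaForm ++ [(1, psi)] ++ muForm ++ [(1, mul B)]) [(1, unit B)],
  mkRule [F] (shift 1 etaForm ++ muForm ++ [(1, mul B)]) [(1, unit B)]]

def cowreathRules : List (Rule Gen) := [
  mkRule [F, B] [(0, phi), (1, comul F)] [(0, comul F), (1, phi), (0, phi)],
  mkRule [F, B] [(0, phi), (1, counit F)] [(0, counit F)],
  mkRule [F, B] ([(0, comul F), (1, phi)] ++ deltaForm)
    ((0, comul F) :: shift 1 deltaForm ++ [(0, phi), (1, phi)]),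
  mkRule [F, B] ([(0, comul F), (1, phi)] ++ epsForm) ((0, comul F) :: shift 1 epsForm),
  mkRule [F, B] ((0, comul F) :: shift 1 deltaForm ++ [(0, phi)] ++ shift 1 deltaForm)
    ((0, comul F) :: shift 1 deltaForm ++ deltaForm),
  mkRule [F, B] ((0, comul F) :: shift 1 deltaForm ++ [(0, phi)] ++ shift 1 epsForm)
    [(0, counit F)],
  mkRule [F, B] ((0, comul F) :: shift 1 deltaForm ++ epsForm) [(0, counit F)]]

def pairingRules : List (Rule Gen) := [
  mkRule [] [(0, unit F)] (etaForm ++ [(1, counit B)]),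
  mkRule [B] [(0, counit B)] ((0, unit F) :: epsForm),
  mkRule [B, F] ((0, psi) :: epsForm) [(0, counit B), (0, counit F)],
  mkRule [] (etaForm ++ [(0, phi)]) [(0, unit B), (1, unit F)],
  mkRule [B, B] ((0, comul B) :: shift 1 lamBForm)
    ([(0, comul B), (2, comul B), (0, coact B), (3, coact B), (2, tau B B), (1, tau F B),
      (3, psi)] ++ shift 2 sigmaForm ++ [(2, mul B), (2, mul B)]),
  mkRule [F, F, F] (lamFForm ++ [(1, mul F)])
    ([(0, comul F), (1, comul F)] ++ shift 2 rhoForm ++ [(1, phi), (3, tau B F), (2, tau F F),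
      (4, act F), (1, act F), (2, mul F), (0, mul F)]),
  mkRule [F, F] muForm ((1, comul F) :: lamFForm ++ shift 1 sigmaForm),
  mkRule [F, B] deltaForm (rhoForm ++ shift 1 lamBForm ++ [(0, mul B)])]

def crossMul : List (ℕ × Gen) := (1, psi) :: muForm ++ [(2, mul B), (1, mul B)]
def crossComul : List (ℕ × Gen) := [(0, comul F), (0, comul F)] ++ shift 2 deltaForm ++ [(1, phi)]
def crossTau : List (ℕ × Gen) := [(1, tau B F), (0, tau F F), (2, tau B B), (1, tau F B)]

def crossBimonad :=
  mkRule [F, B, F, B] (crossMul ++ crossComul)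
    (crossComul ++ shift 4 crossComul ++ shift 2 crossTau ++ crossMul ++ shift 2 crossMul)

def crossMonadRules : List (Rule Gen) := [
  mkRule [F, B, F, B, F, B] (crossMul ++ crossMul) (shift 2 crossMul ++ crossMul),
  mkRule [F, B] (etaForm ++ crossMul) [],
  mkRule [F, B] (shift 2 etaForm ++ crossMul) [],
  mkRule [F, B] (crossComul ++ crossComul) (crossComul ++ shift 2 crossComul),
  mkRule [F, B] (crossComul ++ shift 2 epsForm) [],
  mkRule [F, B] (crossComul ++ epsForm) [],
  mkRule [F, B, F, B] (crossMul ++ epsForm) (epsForm ++ epsForm),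
  mkRule [] (etaForm ++ crossComul) (etaForm ++ etaForm),
  mkRule [] (etaForm ++ epsForm) []]

def crossDistributiveRules : List (Rule Gen) := [
  mkRule [F, B, F, B, F, B] (crossMul ++ crossTau)
    (shift 2 crossTau ++ crossTau ++ shift 2 crossMul),
  mkRule [F, B] (etaForm ++ crossTau) (shift 2 etaForm),
  mkRule [F, B, F, B, F, B] (shift 2 crossMul ++ crossTau)
    (crossTau ++ shift 2 crossTau ++ crossMul),
  mkRule [F, B] (shift 2 etaForm ++ crossTau) etaForm,
  mkRule [F, B, F, B] (crossTau ++ shift 2 crossComul)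
    (crossComul ++ shift 2 crossTau ++ crossTau),
  mkRule [F, B, F, B] (crossTau ++ shift 2 epsForm) epsForm,
  mkRule [F, B, F, B] (crossTau ++ crossComul)
    (shift 2 crossComul ++ crossTau ++ shift 2 crossTau),
  mkRule [F, B, F, B] (crossTau ++ epsForm) (shift 2 epsForm)]

/-- The axioms of a paired wreath, for trivial cocycles. -/
def pairedWreathRules : List (Rule Gen) :=
  commonRules ++ wreathRules ++ cowreathRules ++ pairingRules ++
    crossMonadRules ++ crossDistributiveRules ++ [crossBimonad]

/-- The components of a Hopf datum as the canonical restrictions of its paired wreath. -/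
def restrictionRules : List (Rule Gen) := [
  mkRule [B] ((0, unit F) :: deltaForm) [(0, comul B)],
  mkRule [F, F] (muForm ++ [(1, counit B)]) [(0, mul F)],
  mkRule [B, F] [(0, psi), (1, counit B)] [(0, act F)],
  mkRule [B] [(0, unit F), (0, phi)] [(0, coact B)],
  mkRule [B, F] [(0, psi), (0, counit F)] [(0, act B)],
  mkRule [F] [(1, unit B), (0, phi)] [(0, coact F)],
  mkRule [F, F] (muForm ++ [(0, counit F)]) sigmaForm,
  mkRule [F] ((1, unit B) :: deltaForm) rhoForm]

end Axioms
end HopfPair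

namespace HopfPair
open Signature

/-! ### Families of derivable rules -/

section Derivable

variable {G : Type} [Signature G]

def Derivable (T E : List (Rule G)) : Prop := ∀ R ∈ E, Derives T R

theorem Derivable.refl (T : List (Rule G)) : Derivable T T := fun _ h => derives_of_mem h

theorem Derivable.append {T E E' : List (Rule G)} (h : Derivable T E) (h' : Derivable T E') :
    Derivable T (E ++ E') := fun R hR => (List.mem_append.1 hR).elim (h R) (h' R)

theorem Derivable.trans {T E E' : List (Rule G)} (h : Derivable T E) (h' : Derivable E E') :
    Derivable T E' := fun R hR => (h' R hR).cut h

/-- Compose both sides of a rule with further diagrams. -/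
def Rule.extend (R : Rule G) (u : Word) (pre post : List (ℕ × G)) : Rule G :=
  ⟨u, (target (layers R.tgt post) R.tgt).getD [],
    layers u pre ++ (R.lhs ++ layers R.tgt post), layers u pre ++ (R.rhs ++ layers R.tgt post)⟩

theorem Derives.extend {T : List (Rule G)} {R : Rule G} (h : Derives T R) {u : Word}
    {pre post : List (ℕ × G)} (hu : target (layers u pre) u = some R.src) :
    Derives T (R.extend u pre post) :=
  Conv.context' h _ _ u hu

theorem Derivable.singleton {T : List (Rule G)} {R : Rule G} (h : Derives T R) :
    Derivable T [R] := fun R' hR => by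
  obtain rfl : R' = R := by simpa using hR
  exact h

def wellTyped (T : List (Rule G)) : Bool := T.all fun R => decide R.WellTyped

theorem wellTyped_of_mem {T : List (Rule G)} (hT : wellTyped T = true) {R : Rule G}
    (hR : R ∈ T) : R.WellTyped := by
  simpa using List.all_eq_true.1 hT R hR

theorem Derivable.nil (T : List (Rule G)) : Derivable T [] := fun _ h => by simp at h

variable [DecidableEq G]

/-- The generators on both sides of a rule, as a number. -/
def Rule.fingerprint (R : Rule G) : ℕ := mask (unlayer R.lhs) + mask (unlayer R.rhs)

/-- All rules in `L` are rules in `E`, up to symmetry. -/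
def within (E L : List (Rule G)) : Bool :=
  L.all fun R => E.any fun S =>
    (R.fingerprint).beq S.fingerprint && (decide (S = R) || decide (S.symm = R))

theorem Derivable.of_within {T E L : List (Rule G)} (h : Derivable T E)
    (hL : within E L = true) : Derivable T L := fun R hR => by
  simp only [within, List.all_eq_true, List.any_eq_true, Bool.or_eq_true,
    Bool.and_eq_true, decide_eq_true_eq] at hL
  obtain ⟨S, hS, -, rfl | rfl⟩ := hL R hR
  · exact h _ hS
  · exact (h _ hS).symm

/-- Prove a rule by rewriting both sides. -/
theorem Derivable.rewrite {T E : List (Rule G)} (h : Derivable T E) (S S' : List (Step G))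
    {R : Rule G} (hE : within E ((S ++ S').flatMap Step.rules) = true)
    (hT : wellTyped (R :: (S ++ S').flatMap Step.rules) = true)
    (hR : joins S S' R.src (unlayer R.lhs) (unlayer R.rhs) = true) : Derives T R := by
  have hR' := wellTyped_of_mem hT (List.mem_cons_self ..)
  refine joins_sound (fun s hs R hR => ?_) hR'.1 hR'.2 hR
  have hm : R ∈ (S ++ S').flatMap Step.rules := List.mem_flatMap.2 ⟨s, hs, hR⟩
  exact ⟨h.of_within hE R hm, wellTyped_of_mem hT (List.mem_cons_of_mem _ hm)⟩

/-- The steps `S` relate the two sides of `R` to those of `R'`. -/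
def relates (S : List (Step G)) (R' R : Rule G) : Bool :=
  decide (R'.src = R.src) && (decide (R'.tgt = R.tgt) &&
    (joins S S R.src (unlayer R.lhs) (unlayer R'.lhs) &&
      joins S S R.src (unlayer R'.rhs) (unlayer R.rhs)))

/-- Prove rules by rewriting both sides with the steps `S`, and comparing the results with each
other, or with what `S` makes of the two sides of a rule in `sources`. -/
theorem Derivable.normalForms {T E : List (Rule G)} (h : Derivable T E) (S : List (Step G))
    {sources L : List (Rule G)} (hE : within E (S.flatMap Step.rules) = true)
    (hsources : Derivable T sources)
    (hT : wellTyped (S.flatMap Step.rules ++ (sources ++ L)) = true)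
    (hL : (L.all fun R => joins S S R.src (unlayer R.lhs) (unlayer R.rhs) ||
      sources.any fun R' => relates S R' R) = true) : Derivable T L := by
  intro R hR
  simp only [List.all_eq_true, Bool.or_eq_true, List.any_eq_true] at hL
  have hS : ∀ s ∈ S ++ S, ∀ R ∈ s.rules, Derives T R ∧ R.WellTyped := by
    intro s hs R hR
    have hm : R ∈ S.flatMap Step.rules := List.mem_flatMap.2 ⟨s, by simpa using hs, hR⟩
    exact ⟨h.of_within hE R hm, wellTyped_of_mem hT (List.mem_append_left _ hm)⟩
  have hR₁ := wellTyped_of_mem hT (List.mem_append_right _ (List.mem_append_right _ hR))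
  rcases hL R hR with hJ | ⟨R', hR', hJ⟩
  · exact joins_sound hS hR₁.1 hR₁.2 hJ
  · have hR₂ := wellTyped_of_mem hT (List.mem_append_right _ (List.mem_append_left _ hR'))
    simp only [relates, Bool.and_eq_true, decide_eq_true_eq] at hJ
    obtain ⟨hs, ht, h₁, h₂⟩ := hJ
    have h₃ := hsources R' hR'
    unfold Derives Rule.WellTyped at *
    rw [hs, ht] at hR₂
    rw [hs] at h₃
    exact (joins_sound hS hR₁.1 hR₂.1 h₁).trans (h₃.trans (joins_sound hS hR₂.2 hR₁.2 h₂))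

end Derivable

namespace Axioms
open Gen

local notation "B" => false
local notation "F" => true

/-- The laws by which ψ passes the two multiplications and φ the two comultiplications form one
orbit under the two reflections. -/
def psiMulF := psiMulB.mirror
def phiComulB := psiMulB.flip
def phiComulF := psiMulF.flip

/-- φ need not be a distributive law for the multiplications. This is what `mulCoactL` and
`mulCoactR` give instead; a copy of φ reappears between the second `F` and the first `B`. -/
def phiMulMul := mkRule [F, F, B, B] [(0, mul F), (1, mul B), (0, phi)]
  [(0, coact F), (2, comul F), (1, tau F F), (0, act B), (3, comul B), (5, coact B),
    (4, tau B B), (5, act F), (2, phi), (3, tau F B), (1, tau F B), (2, tau F B), (0, mul B),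
    (0, mul B), (1, mul F), (1, mul F)]

def psiUnitB := mkRule [F] [(0, unit B), (0, psi)] [(1, unit B)]
def psiUnitF := mkRule [B] [(1, unit F), (0, psi)] [(0, unit F)]

def psiCounits : List (Rule Gen) :=
  [mkRule [B, F] [(0, psi), (0, counit F)] [(0, act B)],
    mkRule [B, F] [(0, psi), (1, counit B)] [(0, act F)]]

def phiUnits : List (Rule Gen) := psiCounits.map Rule.flip

/-- Units and counits cancel against `psi` and `phi`. -/
def psiPhiUnits : List (Rule Gen) :=
  psiUnitB :: psiUnitB.flip :: psiUnitF :: psiUnitF.flip :: (psiCounits ++ phiUnits)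

end Axioms
end HopfPair

namespace HopfPair
open Signature

/-! ### Families of rules under composition, symmetry and reflection. -/

section Extend

variable {G : Type} [Signature G]

/-- The rules `L`, composed with further diagrams. -/
def extendAll (L : List (Rule G)) (u : Word) (pre post : List (ℕ × G)) : List (Rule G) :=
  L.map fun R => R.extend u pre post

theorem Derivable.extendAll {T L : List (Rule G)} (h : Derivable T L) {u : Word}
    {pre post : List (ℕ × G)} (hu : ∀ R ∈ L, target (layers u pre) u = some R.src) :
    Derivable T (extendAll L u pre post) := fun R hR => by
  obtain ⟨S, hS, rfl⟩ := List.mem_map.1 hR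
  exact (h S hS).extend (hu S hS)

/-- The rules `L`, and the same rules from right to left. -/
def withSymm (L : List (Rule G)) : List (Rule G) := L ++ L.map Rule.symm

theorem Derivable.withSymm {T L : List (Rule G)} (h : Derivable T L) :
    Derivable T (withSymm L) :=
  h.append fun R hR => by
    obtain ⟨S, hS, rfl⟩ := List.mem_map.1 hR
    exact (h S hS).symm

theorem Derivable.flip [VerticalFlip G] {T L : List (Rule G)} (hT : wellTyped (T ++ L) = true)
    (h : Derivable T L) : Derivable (T.map Rule.flip) (L.map Rule.flip) := fun R hR => by
  obtain ⟨S, hS, rfl⟩ := List.mem_map.1 hR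
  exact (h S hS).flip (fun R hR => wellTyped_of_mem hT (List.mem_append_left _ hR))
    (wellTyped_of_mem hT (List.mem_append_right _ hS))

theorem Derivable.mirror [Mirror G] {T L : List (Rule G)} (h : Derivable T L) :
    Derivable (T.map Rule.mirror) (L.map Rule.mirror) := fun R hR => by
  obtain ⟨S, hS, rfl⟩ := List.mem_map.1 hR
  exact (h S hS).mirror

end Extend

namespace Axioms
open Gen

local notation "B" => false
local notation "F" => true

/-! ### Consequences of the axioms -/

theorem hopf_psiPhiUnits : Derivable hopf psiPhiUnits :=
  (Derivable.refl hopf).normalForms [.norm (unitRules ++ [psiDef, phiDef])] (by decide +kernel)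
    (.nil _) (by decide +kernel) (by decide +kernel)

/-- Compatibilities of `psi` and `phi` with multiplications and comultiplications. -/
def slidingRules : List (Rule Gen) :=
  [psiMulB, psiMulF, phiComulB, phiComulF, phiMulMul] ++ nats psi ++ nats phi

/-- The reduced axioms come in mirror pairs. No rewriting steps are given, so each mirrored axiom is
matched with an axiom up to exchange and orientation only. With `hopf_flip` this reduces the four
trivial-(co)action cases to one. -/
theorem hopf_mirror : Derivable hopf (hopf.map Rule.mirror) :=
  (Derivable.refl hopf).normalForms [] rfl
    (Derivable.refl hopf).withSymm (by decide +kernel) (by decide +kernel)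

theorem hopf_flip : Derivable hopf (hopf.map Rule.flip) :=
  (Derivable.refl hopf).normalForms [] rfl
    (Derivable.refl hopf).withSymm (by decide +kernel) (by decide +kernel)

/-- Only one product law for ψ, the expansion of φ after two products, and naturality of ψ are
computed. Mirroring gives the other product law, and flipping turns the statements about ψ into
those about φ. -/
theorem hopf_sliding : Derivable hopf slidingRules := by
  have h : Derivable hopf ([psiMulB, phiMulMul] ++ nats psi) :=
    (Derivable.refl hopf).normalForms [.norm hopfSystem] (by decide +kernel)
      (.nil _) (by decide +kernel) (by decide +kernel)
  have h₁ := h.append (hopf_mirror.trans h.mirror)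
  exact (h₁.append (hopf_flip.trans (h₁.flip (by decide +kernel)))).of_within (by decide +kernel)

/-! ### The compatibility of `psi` and `phi` with the comultiplications -/

def actLTriv := mkRule [B, F] [(0, act F)] [(0, counit B)]
def actRTriv := mkRule [B, F] [(0, act B)] [(1, counit F)]
def coactLTriv := mkRule [F] [(0, coact F)] [(0, unit B)]
def coactRTriv := mkRule [B] [(0, coact B)] [(1, unit F)]

/-- If λ_F is trivial, φ is (B μ_F)(τ_{F,B} F)(F ρ_B); a product in `F` then passes by naturality of
τ and associativity of μ_F. -/
def phiMulF := mkRule [F, F, B] [(0, mul F), (0, phi)] [(1, phi), (0, tau F B), (1, mul F)]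

def comulNats : List (Rule Gen) := [B, F].flatMap fun x => nats (comul x) ++ nats (coact x)

/-- This is the middle part of the bimonad equation, with the outer products and coproducts removed.
-/
def psiComulPhi :=
  mkRule [B, F] [(0, psi), (0, comul F), (2, comul B), (1, phi)]
    [(0, comul B), (2, comul F), (0, coact B), (4, coact F), (2, tau B F), (1, tau F F),
      (3, tau B B), (2, tau F B), (0, psi), (4, psi), (1, mul B), (2, mul F)]

theorem derives_phiMulF : Derives (coactLTriv :: hopf) phiMulF :=
  (Derivable.refl _).rewrite [.norm (coactLTriv :: hopfSystem)] [.norm (coactLTriv :: hopfSystem)]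
    (by decide +kernel) (by decide +kernel) (by decide +kernel)

/-- Moving Δ_F and Δ_B past the two actions in ψ leaves a product in `F` as the first input of φ,
and `phiMulF` splits it. The second places in the uses of coassociativity regroup the copies so that
the two actions above φ form a ψ again; then `psiPhi` replaces φψ. -/
theorem psiComulPhi_of_coactL : Derives (coactLTriv :: hopf) psiComulPhi :=
  (Derivable.append (Derivable.singleton derives_phiMulF) (Derivable.refl _)).rewrite
    [.rw psiDef 0, .rw actLComul 0, .rw actRComul 0, .norm (coactLTriv :: unitRules),
      .rw phiMulF 0, .norm ([coassoc B, coassoc F] ++ slideRules), .rw (coassoc B).symm 1,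
      .rw (coassoc F).symm 1, .norm comulNats, .rw psiDef.symm 0, .rw psiPhi 0,
      .norm (coactLTriv :: hopfSystem)]
    [.norm (coactLTriv :: hopfSystem)]
    (by decide +kernel) (by decide +kernel) (by decide +kernel)

/-! ### From Hopf data to paired wreaths -/

/-- The wreath product is multiplicative with respect to the cowreath coproduct. -/
def bimonadRule :=
  mkRule [F, B, F, B]
    [(1, psi), (0, mul F), (1, mul B), (0, comul F), (2, comul B), (1, phi)]
    [(0, comul F), (2, comul B), (1, phi), (4, comul F), (6, comul B), (5, phi), (3, tau B F),
      (2, tau F F), (4, tau B B), (3, tau F B), (1, psi), (0, mul F), (1, mul B), (3, psi),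
      (2, mul F), (3, mul B)]

/-- Rules that move the crossings and `psi` past the comultiplications and multiplications. -/
def combRules : List (Rule Gen) :=
  slideRules ++ (nats psi).map Rule.symm ++ assocRules ++ yangBaxterRules

/-- On the left-hand side the products pass the coproducts and φ, exposing the left-hand side of
`psiComulPhi`. On the right-hand side both copies of φ are expanded, ψ is slid past the products,
and two copies of ψ are expanded. Sliding, (co)associativity and Yang–Baxter bring both to one form.
-/
theorem bimonadRule_of_coactL : Derives (coactLTriv :: hopf) bimonadRule := by
  have h : Derivable (coactLTriv :: hopf) hopf := fun R hR =>
    derives_of_mem (List.mem_cons_of_mem _ hR)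
  refine (Derivable.append (.singleton psiComulPhi_of_coactL)
    (.append (h.trans hopf_sliding) h)).rewrite
    [.rw mulComulF 0, .rw mulComulB 0, .rw phiMulMul 0, .norm [(coassoc F).symm, coassoc B],
      .rw psiComulPhi 0, .norm combRules]
    [.rw phiDef 0, .rw phiDef 0, .norm ([psiMulB, psiMulF] ++ slideRules), .rw psiDef 1,
      .rw psiDef 2, .norm combRules]
    (by decide +kernel) (by decide +kernel) (by decide +kernel)

/-- Up to exchange the bimonad equation is its own mirror image, and `hopf` derives its mirror
images, so only the extra hypothesis changes. -/
theorem bimonadRule_mirror {R : Rule Gen} (h : Derives (R :: hopf) bimonadRule) :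
    Derives (R.mirror :: hopf) bimonadRule := by
  have h₁ : Derives (R.mirror :: hopf) bimonadRule.mirror := by
    refine h.mirror.cut fun S hS => ?_
    rcases List.mem_cons.1 hS with rfl | hS
    · exact derives_of_mem (List.mem_cons_self ..)
    · exact (hopf_mirror S hS).cut fun S hS => derives_of_mem (List.mem_cons_of_mem _ hS)
  exact (Derivable.refl _).normalForms (L := [bimonadRule]) [] rfl
    (Derivable.singleton h₁) (by decide +kernel) (by decide +kernel) _ (by simp)

/-- A bimonad is a self-dual notion: reversing the diagrams interchanges product and coproduct, ψ
and φ, and gives back the same equation. Reversal needs a typed extra hypothesis. -/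
theorem bimonadRule_flip {R : Rule Gen} (hR : R.WellTyped)
    (h : Derives (R :: hopf) bimonadRule) : Derives (R.flip :: hopf) bimonadRule := by
  have h₁ : Derives (R.flip :: hopf) bimonadRule.flip := by
    refine (h.flip (fun S hS => ?_) (by decide +kernel)).cut fun S hS => ?_
    · rcases List.mem_cons.1 hS with rfl | hS
      · exact hR
      · exact wellTyped_of_mem (T := hopf) (by decide +kernel) hS
    rcases List.mem_cons.1 hS with rfl | hS
    · exact derives_of_mem (List.mem_cons_self ..)
    · exact (hopf_flip S hS).cut fun S hS => derives_of_mem (List.mem_cons_of_mem _ hS)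
  exact (Derivable.refl _).normalForms (L := [bimonadRule]) [] rfl
    (Derivable.singleton h₁).withSymm (by decide +kernel) (by decide +kernel) _ (by simp)

/-- By computation, the mirror image of a trivial left coaction is a trivial right coaction;
flipping these two gives the two actions. -/
theorem bimonadRule_of_coactR : Derives (coactRTriv :: hopf) bimonadRule :=
  bimonadRule_mirror bimonadRule_of_coactL

theorem bimonadRule_of_actL : Derives (actLTriv :: hopf) bimonadRule :=
  bimonadRule_flip (by decide) bimonadRule_of_coactL

theorem bimonadRule_of_actR : Derives (actRTriv :: hopf) bimonadRule :=
  bimonadRule_flip (by decide) bimonadRule_of_coactR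

/-- The rules from which the axioms of a paired wreath are proved. -/
def crossedRules : List (Rule Gen) := bimonadRule :: (slidingRules ++ (psiPhiUnits ++ hopf))

/-- Once the units coming from the cocycles are cancelled, a wreath is a distributive law ψ between
monads and a cowreath a distributive law φ between comonads, with the usual product and coproduct on
`FB`. -/
theorem crossed_pairedWreath : Derivable crossedRules pairedWreathRules := by
  have h := Derivable.refl crossedRules
  have h₁ : Derivable crossedRules [psiMulB, psiMulF, phiComulB, phiComulF] :=
    h.of_within (by decide +kernel)
  refine Derivable.append (.append (.append (.append (.append (.append ?_ ?_) ?_) ?_) ?_) ?_) ?_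
  · exact h.of_within (by decide +kernel)
  -- Apart from unit laws, what survives is associativity of μ_F and the two product laws of ψ,
  -- whence the sources `h₁`; the next item is the dual for φ.
  · exact h.normalForms [.norm (unitRules ++ psiPhiUnits ++ [assoc F, coassoc B])]
      (by decide +kernel) h₁.withSymm (by decide +kernel) (by decide +kernel)
  · exact h.normalForms [.norm (unitRules ++ psiPhiUnits ++ [assoc F, coassoc B])]
      (by decide +kernel) h₁.withSymm (by decide +kernel) (by decide +kernel)
  · exact h.normalForms [.norm (unitRules ++ psiPhiUnits)]
      (by decide +kernel) (.nil _) (by decide +kernel) (by decide +kernel)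
  -- The second pass proves (co)associativity of the (co)product: ψ and φ move past the inner
  -- (co)multiplications, and then those of `B` and `F` are (co)associative.
  · exact h.normalForms [.norm (unitRules ++ psiPhiUnits),
        .norm ([psiMulB, psiMulF, phiComulB, phiComulF, assoc F, coassoc B, assoc B, coassoc F] ++
          slideRules)]
      (by decide +kernel) (.nil _) (by decide +kernel) (by decide +kernel)
  -- The crossing on `FB` consists of the four crossings of the factors, so it is enough to slide
  -- each constituent of the product and coproduct through them.
  · exact h.normalForms [.norm (unitRules ++ psiPhiUnits),
        .norm (slideRules ++ nats psi ++ (nats phi).map Rule.symm)]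
      (by decide +kernel) (.nil _) (by decide +kernel) (by decide +kernel)
  · exact h.normalForms [.norm (unitRules ++ psiPhiUnits)] (by decide +kernel)
      (h.of_within (L := [bimonadRule]) (by decide +kernel)) (by decide +kernel)
      (by decide +kernel)

/-- The axioms of a Hopf datum make a paired wreath, if the wreath product is multiplicative. -/
theorem hopf_pairedWreath : Derivable (bimonadRule :: hopf) pairedWreathRules := by
  have h : Derivable (bimonadRule :: hopf) hopf := fun R hR =>
    derives_of_mem (List.mem_cons_of_mem _ hR)
  exact Derivable.trans
    (Derivable.append (E := [bimonadRule])
      (Derivable.singleton (derives_of_mem (List.mem_cons_self ..)))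
      (.append (h.trans hopf_sliding) (.append (h.trans hopf_psiPhiUnits) h)))
    crossed_pairedWreath

end Axioms
end HopfPair

namespace HopfPair
open Signature
namespace Axioms
open Gen

local notation "B" => false
local notation "F" => true

/-! ### The reduced axioms -/

/-- After expanding ψ and φ and cancelling the units of the trivial cocycles, each remaining weak,
twisted, cocycle or compatibility axiom is either an identity or one of the listed reduced axioms.
-/
theorem hopf_hopfDatum : Derivable hopf hopfDatumRules := by
  have h := Derivable.refl hopf
  have h₁ : Derivable hopf (commonRules ++ hopfModuleRules) := h.of_within (by decide +kernel)
  rw [hopfDatumRules, List.append_assoc, List.append_assoc, List.append_assoc]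
  exact h₁.append (h.normalForms [.norm (unitRules ++ [psiDef, phiDef])] (by decide +kernel)
    (h.of_within (L := [assoc F, coassoc B, actRMul, coactLComul, mulComulB, mulComulF,
      actRComul, mulCoactL, mulCoactR, psiPhi, actLComul]) (by decide +kernel)).withSymm
    (by decide +kernel) (by decide +kernel))

theorem hopf_restriction : Derivable hopf restrictionRules :=
  (Derivable.refl hopf).normalForms [.norm (unitRules ++ [psiDef, phiDef])] (by decide +kernel)
    (.nil _) (by decide +kernel) (by decide +kernel)

/-- The units hidden in trivial cocycles remove the twisting, so weak (co)associativity becomes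
strict and the twisted (co)action becomes an ordinary one. Naturality for the (co)actions comes from
the additional hypotheses. -/
theorem hopfDatum_hopf : Derivable (hopfDatumRules ++ naturalRules) hopf := by
  have h := Derivable.refl (hopfDatumRules ++ naturalRules)
  -- These unit laws come first because the cancellations in `h₂` use them. They come from the weak
  -- (co)unit axioms and from the unit parts of the twisted (co)actions.
  have h₁ : Derivable (hopfDatumRules ++ naturalRules)
      [unitMul F, comulCounit B, actRUnit, coactLCounit] :=
    h.normalForms [.norm (basicUnitRules ++ [mulUnit F, counitComul B, actLOnUnit, counitCoactR,
      psiDef, phiDef])] (by decide +kernel)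
      (h.of_within (L := hopfWeakRules ++ hopfTwistRules) (by decide +kernel)).withSymm
      (by decide +kernel) (by decide +kernel)
  have h₂ : Derivable (hopfDatumRules ++ naturalRules)
      [assoc F, coassoc B, actRMul, coactLComul, mulComulB, mulComulF, actRComul, mulCoactL] :=
    (h₁.append h).normalForms [.norm (unitRules ++ [psiDef, phiDef])] (by decide +kernel)
      (h.of_within (L := hopfWeakRules ++ hopfTwistRules ++ hopfCompatRules)
        (by decide +kernel)).withSymm
      (by decide +kernel) (by decide +kernel)
  exact (h₂.append (h₁.append h)).of_within (by decide +kernel)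

/-! ### From paired wreaths to Hopf data -/

/-- Units on chosen inputs and counits on chosen outputs of the bimonad equation cancel against
everything they meet, leaving a statement about the strands kept open. -/
theorem derives_of_bimonadRule {T : List (Rule Gen)} (hU : Derivable T (unitRules ++ psiPhiUnits))
    (hb : Derives T bimonadRule) (R : Rule Gen) (pre post : List (ℕ × Gen))
    (hu : target (layers R.src pre) R.src = some bimonadRule.src)
    (hR : wellTyped [bimonadRule.extend R.src pre post, R] = true)
    (h : relates [.norm (unitRules ++ psiPhiUnits)] (bimonadRule.extend R.src pre post) R = true) :
    Derives T R := by
  have hw : wellTyped (unitRules ++ psiPhiUnits) = true := by decide +kernel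
  refine hU.normalForms (L := [R]) [.norm (unitRules ++ psiPhiUnits)] (by decide +kernel)
    (.singleton (hb.extend (post := post) hu)) ?_ (by simp [h]) R (by simp)
  simp only [wellTyped, List.all_append, Bool.and_eq_true, List.flatMap_cons, Step.rules,
    List.flatMap_nil, List.all_nil, List.all_cons] at hw hR ⊢
  simpa [hw] using hR

-- The restrictions express each (co)action, product and coproduct through ψ, φ, μ_M, Δ_C and a unit
-- or counit. Hence a reduced axiom is a wreath, cowreath or bimonad axiom with some strands closed
-- off; the unit laws come first because closing off strands relies on them.
set_option maxHeartbeats 4000000 in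
theorem pairedWreath_hopf {T : List (Rule Gen)}
    (h : Derivable T (pairedWreathRules ++ naturalRules ++ restrictionRules)) :
    Derivable T hopf := by
  -- The restrictions are used in reverse here, to write each (co)action as ψ or φ with one closed
  -- strand.
  have h₁ : Derivable T [actLUnit, actROnUnit, counitCoactL, coactRCounit, actCounit B,
      actCounit F, unitCoact B, unitCoact F] :=
    h.normalForms [.norm ([unitCounit B, unitCounit F, psiUnitB, psiUnitF.flip] ++
      (psiCounits ++ phiUnits).map Rule.symm)] (by decide +kernel)
      (h.of_within (L := pairingRules) (by decide +kernel)) (by decide +kernel) (by decide +kernel)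
  have g₁ := h₁.append h
  -- The last two wreath axioms have an extra output `B`, closed by ε_B; the last two cowreath
  -- axioms have an extra input `F`, closed by η_F.
  have h₂ : Derivable T ([unitMul F, mulUnit F, counitComul B, comulCounit B] ++ psiPhiUnits) :=
    g₁.normalForms [.norm (basicUnitRules ++ [psiUnitB, psiUnitF.flip] ++ psiCounits ++ phiUnits)]
      (by decide +kernel)
      ((h.of_within (L := wreathRules ++ cowreathRules) (by decide +kernel)).withSymm.append
        (Derivable.append
          ((h.of_within (L := wreathRules.drop 5) (by decide +kernel)).extendAll
            (u := [F]) (pre := []) (post := [(1, counit B)]) (by decide +kernel))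
          ((h.of_within (L := cowreathRules.drop 5) (by decide +kernel)).extendAll
            (u := [B]) (pre := [(0, unit F)]) (post := []) (by decide +kernel))))
      (by decide +kernel) (by decide +kernel)
  have h₃ : Derivable T [actRUnit, coactLCounit, actLOnUnit, counitCoactR] :=
    (h₂.append g₁).normalForms [.norm ([unitCounit B, unitCounit F, psiUnitF, psiUnitB.flip] ++
      (psiCounits ++ phiUnits).map Rule.symm)] (by decide +kernel)
      (.nil _) (by decide +kernel) (by decide +kernel)
  have g₃ := h₃.append (h₂.append g₁)
  -- Associativity of μ_F and coassociativity of Δ_B are the (co)associativity axioms of μ_M and Δ_C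
  -- with the extra strand closed; the laws for ψ and φ come from the remaining (co)wreath axioms.
  have h₄ : Derivable T [psiMulB, psiMulF, phiComulB, phiComulF, assoc F, coassoc B] :=
    g₃.normalForms [.norm (unitRules ++ psiPhiUnits)] (by decide +kernel)
      ((h.of_within (L := wreathRules ++ cowreathRules) (by decide +kernel)).withSymm.append
        (Derivable.append
          ((h.of_within (L := (wreathRules.drop 4).take 1) (by decide +kernel)).extendAll
            (u := [F, F, F]) (pre := []) (post := [(1, counit B)]) (by decide +kernel))
          ((h.of_within (L := (cowreathRules.drop 4).take 1) (by decide +kernel)).extendAll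
            (u := [B]) (pre := [(0, unit F)]) (post := []) (by decide +kernel))).withSymm)
      (by decide +kernel) (by decide +kernel)
  -- Each of the four laws of ψ and φ gives two module or comodule laws, one for each strand that
  -- can be closed.
  have h₅ : Derivable T [actLMul, actRMul, coactLComul, coactRComul, actLOnMul, actROnMul,
      comulCoactL, comulCoactR] :=
    g₃.normalForms [.norm (unitRules ++ psiPhiUnits)] (by decide +kernel)
      (Derivable.append
        (.append
          (.append
            ((h₄.of_within (L := [psiMulB]) (by decide +kernel)).extendAll
              (u := [B, B, F]) (pre := []) (post := [(1, counit B)]) (by decide +kernel))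
            ((h₄.of_within (L := [psiMulB]) (by decide +kernel)).extendAll
              (u := [B, B, F]) (pre := []) (post := [(0, counit F)]) (by decide +kernel)))
          (.append
            ((h₄.of_within (L := [psiMulF]) (by decide +kernel)).extendAll
              (u := [B, F, F]) (pre := []) (post := [(1, counit B)]) (by decide +kernel))
            ((h₄.of_within (L := [psiMulF]) (by decide +kernel)).extendAll
              (u := [B, F, F]) (pre := []) (post := [(0, counit F)]) (by decide +kernel))))
        (.append
          ((h₄.of_within (L := [phiComulB, phiComulF]) (by decide +kernel)).extendAll
            (u := [F]) (pre := [(1, unit B)]) (post := []) (by decide +kernel))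
          ((h₄.of_within (L := [phiComulB, phiComulF]) (by decide +kernel)).extendAll
            (u := [B]) (pre := [(0, unit F)]) (post := []) (by decide +kernel)))).withSymm
      (by decide +kernel) (by decide +kernel)
  have g₄ : Derivable T (unitRules ++ psiPhiUnits) := g₃.of_within (by decide +kernel)
  have hb : Derives T bimonadRule :=
    g₄.normalForms (L := [bimonadRule]) [.norm (unitRules ++ psiPhiUnits)] (by decide +kernel)
      (h.of_within (L := [crossBimonad]) (by decide +kernel)).withSymm (by decide +kernel)
      (by decide +kernel) _ (List.mem_singleton_self _)
  -- In each case units close one letter of each input pair `FB`, and counits close one letter of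
  -- each output pair; the open letters spell the source and target of the rule.
  have h₆ : Derivable T [psiPhi, mulComulB, mulComulF, actLComul, actRComul, mulCoactL,
      mulCoactR] := by
    intro R hR
    simp only [List.mem_cons, List.not_mem_nil, or_false] at hR
    rcases hR with rfl | rfl | rfl | rfl | rfl | rfl | rfl
    · exact derives_of_bimonadRule g₄ hb _ [(0, unit F), (3, unit B)] [(0, counit F), (2, counit B)]
        (by decide +kernel) (by decide +kernel) (by decide +kernel)
    · exact derives_of_bimonadRule g₄ hb _ [(0, unit F), (2, unit F)] [(0, counit F), (1, counit F)]
        (by decide +kernel) (by decide +kernel) (by decide +kernel)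
    · exact derives_of_bimonadRule g₄ hb _ [(1, unit B), (3, unit B)] [(1, counit B), (2, counit B)]
        (by decide +kernel) (by decide +kernel) (by decide +kernel)
    · exact derives_of_bimonadRule g₄ hb _ [(0, unit F), (3, unit B)] [(1, counit B), (2, counit B)]
        (by decide +kernel) (by decide +kernel) (by decide +kernel)
    · exact derives_of_bimonadRule g₄ hb _ [(0, unit F), (3, unit B)] [(0, counit F), (1, counit F)]
        (by decide +kernel) (by decide +kernel) (by decide +kernel)
    · exact derives_of_bimonadRule g₄ hb _ [(1, unit B), (3, unit B)] [(0, counit F), (2, counit B)]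
        (by decide +kernel) (by decide +kernel) (by decide +kernel)
    · exact derives_of_bimonadRule g₄ hb _ [(0, unit F), (2, unit F)] [(0, counit F), (2, counit B)]
        (by decide +kernel) (by decide +kernel) (by decide +kernel)
  exact (h₆.append (h₅.append (h₄.append g₃))).of_within (by decide +kernel)

end Axioms
end HopfPair

namespace HopfPair
open Signature

/-! ### String diagrams in a bicategory -/

section Objects

variable {K : Type u} [Bicategory.{w, v} K] {a : K} (X : Bool → (a ⟶ a))

/-- The 1-cell that a word stands for. -/
def ob : Word → (a ⟶ a)
  | [] => 𝟙 a
  | x :: u => X x ≫ ob u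

/-- Words stand for right-nested composites ending in the identity, so concatenation agrees with
composition only up to this isomorphism. -/
def appIso : ∀ u v : Word, ob X u ≫ ob X v ≅ ob X (u ++ v)
  | [], v => λ_ (ob X v)
  | x :: u, v => α_ (X x) (ob X u) (ob X v) ≪≫ whiskerLeftIso (X x) (appIso u v)

/-- The structural 2-cell between equal words. -/
def obEq {u v : Word} (h : u = v) : ob X u ⟶ ob X v := eqToHom (congrArg (ob X) h)

@[simp] theorem obEq_refl {u : Word} (h : u = u) : obEq X h = 𝟙 _ := rfl

@[simp] theorem obEq_trans {u v z : Word} (h : u = v) (h' : v = z) :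
    obEq X h ≫ obEq X h' = obEq X (h.trans h') := by
  subst h h'
  simp

@[simp] theorem obEq_trans_assoc {u v z : Word} (h : u = v) (h' : v = z) {Z : a ⟶ a}
    (f : ob X z ⟶ Z) : obEq X h ≫ obEq X h' ≫ f = obEq X (h.trans h') ≫ f := by
  subst h h'
  simp

theorem whiskerLeft_obEq (x : Bool) {u v : Word} (h : u = v) :
    X x ◁ obEq X h = obEq X (congrArg (List.cons x) h) := by
  subst h
  simp [ob]

variable {X}

/-- Strands on the left of a 2-cell. -/
def wl {u v : Word} : ∀ (l : Word), (ob X u ⟶ ob X v) → (ob X (l ++ u) ⟶ ob X (l ++ v))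
  | [], f => f
  | x :: l, f => X x ◁ wl l f

/-- Strands on the right of a 2-cell. -/
def wr {u v : Word} (f : ob X u ⟶ ob X v) (r : Word) : ob X (u ++ r) ⟶ ob X (v ++ r) :=
  (appIso X u r).inv ≫ f ▷ ob X r ≫ (appIso X v r).hom

/-- The recursive definition makes adding one letter on the left definitional; this conjugated form
matches that of `wr` and gives access to the whiskering lemmas. -/
theorem wl_eq {u v : Word} (l : Word) (f : ob X u ⟶ ob X v) :
    wl l f = (appIso X l u).inv ≫ ob X l ◁ f ≫ (appIso X l v).hom := by
  induction l with
  | nil => simp [wl, appIso, ob]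
  | cons x l ih => simp [wl, appIso, ih, ob]

@[simp] theorem wl_id (l u : Word) : wl l (𝟙 (ob X u)) = 𝟙 _ := by simp [wl_eq]

@[simp] theorem wr_id (u r : Word) : wr (𝟙 (ob X u)) r = 𝟙 _ := by simp [wr]

theorem wl_comp {u v z : Word} (l : Word) (f : ob X u ⟶ ob X v) (g : ob X v ⟶ ob X z) :
    wl l (f ≫ g) = wl l f ≫ wl l g := by simp [wl_eq]

theorem wr_comp {u v z : Word} (f : ob X u ⟶ ob X v) (g : ob X v ⟶ ob X z) (r : Word) :
    wr (f ≫ g) r = wr f r ≫ wr g r := by simp [wr]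

theorem wr_obEq {u v : Word} (h : u = v) (r : Word) :
    wr (obEq X h) r = obEq X (congrArg (· ++ r) h) := by
  subst h
  simp

theorem wl_obEq {u v : Word} (h : u = v) (l : Word) :
    wl l (obEq X h) = obEq X (congrArg (l ++ ·) h) := by
  subst h
  simp

theorem wl_append {u v : Word} (l l' : Word) (f : ob X u ⟶ ob X v) :
    wl (l ++ l') f = obEq X (List.append_assoc ..) ≫ wl l (wl l' f) ≫
      obEq X (List.append_assoc ..).symm := by
  induction l with
  | nil => simp [wl]
  | cons x l ih =>
    simp only [List.cons_append, wl, ih, Bicategory.whiskerLeft_comp, whiskerLeft_obEq]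
    rfl

theorem wr_wl_exchange {u v s t : Word} (f : ob X u ⟶ ob X v) (g : ob X s ⟶ ob X t) :
    wr f s ≫ wl v g = wl u g ≫ wr f t := by
  simp [wl_eq, wr, whisker_exchange_assoc]

/-- This is the coherence statement for concatenation, by induction on the first word: the
associator is absorbed by associativity of lists, which survives only as `obEq`. -/
theorem appIso_assoc (u v z : Word) :
    (appIso X u v).hom ▷ ob X z ≫ (appIso X (u ++ v) z).hom =
      (α_ _ _ _).hom ≫ ob X u ◁ (appIso X v z).hom ≫ (appIso X u (v ++ z)).hom ≫
        obEq X (List.append_assoc ..).symm := by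
  induction u with
  | nil =>
    change (λ_ (ob X v)).hom ▷ ob X z ≫ (appIso X v z).hom = (α_ (𝟙 a) _ _).hom ≫
      𝟙 a ◁ (appIso X v z).hom ≫ (λ_ _).hom ≫ 𝟙 _
    simp
  | cons x u ih =>
    change ((α_ (X x) (ob X u) (ob X v)).hom ≫ X x ◁ (appIso X u v).hom) ▷ ob X z ≫
        (α_ (X x) (ob X (u ++ v)) (ob X z)).hom ≫ X x ◁ (appIso X (u ++ v) z).hom =
      (α_ (X x ≫ ob X u) (ob X v) (ob X z)).hom ≫ (X x ≫ ob X u) ◁ (appIso X v z).hom ≫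
        ((α_ (X x) (ob X u) (ob X (v ++ z))).hom ≫ X x ◁ (appIso X u (v ++ z)).hom) ≫
          obEq X (congrArg (List.cons x) (List.append_assoc u v z).symm)
    rw [← whiskerLeft_obEq X x (List.append_assoc u v z).symm]
    change _ = (α_ (X x ≫ ob X u) (ob X v) (ob X z)).hom ≫
      (X x ≫ ob X u) ◁ (appIso X v z).hom ≫ ((α_ (X x) (ob X u) (ob X (v ++ z))).hom ≫
        X x ◁ (appIso X u (v ++ z)).hom) ≫ X x ◁ obEq X (List.append_assoc u v z).symm
    have h := congrArg (fun f => (X x) ◁ f) ih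
    simp only [Bicategory.whiskerLeft_comp] at h
    simp [h]

theorem appIso_nil (u : Word) :
    (appIso X u []).hom = (ρ_ _).hom ≫ obEq X (List.append_nil u).symm := by
  induction u with
  | nil => simp [appIso, ob, unitors_equal]
  | cons x u ih =>
    change (α_ (X x) (ob X u) (𝟙 a)).hom ≫ X x ◁ (appIso X u []).hom =
      (ρ_ (X x ≫ ob X u)).hom ≫ obEq X (congrArg (List.cons x) (List.append_nil u).symm)
    rw [← whiskerLeft_obEq X x (List.append_nil u).symm, ih]
    simp [ob]

theorem appIso_assoc_inv (u v z : Word) :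
    (appIso X (u ++ v) z).inv ≫ (appIso X u v).inv ▷ ob X z =
      obEq X (List.append_assoc ..) ≫ (appIso X u (v ++ z)).inv ≫
        ob X u ◁ (appIso X v z).inv ≫ (α_ _ _ _).inv := by
  rw [← cancel_epi (appIso X (u ++ v) z).hom, Iso.hom_inv_id_assoc,
    ← cancel_epi ((appIso X u v).hom ▷ ob X z), hom_inv_whiskerRight, ← Category.assoc,
    appIso_assoc]
  simp [← Bicategory.whiskerLeft_comp_assoc]

theorem wr_wr {u v : Word} (f : ob X u ⟶ ob X v) (r s : Word) :
    wr (wr f r) s = obEq X (List.append_assoc ..) ≫ wr f (r ++ s) ≫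
      obEq X (List.append_assoc ..).symm := by
  simp only [wr, comp_whiskerRight, Category.assoc]
  rw [appIso_assoc, ← Category.assoc, appIso_assoc_inv]
  rw [associator_naturality_left_assoc]
  simp only [Category.assoc, Iso.inv_hom_id_assoc]
  rw [← whisker_exchange_assoc, whiskerLeft_inv_hom_assoc]

theorem wr_wl {u v : Word} (l : Word) (f : ob X u ⟶ ob X v) (r : Word) :
    wr (wl l f) r = obEq X (List.append_assoc ..) ≫ wl l (wr f r) ≫
      obEq X (List.append_assoc ..).symm := by
  simp only [wr, wl_eq, comp_whiskerRight, Category.assoc]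
  rw [appIso_assoc, ← Category.assoc, appIso_assoc_inv]
  simp

/-- Equality of 2-cells up to equality of the words. -/
def Similar {u v u' v' : Word} (f : ob X u ⟶ ob X v) (f' : ob X u' ⟶ ob X v') : Prop :=
  ∃ (h : u = u') (h' : v' = v), f = obEq X h ≫ f' ≫ obEq X h'

namespace Similar

theorem refl {u v : Word} (f : ob X u ⟶ ob X v) : Similar f f := ⟨rfl, rfl, by simp⟩

theorem trans {u v u' v' u'' v'' : Word} {f : ob X u ⟶ ob X v} {f' : ob X u' ⟶ ob X v'}
    {f'' : ob X u'' ⟶ ob X v''} (h : Similar f f') (h' : Similar f' f'') : Similar f f'' := by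
  obtain ⟨rfl, rfl, rfl⟩ := h
  simpa using h'

theorem wl {u v u' v' : Word} {f : ob X u ⟶ ob X v} {f' : ob X u' ⟶ ob X v'}
    (h : Similar f f') (l : Word) : Similar (wl l f) (HopfPair.wl l f') := by
  obtain ⟨rfl, rfl, rfl⟩ := h
  simpa using refl _

end Similar

theorem wl_append_similar {u v : Word} (l l' : Word) (f : ob X u ⟶ ob X v) :
    Similar (wl (l ++ l') f) (wl l (wl l' f)) := ⟨_, _, wl_append l l' f⟩

theorem wr_wr_similar {u v : Word} (f : ob X u ⟶ ob X v) (r s : Word) :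
    Similar (wr f (r ++ s)) (wr (wr f r) s) := by
  refine ⟨(List.append_assoc ..).symm, List.append_assoc .., ?_⟩
  rw [wr_wr]
  simp

theorem wl_wr_similar {u v : Word} (l : Word) (f : ob X u ⟶ ob X v) (r : Word) :
    Similar (wl l (wr f r)) (wr (wl l f) r) := by
  refine ⟨(List.append_assoc ..).symm, List.append_assoc .., ?_⟩
  rw [wr_wl]
  simp

end Objects

/-- An interpretation of the generating 2-cells in a bicategory. -/
structure Model (K : Type u) [Bicategory.{w, v} K] (a : K) (G : Type) [Signature G] where
  strand : Bool → (a ⟶ a)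
  cell : ∀ g : G, ob strand (dom g) ⟶ ob strand (cod g)

namespace Model

variable {K : Type u} [Bicategory.{w, v} K] {a : K} {G : Type} [Signature G] (M : Model K a G)

def layer (x : Layer G) : ob M.strand x.src ⟶ ob M.strand x.tgt :=
  wl x.left (wr (M.cell x.gen) x.right)

/-- The 2-cell that a string diagram stands for. -/
def eval : Diagram G → ∀ u v : Word, Option (ob M.strand u ⟶ ob M.strand v)
  | [], u, v => if h : u = v then some (obEq M.strand h) else none
  | x :: d, u, v => if h : u = x.src then
      (eval d x.tgt v).map fun f => obEq M.strand h ≫ M.layer x ≫ f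
    else none

theorem eval_nil {u v : Word} (h : u = v) : M.eval [] u v = some (obEq M.strand h) := by
  simp [eval, h]

theorem eval_cons (x : Layer G) (d : Diagram G) (v : Word) :
    M.eval (x :: d) x.src v = (M.eval d x.tgt v).map fun f => M.layer x ≫ f := by
  simp [eval]

theorem eval_single {x : Layer G} {u v : Word} {f : ob M.strand u ⟶ ob M.strand v}
    (h : Similar (M.layer x) f) : M.eval [x] u v = some f := by
  obtain ⟨rfl, rfl, h⟩ := h
  simp [eval, h]

theorem isSome_eval (d : Diagram G) (u v : Word) :
    (M.eval d u v).isSome ↔ target d u = some v := by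
  induction d generalizing u with
  | nil => by_cases h : u = v <;> simp [eval, target, h]
  | cons x d ih =>
    rw [target_cons]
    by_cases h : u = x.src
    · subst h
      simp [eval_cons, ih]
    · simp [eval, h]

theorem eval_eq_none {d : Diagram G} {u v : Word} (h : target d u ≠ some v) :
    M.eval d u v = none := by
  rw [← Option.not_isSome_iff_eq_none, isSome_eval]
  exact h

theorem exists_eval {d : Diagram G} {u v : Word} (h : target d u = some v) :
    ∃ f, M.eval d u v = some f :=
  Option.isSome_iff_exists.1 ((M.isSome_eval d u v).2 h)

theorem target_of_eval {d : Diagram G} {u v : Word} {f} (h : M.eval d u v = some f) :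
    target d u = some v :=
  (M.isSome_eval d u v).1 (by simp [h])

theorem eval_append {d e : Diagram G} {u v z : Word} {f g} (hf : M.eval d u v = some f)
    (hg : M.eval e v z = some g) : M.eval (d ++ e) u z = some (f ≫ g) := by
  induction d generalizing u with
  | nil =>
    obtain rfl : u = v := by simpa [target] using M.target_of_eval hf
    obtain rfl : 𝟙 _ = f := by simpa [eval] using hf
    simpa using hg
  | cons x d ih =>
    have h := M.target_of_eval hf
    rw [target_cons] at h
    split_ifs at h with hu
    subst hu
    rw [eval_cons, Option.map_eq_some_iff] at hf
    obtain ⟨f', hf', rfl⟩ := hf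
    rw [List.cons_append, eval_cons, ih hf']
    simp

theorem eval_context {d d' : Diagram G} {v : Word} (h : ∀ z, M.eval d v z = M.eval d' v z)
    {pre : Diagram G} {u : Word} (hu : target pre u = some v) (post : Diagram G) (z : Word) :
    M.eval (pre ++ (d ++ post)) u z = M.eval (pre ++ (d' ++ post)) u z := by
  have ht : target d v = target d' v := by
    ext z
    rw [← M.isSome_eval, ← M.isSome_eval, h]
  have ht' : target (pre ++ (d ++ post)) u = target (pre ++ (d' ++ post)) u := by
    simp [target_append, hu, ht]
  by_cases hz : target (pre ++ (d ++ post)) u = some z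
  · obtain ⟨f, hf⟩ := M.exists_eval hu
    have hz' := hz
    simp only [target_append, hu, Option.bind_some, Option.bind_eq_some_iff] at hz'
    obtain ⟨s, hs, hz'⟩ := hz'
    obtain ⟨g, hg⟩ := M.exists_eval hs
    obtain ⟨k, hk⟩ := M.exists_eval hz'
    rw [M.eval_append hf (M.eval_append hg hk),
      M.eval_append hf (M.eval_append ((h s).symm.trans hg) hk)]
  · rw [M.eval_eq_none hz, M.eval_eq_none (ht' ▸ hz)]

theorem eval_context' {d d' : Diagram G} {pre : Diagram G} {u : Word}
    (h : ∀ v, target pre u = some v → ∀ z, M.eval d v z = M.eval d' v z)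
    (post : Diagram G) (z : Word) :
    M.eval (pre ++ (d ++ post)) u z = M.eval (pre ++ (d' ++ post)) u z := by
  rcases hu : target pre u with _ | v
  · rw [M.eval_eq_none (by simp [target_append, hu]), M.eval_eq_none (by simp [target_append, hu])]
  · exact M.eval_context (h v hu) hu post z

theorem eval_padLeft (l : Word) {d : Diagram G} {u v : Word} {f} (h : M.eval d u v = some f) :
    M.eval (padLeft l d) (l ++ u) (l ++ v) = some (wl l f) := by
  induction d generalizing u with
  | nil =>
    obtain rfl : u = v := by simpa [target] using M.target_of_eval h
    obtain rfl : 𝟙 _ = f := by simpa [eval] using h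
    simp [eval]
  | cons x d ih =>
    have h' := M.target_of_eval h
    rw [target_cons] at h'
    split_ifs at h' with hu
    subst hu
    rw [eval_cons, Option.map_eq_some_iff] at h
    obtain ⟨f', hf', rfl⟩ := h
    rw [wl_comp]
    exact M.eval_append (M.eval_single (x := ⟨l ++ x.left, x.gen, x.right⟩)
      (wl_append_similar ..)) (ih hf')

theorem eval_padRight (r : Word) {d : Diagram G} {u v : Word} {f} (h : M.eval d u v = some f) :
    M.eval (padRight d r) (u ++ r) (v ++ r) = some (wr f r) := by
  induction d generalizing u with
  | nil =>
    obtain rfl : u = v := by simpa [target] using M.target_of_eval h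
    obtain rfl : 𝟙 _ = f := by simpa [eval] using h
    simp [eval]
  | cons x d ih =>
    have h' := M.target_of_eval h
    rw [target_cons] at h'
    split_ifs at h' with hu
    subst hu
    rw [eval_cons, Option.map_eq_some_iff] at h
    obtain ⟨f', hf', rfl⟩ := h
    rw [wr_comp]
    exact M.eval_append (M.eval_single (x := ⟨x.left, x.gen, x.right ++ r⟩)
      (((wr_wr_similar ..).wl _).trans (wl_wr_similar ..))) (ih hf')

/-- The model `M` satisfies the rule `R`. -/
def Satisfies (R : Rule G) : Prop :=
  ∀ v, M.eval R.lhs R.src v = M.eval R.rhs R.src v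

theorem eval_pad (l r : Word) {d d' : Diagram G} {u : Word}
    (h : ∀ v, M.eval d u v = M.eval d' u v) (z : Word) :
    M.eval (padLeft l (padRight d r)) (l ++ (u ++ r)) z =
      M.eval (padLeft l (padRight d' r)) (l ++ (u ++ r)) z := by
  have ht : target d u = target d' u := by
    ext z
    rw [← M.isSome_eval, ← M.isSome_eval, h]
  rcases hd : target d u with _ | v
  · rw [M.eval_eq_none (by simp [target_pad, hd]),
      M.eval_eq_none (by simp [target_pad, ← ht, hd])]
  · by_cases hz : z = l ++ (v ++ r)
    · subst hz
      obtain ⟨f, hf⟩ := M.exists_eval hd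
      rw [M.eval_padLeft l (M.eval_padRight r hf),
        M.eval_padLeft l (M.eval_padRight r ((h v).symm.trans hf))]
    · rw [M.eval_eq_none (by simpa [target_pad, hd] using Ne.symm hz),
        M.eval_eq_none (by simpa [target_pad, ← ht, hd] using Ne.symm hz)]

/-- The exchange of generators is interpreted by the interchange law for whiskering. Both orders
accept the same starting word and end on the same word, so they are also undefined together. -/
theorem eval_exchange (l : Word) (g : G) (m : Word) (h : G) (r v z : Word) :
    M.eval [⟨l, g, m ++ (dom h ++ r)⟩, ⟨l ++ (cod g ++ m), h, r⟩] v z =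
      M.eval [⟨l ++ (dom g ++ m), h, r⟩, ⟨l, g, m ++ (cod h ++ r)⟩] v z := by
  set x : Layer G := ⟨l, g, m ++ (dom h ++ r)⟩
  set y : Layer G := ⟨l ++ (cod g ++ m), h, r⟩
  set y' : Layer G := ⟨l ++ (dom g ++ m), h, r⟩
  set x' : Layer G := ⟨l, g, m ++ (cod h ++ r)⟩
  have ht : target [x, y] v = if v = x.src then some x'.tgt else none := by
    rw [target_cons, target_cons]
    simp [target, x, y, x', Layer.src, Layer.tgt]
    congr
  have ht' : target [y', x'] v = if v = x.src then some x'.tgt else none := by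
    rw [target_cons, target_cons]
    simp [target, x, y', x', Layer.src, Layer.tgt]
    congr
  by_cases hz : v = x.src ∧ x'.tgt = z
  · obtain ⟨rfl, rfl⟩ := hz
    have h₁ := M.eval_append (M.eval_single (x := x) (.refl _))
      (M.eval_single (x := y) ((wl_append_similar ..).trans ((wl_append_similar ..).wl _)))
    have h₂ := M.eval_append
      (M.eval_single (x := y') ((wl_append_similar ..).trans ((wl_append_similar ..).wl _)))
      (M.eval_single (x := x') (.refl _))
    have h₃ := congrArg (wl l) (wr_wl_exchange (M.cell g) (wl m (wr (M.cell h) r)))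
    rw [wl_comp, wl_comp] at h₃
    exact h₁.trans ((congrArg some h₃).trans h₂.symm)
  · rw [M.eval_eq_none, M.eval_eq_none]
    · rw [ht']
      simpa using fun h₁ h₂ => hz ⟨h₁, h₂⟩
    · rw [ht]
      simpa using fun h₁ h₂ => hz ⟨h₁, h₂⟩

/-- Soundness: exchanges hold by interchange, and rules survive strands on either side and layers
above and below because evaluation is compatible with whiskering and composition. -/
theorem eval_conv {T : List (Rule G)} (hT : ∀ R ∈ T, M.Satisfies R) {u : Word}
    {d d' : Diagram G} (h : Conv T u d d') (z : Word) : M.eval d u z = M.eval d' u z := by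
  induction h generalizing z with
  | refl => rfl
  | symm _ ih => exact (ih z).symm
  | trans _ _ ih ih' => exact (ih z).trans (ih' z)
  | exchange u pre post l g m h r =>
    exact M.eval_context' (d := [_, _]) (d' := [_, _])
      (fun v _ => M.eval_exchange l g m h r v) post z
  | rule hR u pre l r post hu => exact M.eval_context (M.eval_pad l r (hT _ hR)) hu post z

theorem Satisfies.of_derives {T : List (Rule G)} {R : Rule G} (hT : ∀ R ∈ T, M.Satisfies R)
    (h : Derives T R) : M.Satisfies R := M.eval_conv hT h

theorem satisfies_iff {R : Rule G} (hR : R.WellTyped) :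
    M.Satisfies R ↔ M.eval R.lhs R.src R.tgt = M.eval R.rhs R.src R.tgt := by
  refine ⟨fun h => h _, fun h v => ?_⟩
  by_cases hv : v = R.tgt
  · subst hv
    exact h
  · rw [M.eval_eq_none, M.eval_eq_none]
    · rw [hR.2]
      simpa using Ne.symm hv
    · rw [hR.1]
      simpa using Ne.symm hv

end Model

end HopfPair

namespace HopfPair
open Signature

/-! ### Expressions in a bicategory as string diagrams -/

section Reify

variable {K : Type u} [Bicategory.{w, v} K] {a : K}

theorem appIso_nil_inv (X : Bool → (a ⟶ a)) (u : Word) :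
    (appIso X u []).inv = obEq X (List.append_nil u) ≫ (ρ_ (ob X u)).inv := by
  have h : appIso X u [] = ρ_ (ob X u) ≪≫
    eqToIso (congrArg (ob X) (List.append_nil u).symm) := Iso.ext (appIso_nil u)
  exact congrArg Iso.inv h

theorem wr_nil_similar {X : Bool → (a ⟶ a)} {u v : Word} (f : ob X u ⟶ ob X v) :
    Similar (wr f []) f := by
  refine ⟨List.append_nil u, (List.append_nil v).symm, ?_⟩
  rw [wr, appIso_nil, appIso_nil_inv]
  simp [ob]

/-- The word `u` stands for the 1-cell `Y`. -/
class OneCell (X : Bool → (a ⟶ a)) (Y : a ⟶ a) (u : outParam Word) where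
  iso (X Y) : ob X u ≅ Y

namespace OneCell

variable {X : Bool → (a ⟶ a)}

instance : OneCell X (𝟙 a) [] := ⟨Iso.refl _⟩

instance comp (Y Z : a ⟶ a) {u v : Word} [OneCell X Y u] [OneCell X Z v] :
    OneCell X (Y ≫ Z) (u ++ v) :=
  ⟨(appIso X u v).symm ≪≫ whiskerRightIso (iso X Y) _ ≪≫ whiskerLeftIso _ (iso X Z)⟩

end OneCell

variable (X : Bool → (a ⟶ a))

/-- A 2-cell as a 2-cell between words. -/
def reify {Y Z : a ⟶ a} {u v : Word} [OneCell X Y u] [OneCell X Z v] (f : Y ⟶ Z) :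
    ob X u ⟶ ob X v :=
  (OneCell.iso X Y).hom ≫ f ≫ (OneCell.iso X Z).inv

section

variable {Y Z W : a ⟶ a} {u v z : Word} [OneCell X Y u] [OneCell X Z v] [OneCell X W z]

theorem reify_comp (f : Y ⟶ Z) (g : Z ⟶ W) : reify X (f ≫ g) = reify X f ≫ reify X g := by
  simp [reify]

theorem reify_id : reify X (𝟙 Y) = 𝟙 _ := by simp [reify]

theorem reify_injective : Function.Injective (reify X : (Y ⟶ Z) → _) := fun f g h => by
  simpa [reify] using h

theorem reify_whiskerLeft (f : Y ⟶ Z) : reify X (W ◁ f) = wl z (reify X f) := by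
  simp [reify, wl_eq, OneCell.iso, whisker_exchange_assoc]

theorem reify_whiskerRight (f : Y ⟶ Z) : reify X (f ▷ W) = wr (reify X f) z := by
  simp only [reify, wr, OneCell.iso, Iso.trans_hom, Iso.trans_inv, Iso.symm_hom, Iso.symm_inv,
    whiskerRightIso_hom, whiskerLeftIso_hom, whiskerRightIso_inv, whiskerLeftIso_inv,
    Category.assoc, comp_whiskerRight]
  rw [whisker_exchange_assoc, ← Bicategory.whiskerLeft_comp_assoc]
  simp

/-- Since associators and unitors become equalities of words, the structural isomorphisms inside
`⊗≫` leave no trace in a diagram. -/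
theorem reify_associator :
    reify X (α_ Y Z W).hom = obEq X (List.append_assoc u v z) := by
  simp only [reify, OneCell.iso, Iso.trans_hom, Iso.trans_inv, Iso.symm_hom, Iso.symm_inv,
    whiskerRightIso_hom, whiskerLeftIso_hom, whiskerRightIso_inv, whiskerLeftIso_inv,
    Category.assoc, comp_whiskerRight, Bicategory.whiskerLeft_comp]
  rw [← Category.assoc, appIso_assoc_inv]
  simp
  rw [associator_naturality_left_assoc, Iso.inv_hom_id_assoc, ← whisker_exchange_assoc]
  simp

theorem reify_leftUnitor : reify X (λ_ Y).hom = 𝟙 _ := by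
  simp [reify, OneCell.iso, appIso, ob]

theorem reify_rightUnitor : reify X (ρ_ Y).hom = obEq X (List.append_nil u) := by
  have h := appIso_nil_inv X u
  simp only [reify, OneCell.iso, Iso.trans_hom, Iso.symm_hom, whiskerRightIso_hom]
  rw [h]
  simp [ob]

end

section

variable {Y Z : a ⟶ a} {u v : Word} [OneCell X Y u] [OneCell X Z v]

/-- The 2-cell `f` is made of the structural isomorphisms of the bicategory. -/
class Structural (f : Y ⟶ Z) : Prop where
  reify_eq : ∃ h : u = v, reify X f = obEq X h

/-- The structural isomorphism in a vertical composition consists of associators and unitors. -/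
class StructuralCoherence (c : BicategoricalCoherence Y Z) : Prop where
  structural : Structural X c.iso.hom

end

section

variable {Y Z W : a ⟶ a} {u v z : Word} [OneCell X Y u] [OneCell X Z v] [OneCell X W z]

namespace Structural

instance id : Structural X (𝟙 Y) := ⟨rfl, reify_id X⟩

instance comp (f : Y ⟶ Z) (g : Z ⟶ W) [hf : Structural X f] [hg : Structural X g] :
    Structural X (f ≫ g) := by
  obtain ⟨hu, hf⟩ := hf.reify_eq
  obtain ⟨hv, hg⟩ := hg.reify_eq
  exact ⟨hu.trans hv, by rw [reify_comp X, hf, hg, obEq_trans]⟩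

theorem inv (f : Y ≅ Z) (hf : Structural X f.hom) : Structural X f.inv := by
  obtain ⟨rfl, hf⟩ := hf.reify_eq
  refine ⟨rfl, ?_⟩
  have h := reify_comp X f.hom f.inv
  rw [f.hom_inv_id, reify_id, hf] at h
  simpa using h.symm

instance whiskerLeft (f : Y ⟶ Z) [hf : Structural X f] : Structural X (W ◁ f) := by
  obtain ⟨hu, hf⟩ := hf.reify_eq
  exact ⟨congrArg (z ++ ·) hu, by rw [reify_whiskerLeft, hf, wl_obEq]⟩

instance whiskerRight (f : Y ⟶ Z) [hf : Structural X f] : Structural X (f ▷ W) := by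
  obtain ⟨hu, hf⟩ := hf.reify_eq
  exact ⟨congrArg (· ++ z) hu, by rw [reify_whiskerRight, hf, wr_obEq]⟩

instance associator : Structural X (α_ Y Z W).hom := ⟨_, reify_associator X⟩

instance associator_inv : Structural X (α_ Y Z W).inv := inv X _ (associator X)

instance leftUnitor : Structural X (λ_ Y).hom := ⟨rfl, reify_leftUnitor X⟩

instance leftUnitor_inv : Structural X (λ_ Y).inv := inv X _ (leftUnitor X)

instance rightUnitor : Structural X (ρ_ Y).hom := ⟨_, reify_rightUnitor X⟩

instance rightUnitor_inv : Structural X (ρ_ Y).inv := inv X _ (rightUnitor X)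

end Structural

namespace StructuralCoherence

open BicategoricalCoherence

attribute [local instance] StructuralCoherence.structural

/-- The instances follow the ways in which the isomorphism inside `⊗≫` is assembled, so that
instance search certifies it as structural. -/
instance : StructuralCoherence X (.refl Y) := ⟨Structural.id X⟩

instance (c : BicategoricalCoherence Z W) [StructuralCoherence X c] :
    StructuralCoherence X (.whiskerLeft Y Z W) :=
  ⟨inferInstanceAs (Structural X (Y ◁ c.iso.hom))⟩

instance (c : BicategoricalCoherence Y Z) [StructuralCoherence X c] :
    StructuralCoherence X (.whiskerRight Y Z W) :=
  ⟨inferInstanceAs (Structural X (c.iso.hom ▷ W))⟩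

instance (c : BicategoricalCoherence (𝟙 a) Z) [StructuralCoherence X c] :
    StructuralCoherence X (.tensorRight Y Z) :=
  ⟨inferInstanceAs (Structural X ((ρ_ Y).inv ≫ Y ◁ c.iso.hom))⟩

instance (c : BicategoricalCoherence Z (𝟙 a)) [StructuralCoherence X c] :
    StructuralCoherence X (.tensorRight' Y Z) :=
  ⟨inferInstanceAs (Structural X (Y ◁ c.iso.hom ≫ (ρ_ Y).hom))⟩

instance (c : BicategoricalCoherence Y Z) [StructuralCoherence X c] :
    StructuralCoherence X (.left Y Z) :=
  ⟨inferInstanceAs (Structural X ((λ_ Y).hom ≫ c.iso.hom))⟩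

instance (c : BicategoricalCoherence Y Z) [StructuralCoherence X c] :
    StructuralCoherence X (.left' Y Z) :=
  ⟨inferInstanceAs (Structural X (c.iso.hom ≫ (λ_ Z).inv))⟩

instance (c : BicategoricalCoherence Y Z) [StructuralCoherence X c] :
    StructuralCoherence X (.right Y Z) :=
  ⟨inferInstanceAs (Structural X ((ρ_ Y).hom ≫ c.iso.hom))⟩

instance (c : BicategoricalCoherence Y Z) [StructuralCoherence X c] :
    StructuralCoherence X (.right' Y Z) :=
  ⟨inferInstanceAs (Structural X (c.iso.hom ≫ (ρ_ Z).inv))⟩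

variable {V : a ⟶ a} {s : Word} [OneCell X V s]

instance (c : BicategoricalCoherence (Y ≫ Z ≫ W) V) [StructuralCoherence X c] :
    StructuralCoherence X (.assoc Y Z W V) :=
  ⟨inferInstanceAs (Structural X ((α_ Y Z W).hom ≫ c.iso.hom))⟩

instance (c : BicategoricalCoherence V (Y ≫ Z ≫ W)) [StructuralCoherence X c] :
    StructuralCoherence X (.assoc' Y Z W V) :=
  ⟨inferInstanceAs (Structural X (c.iso.hom ≫ (α_ Y Z W).inv))⟩

end StructuralCoherence

end

end Reify

/-- The diagram `d` stands for the 2-cell `f`. -/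
class TwoCell {K : Type u} [Bicategory.{w, v} K] {a : K} {G : Type} [Signature G]
    (M : Model K a G) {Y Z : a ⟶ a} {u v : Word} [OneCell M.strand Y u] [OneCell M.strand Z v]
    (f : Y ⟶ Z) (d : outParam (Diagram G)) : Prop where
  eval_eq : M.eval d u v = some (reify M.strand f)

namespace TwoCell

variable {K : Type u} [Bicategory.{w, v} K] {a : K} {G : Type} [Signature G] (M : Model K a G)
variable {Y Z W : a ⟶ a} {u v z : Word} [OneCell M.strand Y u] [OneCell M.strand Z v]
  [OneCell M.strand W z]

theorem of_structural (f : Y ⟶ Z) [h : Structural M.strand f] : TwoCell M f [] := by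
  obtain ⟨h, h'⟩ := h.reify_eq
  exact ⟨by rw [M.eval_nil h, h']⟩

instance id : TwoCell M (𝟙 Y) [] := of_structural M _

instance comp (f : Y ⟶ Z) (g : Z ⟶ W) {d e : Diagram G} [hf : TwoCell M f d]
    [hg : TwoCell M g e] : TwoCell M (f ≫ g) (d ++ e) :=
  ⟨by rw [M.eval_append hf.eval_eq hg.eval_eq, reify_comp]⟩

instance whiskerLeft (f : Y ⟶ Z) {d : Diagram G} [hf : TwoCell M f d] :
    TwoCell M (W ◁ f) (padLeft z d) :=
  ⟨by rw [reify_whiskerLeft]; exact M.eval_padLeft z hf.eval_eq⟩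

instance whiskerRight (f : Y ⟶ Z) {d : Diagram G} [hf : TwoCell M f d] :
    TwoCell M (f ▷ W) (padRight d z) :=
  ⟨by rw [reify_whiskerRight]; exact M.eval_padRight z hf.eval_eq⟩

instance leftUnitor : TwoCell M (λ_ Y).hom [] := of_structural M _

instance leftUnitor_inv : TwoCell M (λ_ Y).inv [] := of_structural M _

instance rightUnitor : TwoCell M (ρ_ Y).hom [] := of_structural M _

instance rightUnitor_inv : TwoCell M (ρ_ Y).inv [] := of_structural M _

instance bicategoricalComp {V : a ⟶ a} {s : Word} [OneCell M.strand V s]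
    (c : BicategoricalCoherence Z W) [hc : StructuralCoherence M.strand c] (f : Y ⟶ Z) (g : W ⟶ V)
    {d e : Diagram G} [TwoCell M f d] [TwoCell M g e] : TwoCell M (f ⊗≫ g) (d ++ e) :=
  have := hc.structural
  have := of_structural M c.iso.hom
  inferInstanceAs (TwoCell M (f ≫ c.iso.hom ≫ g) (d ++ ([] ++ e)))

theorem of_cell {g : G} {f : ob M.strand (dom g) ⟶ ob M.strand (cod g)} (h : M.cell g = f) :
    M.eval [⟨[], g, []⟩] (dom g) (cod g) = some f :=
  h ▸ M.eval_single (wr_nil_similar _)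

theorem congr (f : Y ⟶ Z) {d e : Diagram G} [hf : TwoCell M f d] (h : d = e) :
    TwoCell M f e := h ▸ hf

variable [DecidableEq G]

/-- Diagrams that agree up to exchange have the same value, and `reify` is injective. Both
directions are used: axioms are turned into valid rules, and derived rules into the required
equations. -/
theorem eq_iff {f g : Y ⟶ Z} {d e : Diagram G} [hf : TwoCell M f d] [hg : TwoCell M g e]
    (R : Rule G) (hR : R.WellTyped) (h : relates [] ⟨u, v, d, e⟩ R = true) :
    f = g ↔ M.Satisfies R := by
  simp only [Bool.and_eq_true, decide_eq_true_eq, relates] at h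
  obtain ⟨hu, hv, h₁, h₂⟩ := h
  obtain ⟨u', v', d', e'⟩ := R
  obtain rfl : u = u' := hu
  obtain rfl : v = v' := hv
  have hd := M.target_of_eval hf.eval_eq
  have he := M.target_of_eval hg.eval_eq
  have h₁ := M.eval_conv (T := []) (by simp) (joins_sound (by simp) hR.1 hd h₁) v
  have h₂ := M.eval_conv (T := []) (by simp) (joins_sound (by simp) he hR.2 h₂) v
  rw [M.satisfies_iff hR]
  dsimp only at h₁ h₂ ⊢
  rw [h₁, ← h₂, hf.eval_eq, hg.eval_eq, Option.some.injEq]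
  exact (reify_injective M.strand).eq_iff.symm

/-- The rule `R` expresses that `d` equals `e`. -/
def expresses (u v : Word) (d e : Diagram G) (R : Rule G) : Bool :=
  (Rule.mk u v d e).fingerprint.beq R.fingerprint &&
    ((relates [] ⟨u, v, d, e⟩ R || relates [] ⟨u, v, e, d⟩ R) && decide R.WellTyped)

theorem eq_iff_of_expresses {f g : Y ⟶ Z} {d e : Diagram G} [TwoCell M f d] [TwoCell M g e]
    {R : Rule G} (h : expresses u v d e R = true) : f = g ↔ M.Satisfies R := by
  simp only [expresses, Bool.and_eq_true, Bool.or_eq_true, decide_eq_true_eq] at h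
  obtain ⟨-, h | h, hR⟩ := h
  · exact eq_iff M R hR h
  · exact eq_comm.trans (eq_iff M R hR h)

variable {M}

theorem satisfies {f g : Y ⟶ Z} {d e : Diagram G} [TwoCell M f d] [TwoCell M g e]
    {R : Rule G} (hfg : f = g) (h : expresses u v d e R = true := by decide +kernel) :
    M.Satisfies R :=
  (eq_iff_of_expresses M h).1 hfg

theorem eq_of_satisfies {f g : Y ⟶ Z} {d e : Diagram G} [TwoCell M f d] [TwoCell M g e]
    {L : List (Rule G)} (hL : ∀ R ∈ L, M.Satisfies R)
    (h : L.any (expresses u v d e) = true := by decide +kernel) : f = g := by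
  obtain ⟨R, hR, h⟩ := List.any_eq_true.1 h
  exact (eq_iff_of_expresses M h).2 (hL R hR)

end TwoCell

end HopfPair

namespace HopfPair
open Signature Gen

theorem Derivable.satisfies {K : Type u} [Bicategory.{w, v} K] {a : K} {G : Type} [Signature G]
    {M : Model K a G} {T L : List (Rule G)} (h : Derivable T L) (hT : ∀ R ∈ T, M.Satisfies R) :
    ∀ R ∈ L, M.Satisfies R := fun R hR => .of_derives M hT (h R hR)

/-! ### The interpretation of the generators by a Hopf datum. -/

section

variable {K : Type u} [Bicategory.{w, v} K] {a : K} {B F : a ⟶ a}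

variable (B F) in
/-- The 1-cells that the letters stand for. -/
abbrev strands : Bool → (a ⟶ a) := fun x => bif x then F else B

instance : OneCell (strands B F) B [false] := ⟨ρ_ B⟩

instance : OneCell (strands B F) F [true] := ⟨ρ_ F⟩

namespace HopfData

variable (D : HopfData B F)

/-- The 2-cells that the generators stand for. -/
abbrev cell : ∀ g : Gen, ob (strands B F) (dom g) ⟶ ob (strands B F) (cod g)
  | .mul false => reify (strands B F) D.mulB
  | .mul true => reify (strands B F) D.mulF
  | .unit false => reify (strands B F) D.unitB
  | .unit true => reify (strands B F) D.unitF
  | .comul false => reify (strands B F) D.comulB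
  | .comul true => reify (strands B F) D.comulF
  | .counit false => reify (strands B F) D.counitB
  | .counit true => reify (strands B F) D.counitF
  | .act false => reify (strands B F) D.actR
  | .act true => reify (strands B F) D.actL
  | .coact false => reify (strands B F) D.coactR
  | .coact true => reify (strands B F) D.coactL
  | .tau false false => reify (strands B F) D.tauBB
  | .tau false true => reify (strands B F) D.tauBF
  | .tau true false => reify (strands B F) D.tauFB
  | .tau true true => reify (strands B F) D.tauFF
  | .psi => reify (strands B F) D.psi
  | .phi => reify (strands B F) D.phi

/-- The interpretation of string diagrams by the 2-cells of a Hopf datum. -/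
abbrev model : Model K a Gen := ⟨strands B F, D.cell⟩

instance : TwoCell D.model D.mulB [⟨[], .mul false, []⟩] := ⟨TwoCell.of_cell _ rfl⟩
instance : TwoCell D.model D.mulF [⟨[], .mul true, []⟩] := ⟨TwoCell.of_cell _ rfl⟩
instance : TwoCell D.model D.unitB [⟨[], .unit false, []⟩] := ⟨TwoCell.of_cell _ rfl⟩
instance : TwoCell D.model D.unitF [⟨[], .unit true, []⟩] := ⟨TwoCell.of_cell _ rfl⟩
instance : TwoCell D.model D.comulB [⟨[], .comul false, []⟩] := ⟨TwoCell.of_cell _ rfl⟩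
instance : TwoCell D.model D.comulF [⟨[], .comul true, []⟩] := ⟨TwoCell.of_cell _ rfl⟩
instance : TwoCell D.model D.counitB [⟨[], .counit false, []⟩] := ⟨TwoCell.of_cell _ rfl⟩
instance : TwoCell D.model D.counitF [⟨[], .counit true, []⟩] := ⟨TwoCell.of_cell _ rfl⟩
instance : TwoCell D.model D.actR [⟨[], .act false, []⟩] := ⟨TwoCell.of_cell _ rfl⟩
instance : TwoCell D.model D.actL [⟨[], .act true, []⟩] := ⟨TwoCell.of_cell _ rfl⟩
instance : TwoCell D.model D.coactR [⟨[], .coact false, []⟩] := ⟨TwoCell.of_cell _ rfl⟩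
instance : TwoCell D.model D.coactL [⟨[], .coact true, []⟩] := ⟨TwoCell.of_cell _ rfl⟩
instance : TwoCell D.model D.tauBB [⟨[], .tau false false, []⟩] := ⟨TwoCell.of_cell _ rfl⟩
instance : TwoCell D.model D.tauBF [⟨[], .tau false true, []⟩] := ⟨TwoCell.of_cell _ rfl⟩
instance : TwoCell D.model D.tauFB [⟨[], .tau true false, []⟩] := ⟨TwoCell.of_cell _ rfl⟩
instance : TwoCell D.model D.tauFF [⟨[], .tau true true, []⟩] := ⟨TwoCell.of_cell _ rfl⟩
instance : TwoCell D.model D.psi [⟨[], .psi, []⟩] := ⟨TwoCell.of_cell _ rfl⟩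
instance : TwoCell D.model D.phi [⟨[], .phi, []⟩] := ⟨TwoCell.of_cell _ rfl⟩

instance : TwoCell D.model D.cellsB.mul [⟨[], .mul false, []⟩] := ⟨TwoCell.of_cell _ rfl⟩
instance : TwoCell D.model D.cellsF.mul [⟨[], .mul true, []⟩] := ⟨TwoCell.of_cell _ rfl⟩
instance : TwoCell D.model D.cellsB.unit [⟨[], .unit false, []⟩] := ⟨TwoCell.of_cell _ rfl⟩
instance : TwoCell D.model D.cellsF.unit [⟨[], .unit true, []⟩] := ⟨TwoCell.of_cell _ rfl⟩
instance : TwoCell D.model D.cellsB.comul [⟨[], .comul false, []⟩] := ⟨TwoCell.of_cell _ rfl⟩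
instance : TwoCell D.model D.cellsF.comul [⟨[], .comul true, []⟩] := ⟨TwoCell.of_cell _ rfl⟩
instance : TwoCell D.model D.cellsB.counit [⟨[], .counit false, []⟩] := ⟨TwoCell.of_cell _ rfl⟩
instance : TwoCell D.model D.cellsF.counit [⟨[], .counit true, []⟩] := ⟨TwoCell.of_cell _ rfl⟩

/-- The 2-cocycle and the 2-cycle are trivial. -/
class TrivialCocycles : Prop where
  sigma : D.SigmaTrivial
  rho : D.RhoTrivial

open Axioms

/-- From here on instance search replaces the cocycle and cycle by composites of units and counits
wherever they occur. -/
instance [h : D.TrivialCocycles] : TwoCell D.model D.sigma (layers [true, true] sigmaForm) := by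
  rw [show D.sigma = _ from h.sigma]
  exact TwoCell.congr _ _ (by decide +kernel)

instance [h : D.TrivialCocycles] : TwoCell D.model D.rho (layers [true] rhoForm) := by
  rw [show D.rho = _ from h.rho]
  exact TwoCell.congr _ _ (by decide +kernel)

instance : TwoCell D.model D.etaM (layers [] etaForm) := by
  unfold etaM
  exact TwoCell.congr _ _ (by decide +kernel)

instance : TwoCell D.model D.epsC (layers [true, false] epsForm) := by
  unfold epsC
  exact TwoCell.congr _ _ (by decide +kernel)

instance : TwoCell D.model D.lamB (layers [false, false] lamBForm) := by
  unfold lamB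
  exact TwoCell.congr _ _ (by decide +kernel)

instance : TwoCell D.model D.lamF (layers [true, true] lamFForm) := by
  unfold lamF
  exact TwoCell.congr _ _ (by decide +kernel)

instance [D.TrivialCocycles] : TwoCell D.model D.muM (layers [true, true] muForm) := by
  unfold muM
  exact TwoCell.congr _ _ (by decide +kernel)

instance [D.TrivialCocycles] : TwoCell D.model D.deltaC (layers [true, false] deltaForm) := by
  unfold deltaC
  exact TwoCell.congr _ _ (by decide +kernel)

theorem satisfies_psiDef : D.model.Satisfies psiDef :=
  TwoCell.satisfies (show D.psi = D.comulB ▷ F ≫ (B ≫ B) ◁ D.comulF ⊗≫ B ◁ D.tauBF ▷ F ⊗≫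
    D.actL ▷ (B ≫ F) ≫ F ◁ D.actR from rfl)

theorem satisfies_phiDef : D.model.Satisfies phiDef :=
  TwoCell.satisfies (show D.phi = D.coactL ▷ B ≫ (B ≫ F) ◁ D.coactR ⊗≫ B ◁ D.tauFB ▷ F ⊗≫
    D.mulB ▷ (F ≫ F) ≫ B ◁ D.mulF from rfl)

variable {D}

section Distributive

theorem satisfies_tauBB (h : PreBimonad.IsDistributive D.cellsB D.cellsB D.tauBB) :
    ∀ R ∈ distributiveRules false false, D.model.Satisfies R := by
  simp only [distributiveRules, List.forall_mem_cons]
  exact ⟨TwoCell.satisfies h.mul_left, TwoCell.satisfies h.unit_left, TwoCell.satisfies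
    h.mul_right, TwoCell.satisfies h.unit_right, TwoCell.satisfies h.comul_left, TwoCell.satisfies
    h.counit_left, TwoCell.satisfies h.comul_right, TwoCell.satisfies h.counit_right,
    List.forall_mem_nil _⟩

theorem satisfies_tauBF (h : PreBimonad.IsDistributive D.cellsB D.cellsF D.tauBF) :
    ∀ R ∈ distributiveRules false true, D.model.Satisfies R := by
  simp only [distributiveRules, List.forall_mem_cons]
  exact ⟨TwoCell.satisfies h.mul_left, TwoCell.satisfies h.unit_left, TwoCell.satisfies
    h.mul_right, TwoCell.satisfies h.unit_right, TwoCell.satisfies h.comul_left, TwoCell.satisfies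
    h.counit_left, TwoCell.satisfies h.comul_right, TwoCell.satisfies h.counit_right,
    List.forall_mem_nil _⟩

theorem satisfies_tauFB (h : PreBimonad.IsDistributive D.cellsF D.cellsB D.tauFB) :
    ∀ R ∈ distributiveRules true false, D.model.Satisfies R := by
  simp only [distributiveRules, List.forall_mem_cons]
  exact ⟨TwoCell.satisfies h.mul_left, TwoCell.satisfies h.unit_left, TwoCell.satisfies
    h.mul_right, TwoCell.satisfies h.unit_right, TwoCell.satisfies h.comul_left, TwoCell.satisfies
    h.counit_left, TwoCell.satisfies h.comul_right, TwoCell.satisfies h.counit_right,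
    List.forall_mem_nil _⟩

theorem satisfies_tauFF (h : PreBimonad.IsDistributive D.cellsF D.cellsF D.tauFF) :
    ∀ R ∈ distributiveRules true true, D.model.Satisfies R := by
  simp only [distributiveRules, List.forall_mem_cons]
  exact ⟨TwoCell.satisfies h.mul_left, TwoCell.satisfies h.unit_left, TwoCell.satisfies
    h.mul_right, TwoCell.satisfies h.unit_right, TwoCell.satisfies h.comul_left, TwoCell.satisfies
    h.counit_left, TwoCell.satisfies h.comul_right, TwoCell.satisfies h.counit_right,
    List.forall_mem_nil _⟩

theorem isDistributive_tauBB (h : ∀ R ∈ distributiveRules false false, D.model.Satisfies R) :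
    PreBimonad.IsDistributive D.cellsB D.cellsB D.tauBB := by
  constructor <;> exact TwoCell.eq_of_satisfies h

theorem isDistributive_tauBF (h : ∀ R ∈ distributiveRules false true, D.model.Satisfies R) :
    PreBimonad.IsDistributive D.cellsB D.cellsF D.tauBF := by
  constructor <;> exact TwoCell.eq_of_satisfies h

theorem isDistributive_tauFB (h : ∀ R ∈ distributiveRules true false, D.model.Satisfies R) :
    PreBimonad.IsDistributive D.cellsF D.cellsB D.tauFB := by
  constructor <;> exact TwoCell.eq_of_satisfies h

theorem isDistributive_tauFF (h : ∀ R ∈ distributiveRules true true, D.model.Satisfies R) :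
    PreBimonad.IsDistributive D.cellsF D.cellsF D.tauFF := by
  constructor <;> exact TwoCell.eq_of_satisfies h

end Distributive

theorem satisfies_common (h₁ : D.cellsB.IsMonad) (h₂ : D.cellsF.IsComonad)
    (h₃ : D.cellsB.CounitMul) (h₄ : D.cellsB.UnitComul) (h₅ : D.cellsB.UnitCounit)
    (h₆ : D.cellsF.CounitMul) (h₇ : D.cellsF.UnitComul) (h₈ : D.cellsF.UnitCounit)
    (hBF : PreBimonad.IsDistributive D.cellsB D.cellsF D.tauBF)
    (hFB : PreBimonad.IsDistributive D.cellsF D.cellsB D.tauFB)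
    (hBB : PreBimonad.IsDistributive D.cellsB D.cellsB D.tauBB)
    (hFF : PreBimonad.IsDistributive D.cellsF D.cellsF D.tauFF) :
    ∀ R ∈ commonRules, D.model.Satisfies R := by
  refine List.forall_mem_append.2 ⟨?_, ?_⟩
  · simp only [List.forall_mem_cons]
    exact ⟨TwoCell.satisfies h₁.assoc, TwoCell.satisfies h₁.unit_mul, TwoCell.satisfies h₁.mul_unit,
      TwoCell.satisfies h₂.coassoc, TwoCell.satisfies h₂.comul_counit, TwoCell.satisfies
      h₂.counit_comul, TwoCell.satisfies h₃, TwoCell.satisfies h₄, TwoCell.satisfies h₅,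
      TwoCell.satisfies h₆, TwoCell.satisfies h₇, TwoCell.satisfies h₈, D.satisfies_psiDef, D.satisfies_phiDef, List.forall_mem_nil _⟩
  · refine Derivable.satisfies ((Derivable.refl (distributiveRules false true ++
      distributiveRules true false ++ distributiveRules false false ++
      distributiveRules true true)).of_within (by decide +kernel)) ?_
    simp only [List.forall_mem_append]
    exact ⟨⟨⟨satisfies_tauBF hBF, satisfies_tauFB hFB⟩, satisfies_tauBB hBB⟩, satisfies_tauFF hFF⟩

theorem satisfies_natural (h : D.IsNatural) (h' : D.IsYangBaxter) :
    ∀ R ∈ naturalRules, D.model.Satisfies R := by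
  refine List.forall_mem_append.2 ⟨List.forall_mem_append.2 ⟨?_, ?_⟩, ?_⟩
  · simp only [naturalRulesAt, List.forall_mem_cons]
    exact ⟨TwoCell.satisfies h.atB.actL_right, TwoCell.satisfies h.atB.actL_left, TwoCell.satisfies
      h.atB.actR_right, TwoCell.satisfies h.atB.actR_left, TwoCell.satisfies h.atB.coactL_right,
      TwoCell.satisfies h.atB.coactL_left, TwoCell.satisfies h.atB.coactR_right, TwoCell.satisfies
      h.atB.coactR_left, List.forall_mem_nil _⟩
  · simp only [naturalRulesAt, List.forall_mem_cons]
    exact ⟨TwoCell.satisfies h.atF.actL_right, TwoCell.satisfies h.atF.actL_left, TwoCell.satisfies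
      h.atF.actR_right, TwoCell.satisfies h.atF.actR_left, TwoCell.satisfies h.atF.coactL_right,
      TwoCell.satisfies h.atF.coactL_left, TwoCell.satisfies h.atF.coactR_right, TwoCell.satisfies
      h.atF.coactR_left, List.forall_mem_nil _⟩
  · simp only [yangBaxterRules, List.flatMap_cons, List.flatMap_nil, List.append_nil,
      List.cons_append, List.nil_append, List.forall_mem_cons]
    exact ⟨TwoCell.satisfies h'.BBB, TwoCell.satisfies h'.BBF, TwoCell.satisfies h'.BFB,
      TwoCell.satisfies h'.BFF, TwoCell.satisfies h'.FBB, TwoCell.satisfies h'.FBF,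
      TwoCell.satisfies h'.FFB, TwoCell.satisfies h'.FFF, List.forall_mem_nil _⟩

end HopfData

end
end HopfPair

namespace HopfPair
open Signature Gen Axioms

section

variable {K : Type u} [Bicategory.{w, v} K] {a : K} {B F : a ⟶ a}

namespace HopfData

variable {D : HopfData B F}

/-! ### Hopf data -/

theorem common_of_satisfies (h : ∀ R ∈ commonRules, D.model.Satisfies R) :
    (D.cellsB.IsMonad ∧ D.cellsF.IsComonad) ∧
    (D.cellsB.CounitMul ∧ D.cellsB.UnitComul ∧ D.cellsB.UnitCounit) ∧
    (D.cellsF.CounitMul ∧ D.cellsF.UnitComul ∧ D.cellsF.UnitCounit) ∧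
    PreBimonad.IsDistributive D.cellsB D.cellsF D.tauBF ∧
    PreBimonad.IsDistributive D.cellsF D.cellsB D.tauFB ∧
    PreBimonad.IsDistributive D.cellsB D.cellsB D.tauBB ∧
    PreBimonad.IsDistributive D.cellsF D.cellsF D.tauFF := by
  have h' {L : List (Rule Gen)} (hL : within commonRules L = true) :
      ∀ R ∈ L, D.model.Satisfies R := ((Derivable.refl _).of_within hL).satisfies h
  refine ⟨⟨?_, ?_⟩, ⟨?_, ?_, ?_⟩, ⟨?_, ?_, ?_⟩, isDistributive_tauBF (h' (by decide +kernel)),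
    isDistributive_tauFB (h' (by decide +kernel)), isDistributive_tauBB (h' (by decide +kernel)),
    isDistributive_tauFF (h' (by decide +kernel))⟩
  · constructor <;> exact TwoCell.eq_of_satisfies h
  · constructor <;> exact TwoCell.eq_of_satisfies h
  all_goals exact TwoCell.eq_of_satisfies h

variable [D.TrivialCocycles]

set_option synthInstance.maxSize 4000 in
set_option synthInstance.maxHeartbeats 400000 in
set_option maxHeartbeats 4000000 in
theorem IsHopfDatum.satisfies (h : D.IsHopfDatum) :
    ∀ R ∈ hopfDatumRules, D.model.Satisfies R := by
  simp only [hopfDatumRules, List.forall_mem_append, hopfModuleRules, hopfWeakRules,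
    hopfTwistRules, hopfCocycleRules, hopfCompatRules, List.forall_mem_cons]
  refine ⟨⟨⟨⟨⟨satisfies_common h.monadB h.comonadF h.counit_mulB h.unit_comulB h.unit_counitB
    h.counit_mulF h.unit_comulF h.unit_counitF h.tauBF h.tauFB h.tauBB h.tauFF,
    ?_⟩, ?_⟩, ?_⟩, ?_⟩, ?_⟩
  · exact ⟨TwoCell.satisfies h.actL_mul, TwoCell.satisfies h.actL_unit, TwoCell.satisfies
      h.coactR_comul, TwoCell.satisfies h.coactR_counit, TwoCell.satisfies h.actL_counit,
      TwoCell.satisfies h.unit_coactR, TwoCell.satisfies h.actR_counit, TwoCell.satisfies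
      h.unit_coactL, TwoCell.satisfies h.module_monad, TwoCell.satisfies h.module_monad_unit,
      TwoCell.satisfies h.comodule_comonad, TwoCell.satisfies h.comodule_comonad_counit,
      TwoCell.satisfies h.right_module_monad, TwoCell.satisfies h.right_module_monad_unit,
      TwoCell.satisfies h.left_comodule_comonad, TwoCell.satisfies h.left_comodule_comonad_counit,
      List.forall_mem_nil _⟩
  · exact ⟨TwoCell.satisfies h.weak_assoc, TwoCell.satisfies h.weak_unit_left, TwoCell.satisfies
      h.weak_unit_right, TwoCell.satisfies h.weak_coassoc, TwoCell.satisfies h.weak_counit_right,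
      TwoCell.satisfies h.weak_counit_left, List.forall_mem_nil _⟩
  · exact ⟨TwoCell.satisfies h.twisted_action, TwoCell.satisfies h.twisted_action_unit,
      TwoCell.satisfies h.twisted_coaction, TwoCell.satisfies h.twisted_coaction_counit,
      List.forall_mem_nil _⟩
  · exact ⟨TwoCell.satisfies h.cocycle, TwoCell.satisfies h.cocycle_unit_left, TwoCell.satisfies
      h.cocycle_unit_right, TwoCell.satisfies h.cycle, TwoCell.satisfies h.cycle_counit_right,
      TwoCell.satisfies h.cycle_counit_left, TwoCell.satisfies h.sigma_counit, TwoCell.satisfies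
      h.unit_rho, List.forall_mem_nil _⟩
  · exact ⟨TwoCell.satisfies h.psi_phi, TwoCell.satisfies h.psi_delta, TwoCell.satisfies
      h.actL_comul, TwoCell.satisfies h.mu_phi, TwoCell.satisfies h.mu_delta, TwoCell.satisfies
      h.mul_coactR, TwoCell.satisfies h.mul_comulB, TwoCell.satisfies h.mul_comulB_lam,
      TwoCell.satisfies h.mul_comulF, TwoCell.satisfies h.mul_comulF_lam, List.forall_mem_nil _⟩

set_option synthInstance.maxSize 4000 in
set_option synthInstance.maxHeartbeats 400000 in
set_option maxHeartbeats 4000000 in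
theorem isHopfDatum_of_satisfies (h : ∀ R ∈ hopfDatumRules, D.model.Satisfies R) :
    D.IsHopfDatum := by
  obtain ⟨⟨h₁, h₂⟩, ⟨h₃, h₄, h₅⟩, ⟨h₆, h₇, h₈⟩, hBF, hFB, hBB, hFF⟩ := common_of_satisfies
    fun R hR => h R (by simp only [hopfDatumRules, List.mem_append, hR, true_or])
  constructor
  -- The order of the fields is used: eight laws of (co)monads and (co)units, eight of (co)actions,
  -- four distributive laws, then the remaining equations.
  iterate 8 assumption
  iterate 8 exact TwoCell.eq_of_satisfies h
  iterate 4 assumption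
  all_goals exact TwoCell.eq_of_satisfies h

end HopfData

end
end HopfPair

namespace HopfPair
open Signature Gen Axioms

section

variable {K : Type u} [Bicategory.{w, v} K] {a : K} {B F : a ⟶ a}

namespace HopfData

variable {D : HopfData B F}

/-! ### Paired wreaths -/

instance : TwoCell D.model D.toPaired.cross.unit (layers [] etaForm) :=
  inferInstanceAs (TwoCell D.model D.etaM _)

instance : TwoCell D.model D.toPaired.cross.counit (layers [true, false] epsForm) :=
  inferInstanceAs (TwoCell D.model D.epsC _)

instance : TwoCell D.model D.toPaired.tauCross (layers [true, false, true, false] crossTau) := by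
  change TwoCell D.model (𝟙 ((F ≫ B) ≫ F ≫ B) ⊗≫ F ◁ D.tauBF ▷ B ⊗≫
    D.tauFF ▷ (B ≫ B) ≫ (F ≫ F) ◁ D.tauBB ⊗≫ F ◁ D.tauFB ▷ B ⊗≫ 𝟙 ((F ≫ B) ≫ F ≫ B)) _
  exact TwoCell.congr _ _ (by decide +kernel)

variable [D.TrivialCocycles]

instance : TwoCell D.model D.toPaired.cross.mul (layers [true, false, true, false] crossMul) := by
  change TwoCell D.model (𝟙 ((F ≫ B) ≫ F ≫ B) ⊗≫ F ◁ D.psi ▷ B ⊗≫ D.muM ▷ (B ≫ B) ⊗≫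
    F ◁ B ◁ D.mulB ⊗≫ F ◁ D.mulB) _
  exact TwoCell.congr _ _ (by decide +kernel)

instance : TwoCell D.model D.toPaired.cross.comul (layers [true, false] crossComul) := by
  change TwoCell D.model (D.comulF ▷ B ⊗≫ D.comulF ▷ (F ≫ B) ⊗≫ F ◁ F ◁ D.deltaC ⊗≫
    F ◁ D.phi ▷ B ⊗≫ 𝟙 ((F ≫ B) ≫ F ≫ B)) _
  exact TwoCell.congr _ _ (by decide +kernel)

set_option synthInstance.maxSize 4000 in
set_option synthInstance.maxHeartbeats 400000 in
set_option maxHeartbeats 4000000 in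
theorem _root_.HopfPair.PairedData.IsPairedWreath.satisfies (h : D.toPaired.IsPairedWreath)
    (hD : D.toPaired.toHopf = D) : ∀ R ∈ pairedWreathRules, D.model.Satisfies R := by
  -- The four discarded fields are the canonical form of the (co)units and the defining formulas of
  -- ψ and φ, which carry no information for a paired wreath built from `D`.
  obtain ⟨monadB, comonadF, counit_mulB, unit_counitB, unit_comulF, unit_counitF, wreath, cowreath,
    etaM_restrict, epsC_restrict, -, -, unit_comulB, counit_mulF, psi_counit, phi_unit, -, -,
    tauBF, tauFB, tauBB, tauFF, proj_B, proj_F, muM_eq, deltaC_eq, bimonad⟩ := h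
  simp only [hD] at monadB comonadF counit_mulB unit_counitB unit_comulF unit_counitF
  simp only [hD] at unit_comulB counit_mulF tauBF tauFB tauBB tauFF proj_B proj_F muM_eq deltaC_eq
  dsimp only [toPaired] at wreath cowreath etaM_restrict epsC_restrict psi_counit phi_unit
  dsimp only [toPaired] at proj_B proj_F muM_eq deltaC_eq
  simp only [pairedWreathRules, List.forall_mem_append, wreathRules, cowreathRules, pairingRules,
    crossMonadRules, crossDistributiveRules, List.forall_mem_cons]
  refine ⟨⟨⟨⟨⟨⟨satisfies_common monadB comonadF counit_mulB unit_comulB unit_counitB counit_mulF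
    unit_comulF unit_counitF tauBF tauFB tauBB tauFF, ?_⟩, ?_⟩, ?_⟩, ?_⟩, ?_⟩, ?_⟩
  · exact ⟨TwoCell.satisfies wreath.psi_mul, TwoCell.satisfies wreath.psi_unit, TwoCell.satisfies
      wreath.mu_two_cell, TwoCell.satisfies wreath.eta_two_cell, TwoCell.satisfies
      wreath.mu_assoc, TwoCell.satisfies wreath.eta_mu, TwoCell.satisfies wreath.mu_eta,
      List.forall_mem_nil _⟩
  · exact ⟨TwoCell.satisfies cowreath.phi_comul, TwoCell.satisfies cowreath.phi_counit,
      TwoCell.satisfies cowreath.delta_two_cell, TwoCell.satisfies cowreath.eps_two_cell,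
      TwoCell.satisfies cowreath.delta_coassoc, TwoCell.satisfies cowreath.delta_eps,
      TwoCell.satisfies cowreath.eps_delta, List.forall_mem_nil _⟩
  · exact ⟨TwoCell.satisfies etaM_restrict, TwoCell.satisfies epsC_restrict, TwoCell.satisfies
      psi_counit, TwoCell.satisfies phi_unit, TwoCell.satisfies proj_B, TwoCell.satisfies proj_F,
      TwoCell.satisfies muM_eq, TwoCell.satisfies deltaC_eq, List.forall_mem_nil _⟩
  · exact ⟨TwoCell.satisfies bimonad.monad.assoc, TwoCell.satisfies bimonad.monad.unit_mul,
      TwoCell.satisfies bimonad.monad.mul_unit, TwoCell.satisfies bimonad.comonad.coassoc,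
      TwoCell.satisfies bimonad.comonad.comul_counit, TwoCell.satisfies
      bimonad.comonad.counit_comul, TwoCell.satisfies bimonad.counit_mul, TwoCell.satisfies
      bimonad.unit_comul, TwoCell.satisfies bimonad.unit_counit, List.forall_mem_nil _⟩
  · exact ⟨TwoCell.satisfies bimonad.distributive.mul_left, TwoCell.satisfies
      bimonad.distributive.unit_left, TwoCell.satisfies bimonad.distributive.mul_right,
      TwoCell.satisfies bimonad.distributive.unit_right, TwoCell.satisfies
      bimonad.distributive.comul_left, TwoCell.satisfies bimonad.distributive.counit_left,
      TwoCell.satisfies bimonad.distributive.comul_right, TwoCell.satisfies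
      bimonad.distributive.counit_right, List.forall_mem_nil _⟩
  · exact ⟨TwoCell.satisfies bimonad.mul_comul, List.forall_mem_nil _⟩

set_option synthInstance.maxSize 4000 in
set_option synthInstance.maxHeartbeats 400000 in
set_option maxHeartbeats 4000000 in
theorem isPairedWreath_of_satisfies (h : ∀ R ∈ pairedWreathRules, D.model.Satisfies R)
    (hD : D.toPaired.toHopf = D) : D.toPaired.IsPairedWreath := by
  obtain ⟨⟨h₁, h₂⟩, ⟨h₃, h₄, h₅⟩, ⟨h₆, h₇, h₈⟩, hBF, hFB, hBB, hFF⟩ := common_of_satisfies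
    fun R hR => h R (by simp only [pairedWreathRules, List.mem_append, hR, true_or])
  constructor <;> try rw [hD]
  iterate 6 assumption
  · change IsLeftWreath D.mulB D.unitB D.psi D.muM D.etaM
    constructor <;> exact TwoCell.eq_of_satisfies h
  · change IsRightCowreath D.comulF D.counitF D.phi D.deltaC D.epsC
    constructor <;> exact TwoCell.eq_of_satisfies h
  · dsimp only [toPaired]
    exact TwoCell.eq_of_satisfies h
  · dsimp only [toPaired]
    exact TwoCell.eq_of_satisfies h
  · rfl
  · rfl
  iterate 2 assumption
  · dsimp only [toPaired]
    exact TwoCell.eq_of_satisfies h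
  · dsimp only [toPaired]
    exact TwoCell.eq_of_satisfies h
  · rfl
  · rfl
  iterate 4 assumption
  iterate 4
    dsimp only [toPaired]
    exact TwoCell.eq_of_satisfies h
  constructor
  · constructor <;> exact TwoCell.eq_of_satisfies h
  · constructor <;> exact TwoCell.eq_of_satisfies h
  · constructor <;> exact TwoCell.eq_of_satisfies h
  all_goals exact TwoCell.eq_of_satisfies h

/-! ### The canonical restrictions -/

theorem toHopf_toPaired (h : ∀ R ∈ restrictionRules, D.model.Satisfies R) :
    D.toPaired.toHopf = D := by
  have h₁ : (λ_ B).inv ≫ D.unitF ▷ B ≫ D.deltaC = D.comulB := TwoCell.eq_of_satisfies h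
  have h₂ : D.muM ≫ F ◁ D.counitB ≫ (ρ_ F).hom = D.mulF := TwoCell.eq_of_satisfies h
  have h₃ : D.psi ≫ F ◁ D.counitB ≫ (ρ_ F).hom = D.actL := TwoCell.eq_of_satisfies h
  have h₄ : (λ_ B).inv ≫ D.unitF ▷ B ≫ D.phi = D.coactR := TwoCell.eq_of_satisfies h
  have h₅ : D.psi ≫ D.counitF ▷ B ≫ (λ_ B).hom = D.actR := TwoCell.eq_of_satisfies h
  have h₆ : (ρ_ F).inv ≫ F ◁ D.unitB ≫ D.phi = D.coactL := TwoCell.eq_of_satisfies h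
  have h₇ : D.muM ≫ D.counitF ▷ B ≫ (λ_ B).hom = D.sigma := TwoCell.eq_of_satisfies h
  have h₈ : (ρ_ F).inv ≫ F ◁ D.unitB ≫ D.deltaC = D.rho := TwoCell.eq_of_satisfies h
  simp only [toPaired, PairedData.toHopf, h₁, h₂, h₃, h₄, h₅, h₆, h₇, h₈]

theorem satisfies_restriction (h : D.toPaired.toHopf = D) :
    ∀ R ∈ restrictionRules, D.model.Satisfies R := by
  have h₁ : (λ_ B).inv ≫ D.unitF ▷ B ≫ D.deltaC = D.comulB := congrArg comulB h
  have h₂ : D.muM ≫ F ◁ D.counitB ≫ (ρ_ F).hom = D.mulF := congrArg mulF h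
  have h₃ : D.psi ≫ F ◁ D.counitB ≫ (ρ_ F).hom = D.actL := congrArg actL h
  have h₄ : (λ_ B).inv ≫ D.unitF ▷ B ≫ D.phi = D.coactR := congrArg coactR h
  have h₅ : D.psi ≫ D.counitF ▷ B ≫ (λ_ B).hom = D.actR := congrArg actR h
  have h₆ : (ρ_ F).inv ≫ F ◁ D.unitB ≫ D.phi = D.coactL := congrArg coactL h
  have h₇ : D.muM ≫ D.counitF ▷ B ≫ (λ_ B).hom = D.sigma := congrArg sigma h
  have h₈ : (ρ_ F).inv ≫ F ◁ D.unitB ≫ D.deltaC = D.rho := congrArg rho h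
  simp only [restrictionRules, List.forall_mem_cons]
  exact ⟨TwoCell.satisfies h₁, TwoCell.satisfies h₂, TwoCell.satisfies h₃, TwoCell.satisfies h₄,
    TwoCell.satisfies h₅, TwoCell.satisfies h₆, TwoCell.satisfies h₇, TwoCell.satisfies h₈,
    List.forall_mem_nil _⟩

end HopfData

end
end HopfPair

namespace HopfPair
open Signature

/-! ### Recovering a paired wreath from its canonical restrictions -/

/-- The generating 2-cells of a paired wreath. -/
inductive PairedGen
  | mulB
  | comulF
  | unit (x : Bool)
  | counit (x : Bool)
  | psi
  | muM
  | phi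
  | deltaC
  | tau (x y : Bool)
  /-- the 2-cells `λ^F` (`true`) and `λ^B` (`false`) -/
  | lam (x : Bool)
deriving DecidableEq

namespace PairedGen

instance : Signature PairedGen where
  dom
    | mulB => [false, false]
    | comulF => [true]
    | unit _ => []
    | counit x => [x]
    | psi => [false, true]
    | muM => [true, true]
    | phi => [true, false]
    | deltaC => [true, false]
    | tau x y => [x, y]
    | lam x => [x, x]
  cod
    | mulB => [false]
    | comulF => [true, true]
    | unit x => [x]
    | counit _ => []
    | psi => [true, false]
    | muM => [true, false]
    | phi => [false, true]
    | deltaC => [false, false]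
    | tau x y => [y, x]
    | lam x => [x, x]
  code
    | mulB => 0
    | comulF => 1
    | unit x => bif x then 2 else 3
    | counit x => bif x then 4 else 5
    | psi => 6
    | muM => 7
    | phi => 8
    | deltaC => 9
    | tau x y => bif x then bif y then 10 else 11 else bif y then 12 else 13
    | lam x => bif x then 14 else 15
  force
    | mulB, f => f mulB
    | comulF, f => f comulF
    | unit x, f => bif x then f (unit true) else f (unit false)
    | counit x, f => bif x then f (counit true) else f (counit false)
    | psi, f => f psi
    | muM, f => f muM
    | phi, f => f phi
    | deltaC, f => f deltaC
    | tau x y, f => bif x then bif y then f (tau true true) else f (tau true false)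
        else bif y then f (tau false true) else f (tau false false)
    | lam x, f => bif x then f (lam true) else f (lam false)
  force_eq g f := by
    cases g with
    | tau x y => cases x <;> cases y <;> rfl
    | unit x => cases x <;> rfl
    | counit x => cases x <;> rfl
    | lam x => cases x <;> rfl
    | _ => rfl

local notation "B" => false
local notation "F" => true

def unitRules : List (Rule PairedGen) := [
  mkRule [F] [(0, comulF), (1, counit F)] [],
  mkRule [F] [(0, comulF), (0, counit F)] [],
  mkRule [B] [(0, unit B), (0, mulB)] [],
  mkRule [B] [(1, unit B), (0, mulB)] [],
  mkRule [B, B] [(0, mulB), (0, counit B)] [(0, counit B), (0, counit B)],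
  mkRule [] [(0, unit F), (0, comulF)] [(0, unit F), (0, unit F)],
  mkRule [] [(0, unit B), (0, counit B)] [],
  mkRule [] [(0, unit F), (0, counit F)] [],
  mkRule [F] [(0, unit B), (0, psi)] [(1, unit B)],
  mkRule [F, B] [(0, phi), (1, counit F)] [(0, counit F)],
  mkRule [F] [(0, unit B), (0, tau B F)] [(1, unit B)],
  mkRule [F, B] [(0, tau F B), (1, counit F)] [(0, counit F)]]

def muEta := mkRule [F] [(1, unit F), (2, unit B), (0, muM), (1, mulB)] [(1, unit B)]

def epsDelta := mkRule [F, B] [(0, comulF), (1, deltaC), (0, counit F), (0, counit B)]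
  [(0, counit F)]

def projF := mkRule [F, F, F] [(0, lam F), (1, muM), (2, counit B)]
  [(0, comulF), (1, comulF), (2, counit F), (2, unit B), (3, unit B), (1, phi), (3, tau B F),
    (2, tau F F), (4, psi), (5, counit B), (1, psi), (2, counit B), (2, muM), (3, counit B),
    (0, muM), (1, counit B)]

def projB := mkRule [B, B] [(0, unit F), (0, deltaC), (1, lam B)]
  [(0, unit F), (0, deltaC), (2, unit F), (2, deltaC), (0, unit F), (0, phi), (3, unit F),
    (3, phi), (2, tau B B), (1, tau F B), (3, psi), (2, counit F), (2, counit F), (2, unit B),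
    (2, mulB), (2, mulB)]

/-- Axioms of a paired wreath with trivial cocycles, with the canonical restrictions expanded. -/
def axioms : List (Rule PairedGen) := [muEta, epsDelta, projF, projB] ++ unitRules

def lamF := mkRule [F, F] [(0, lam F)]
  [(0, comulF), (2, unit B), (1, phi), (2, tau F F), (1, psi), (2, counit B), (0, muM),
    (1, counit B)]

def lamB := mkRule [B, B] [(0, lam B)]
  [(1, unit F), (1, deltaC), (1, unit F), (1, phi), (0, tau B B), (1, psi), (1, counit F),
    (1, mulB)]

/-- Closing the output `B` of the unit law of μ_M makes η_F a right unit for the restricted product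
of `F`; hence η_F on the third strand of the projection axiom isolates λ^F, and trivial ρ'
simplifies the other side. Dually, ε_B on the first output strand isolates λ^B. -/
theorem axioms_lam : Derivable axioms [lamF, lamB] := by
  have h := Derivable.refl axioms
  have h₁ : Derivable axioms [mkRule [F] [(1, unit F), (0, muM), (1, counit B)] [],
      mkRule [B] [(0, unit F), (0, deltaC), (0, counit B)] []] :=
    h.normalForms [.norm unitRules] (by decide +kernel)
      (Derivable.append
        ((h.of_within (L := [muEta]) (by decide +kernel)).extendAll
          (u := [F]) (pre := []) (post := [(1, counit B)]) (by decide +kernel))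
        ((h.of_within (L := [epsDelta]) (by decide +kernel)).extendAll
          (u := [B]) (pre := [(0, unit F)]) (post := []) (by decide +kernel)))
      (by decide +kernel) (by decide +kernel)
  exact (h₁.append h).normalForms
    [.norm ([mkRule [F] [(1, unit F), (0, muM), (1, counit B)] [],
      mkRule [B] [(0, unit F), (0, deltaC), (0, counit B)] []] ++ unitRules)] (by decide +kernel)
    (Derivable.append
      ((h.of_within (L := [projF]) (by decide +kernel)).extendAll
        (u := [F, F]) (pre := [(2, unit F)]) (post := []) (by decide +kernel))
      ((h.of_within (L := [projB]) (by decide +kernel)).extendAll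
        (u := [B, B]) (pre := []) (post := [(0, counit B)]) (by decide +kernel)))
    (by decide +kernel) (by decide +kernel)

end PairedGen

section

variable {K : Type u} [Bicategory.{w, v} K] {a : K} {B F : a ⟶ a}

namespace PairedData

open PairedGen

variable (P : PairedData B F)

/-- The 2-cells that the generators stand for. -/
abbrev cell : ∀ g : PairedGen, ob (strands B F) (dom g) ⟶ ob (strands B F) (cod g)
  | .mulB => reify (strands B F) P.mulB
  | .comulF => reify (strands B F) P.comulF
  | .unit false => reify (strands B F) P.unitB
  | .unit true => reify (strands B F) P.unitF
  | .counit false => reify (strands B F) P.counitB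
  | .counit true => reify (strands B F) P.counitF
  | .psi => reify (strands B F) P.psi
  | .muM => reify (strands B F) P.muM
  | .phi => reify (strands B F) P.phi
  | .deltaC => reify (strands B F) P.deltaC
  | .tau false false => reify (strands B F) P.tauBB
  | .tau false true => reify (strands B F) P.tauBF
  | .tau true false => reify (strands B F) P.tauFB
  | .tau true true => reify (strands B F) P.tauFF
  | .lam false => reify (strands B F) P.lamB
  | .lam true => reify (strands B F) P.lamF

/-- The interpretation of string diagrams by the 2-cells of a paired wreath. -/
abbrev model : Model K a PairedGen := ⟨strands B F, P.cell⟩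

instance : TwoCell P.model P.mulB [⟨[], .mulB, []⟩] := ⟨TwoCell.of_cell _ rfl⟩
instance : TwoCell P.model P.comulF [⟨[], .comulF, []⟩] := ⟨TwoCell.of_cell _ rfl⟩
instance : TwoCell P.model P.unitB [⟨[], .unit false, []⟩] := ⟨TwoCell.of_cell _ rfl⟩
instance : TwoCell P.model P.unitF [⟨[], .unit true, []⟩] := ⟨TwoCell.of_cell _ rfl⟩
instance : TwoCell P.model P.counitB [⟨[], .counit false, []⟩] := ⟨TwoCell.of_cell _ rfl⟩
instance : TwoCell P.model P.counitF [⟨[], .counit true, []⟩] := ⟨TwoCell.of_cell _ rfl⟩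
instance : TwoCell P.model P.psi [⟨[], .psi, []⟩] := ⟨TwoCell.of_cell _ rfl⟩
instance : TwoCell P.model P.muM [⟨[], .muM, []⟩] := ⟨TwoCell.of_cell _ rfl⟩
instance : TwoCell P.model P.phi [⟨[], .phi, []⟩] := ⟨TwoCell.of_cell _ rfl⟩
instance : TwoCell P.model P.deltaC [⟨[], .deltaC, []⟩] := ⟨TwoCell.of_cell _ rfl⟩
instance : TwoCell P.model P.tauBB [⟨[], .tau false false, []⟩] := ⟨TwoCell.of_cell _ rfl⟩
instance : TwoCell P.model P.tauBF [⟨[], .tau false true, []⟩] := ⟨TwoCell.of_cell _ rfl⟩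
instance : TwoCell P.model P.tauFB [⟨[], .tau true false, []⟩] := ⟨TwoCell.of_cell _ rfl⟩
instance : TwoCell P.model P.tauFF [⟨[], .tau true true, []⟩] := ⟨TwoCell.of_cell _ rfl⟩
instance : TwoCell P.model P.lamB [⟨[], .lam false, []⟩] := ⟨TwoCell.of_cell _ rfl⟩
instance : TwoCell P.model P.lamF [⟨[], .lam true, []⟩] := ⟨TwoCell.of_cell _ rfl⟩

variable {P}

set_option synthInstance.maxSize 4000 in
set_option synthInstance.maxHeartbeats 400000 in
set_option maxHeartbeats 4000000 in
theorem satisfies_axioms (h : P.IsPairedWreath) (hs : P.toHopf.SigmaTrivial)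
    (hr : P.toHopf.RhoTrivial) : ∀ R ∈ axioms, P.model.Satisfies R := by
  have mu_eta := h.wreath.mu_eta
  have eps_delta := h.cowreath.eps_delta
  have proj_B := h.proj_B
  have proj_F := h.proj_F
  have comul_counit := h.comonadF.comul_counit
  have counit_comul := h.comonadF.counit_comul
  have unit_mul := h.monadB.unit_mul
  have mul_unit := h.monadB.mul_unit
  have counit_mul : _ = _ := h.counit_mulB
  have unit_comul : _ = _ := h.unit_comulF
  have unit_counitB : _ = _ := h.unit_counitB
  have unit_counitF : _ = _ := h.unit_counitF
  have unit_tau := h.tauBF.unit_left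
  have tau_counit := h.tauFB.counit_left
  -- η_M and ε_C are not generators of `PairedGen`; they enter through their canonical form.
  rw [h.etaM_canonical] at mu_eta
  rw [h.epsC_canonical] at eps_delta
  rw [show P.toHopf.sigma = _ from hs] at proj_B
  rw [show P.toHopf.rho = _ from hr] at proj_F
  dsimp only [toHopf, HopfData.cellsB, HopfData.cellsF, HopfData.etaM, HopfData.epsC] at *
  simp only [axioms, PairedGen.unitRules, List.forall_mem_append, List.forall_mem_cons]
  exact ⟨⟨TwoCell.satisfies mu_eta, TwoCell.satisfies eps_delta, TwoCell.satisfies proj_F,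
    TwoCell.satisfies proj_B, List.forall_mem_nil _⟩, TwoCell.satisfies comul_counit,
    TwoCell.satisfies counit_comul, TwoCell.satisfies unit_mul, TwoCell.satisfies mul_unit,
    TwoCell.satisfies counit_mul, TwoCell.satisfies unit_comul, TwoCell.satisfies unit_counitB,
    TwoCell.satisfies unit_counitF, TwoCell.satisfies h.wreath.psi_unit,
    TwoCell.satisfies h.cowreath.phi_counit, TwoCell.satisfies unit_tau,
    TwoCell.satisfies tau_counit, List.forall_mem_nil _⟩

/-- λ^F and λ^B are determined by the restrictions, and μ_M and Δ_C are given in terms of them; for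
ψ, φ and the (co)units the axioms state directly that they are rebuilt from the restrictions. -/
theorem toPaired_toHopf (h : P.IsPairedWreath) (hs : P.toHopf.SigmaTrivial)
    (hr : P.toHopf.RhoTrivial) : P.toHopf.toPaired = P := by
  have hl := axioms_lam.satisfies (satisfies_axioms h hs hr)
  have hF : P.toHopf.lamF = P.lamF := by
    dsimp only [HopfData.lamF, toHopf]
    exact TwoCell.eq_of_satisfies hl
  have hB : P.toHopf.lamB = P.lamB := by
    dsimp only [HopfData.lamB, toHopf]
    exact TwoCell.eq_of_satisfies hl
  have : P.toHopf.TrivialCocycles := ⟨hs, hr⟩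
  have hM : P.toHopf.muM = P.muM := by
    rw [h.muM_eq, ← hF]
    -- The two composites differ only in the order of independent cells; the tautological rule
    -- serves to compare both with one diagram.
    exact (TwoCell.eq_iff P.toHopf.model (f := P.toHopf.muM)
      (g := F ◁ P.toHopf.comulF ⊗≫ P.toHopf.lamF ▷ F ⊗≫ F ◁ P.toHopf.sigma)
      (mkRule [true, true] Axioms.muForm Axioms.muForm) (by decide +kernel) (by decide +kernel)).2
      fun _ => rfl
  have hC : P.toHopf.deltaC = P.deltaC := by
    rw [h.deltaC_eq, ← hB]
    exact (TwoCell.eq_iff P.toHopf.model (f := P.toHopf.deltaC)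
      (g := P.toHopf.rho ▷ B ⊗≫ B ◁ P.toHopf.lamB ⊗≫ P.toHopf.mulB ▷ B)
      (mkRule [true, false] Axioms.deltaForm Axioms.deltaForm) (by decide +kernel)
      (by decide +kernel)).2 fun _ => rfl
  have h₁ := h.etaM_canonical
  have h₂ := h.epsC_canonical
  have h₃ := h.psi_eq
  have h₄ := h.phi_eq
  rw [HopfData.toPaired, hF, hB, hM, hC, ← h₁, ← h₂, ← h₃, ← h₄]
  rfl

end PairedData

/-! ### The two passages between Hopf data and paired wreaths. -/

namespace HopfData

open Axioms

/-- Four non-trivial (co)actions would give valence four. Whichever one is trivial, its triviality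
together with the reduced axioms yields the bimonad equation. -/
theorem exists_trivial {D : HopfData B F} (h : D.valence ≤ 3) :
    ∃ R : Rule Gen, D.model.Satisfies R ∧ Derives (R :: hopf) bimonadRule := by
  by_cases h₁ : D.ActLTrivial
  · exact ⟨actLTriv, TwoCell.satisfies h₁, bimonadRule_of_actL⟩
  by_cases h₂ : D.ActRTrivial
  · exact ⟨actRTriv, TwoCell.satisfies h₂, bimonadRule_of_actR⟩
  by_cases h₃ : D.CoactLTrivial
  · exact ⟨coactLTriv, TwoCell.satisfies h₃, bimonadRule_of_coactL⟩
  by_cases h₄ : D.CoactRTrivial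
  · exact ⟨coactRTriv, TwoCell.satisfies h₄, bimonadRule_of_coactR⟩
  simp [valence, h₁, h₂, h₃, h₄] at h

theorem isPairedWreath {D : HopfData B F} (h : D.IsHopfDatum) (hD : D.IsTrivalent)
    (hn : D.IsNatural) (hy : D.IsYangBaxter) :
    D.toPaired.IsPairedWreath ∧ D.toPaired.toHopf = D := by
  have : D.TrivialCocycles := ⟨hD.sigma, hD.rho⟩
  have hhopf := hopfDatum_hopf.satisfies
    (List.forall_mem_append.2 ⟨h.satisfies, satisfies_natural hn hy⟩)
  obtain ⟨R, hR, hb⟩ := exists_trivial hD.valence_le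
  have hb' := Model.Satisfies.of_derives _ (List.forall_mem_cons.2 ⟨hR, hhopf⟩) hb
  have hr := toHopf_toPaired (hopf_restriction.satisfies hhopf)
  exact ⟨isPairedWreath_of_satisfies
    (hopf_pairedWreath.satisfies (List.forall_mem_cons.2 ⟨hb', hhopf⟩)) hr, hr⟩

end HopfData

namespace PairedData

open Axioms

/-- Since `P` is rebuilt from its restrictions, its axioms may be read as statements about the
paired wreath of `P.toHopf`, where the model and the rules for Hopf data apply. -/
theorem isHopfDatum {P : PairedData B F} (h : P.IsPairedWreath) (hP : P.toHopf.IsTrivalent)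
    (hn : P.toHopf.IsNatural) (hy : P.toHopf.IsYangBaxter) :
    P.toHopf.IsHopfDatum ∧ P.toHopf.toPaired = P := by
  have : P.toHopf.TrivialCocycles := ⟨hP.sigma, hP.rho⟩
  have hr := toPaired_toHopf h hP.sigma hP.rho
  have hr' : P.toHopf.toPaired.toHopf = P.toHopf := congrArg toHopf hr
  refine ⟨HopfData.isHopfDatum_of_satisfies (hopf_hopfDatum.satisfies
    ((pairedWreath_hopf (Derivable.refl _)).satisfies ?_)), hr⟩
  refine List.forall_mem_append.2 ⟨List.forall_mem_append.2 ⟨?_, ?_⟩, ?_⟩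
  · exact IsPairedWreath.satisfies (hr.symm ▸ h) hr'
  · exact HopfData.satisfies_natural hn hy
  · exact HopfData.satisfies_restriction hr'

end PairedData

end

end HopfPair

theorem mainTheorem1 {K : Type u} [Bicategory.{w, v} K] {a : K} {B F : a ⟶ a} :
    -- a trivalent Hopf datum makes `FB` a `τ`-bimonad
    (∀ D : HopfPair.HopfData B F,
      D.IsHopfDatum → D.IsTrivalent → D.IsNatural → D.IsYangBaxter →
        D.toPaired.cross.IsTauBimonad D.toPaired.tauCross) ∧
    -- a trivalent Hopf datum is a paired wreath, from which it is recovered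
    (∀ D : HopfPair.HopfData B F,
      D.IsHopfDatum → D.IsTrivalent → D.IsNatural → D.IsYangBaxter →
        D.toPaired.IsPairedWreath ∧ D.toPaired.toHopf = D) ∧
    -- a trivalent paired wreath is a Hopf datum, from which it is recovered
    (∀ P : HopfPair.PairedData B F,
      P.IsPairedWreath → P.toHopf.IsTrivalent → P.toHopf.IsNatural → P.toHopf.IsYangBaxter →
        P.toHopf.IsHopfDatum ∧ P.toHopf.toPaired = P) :=
  ⟨fun _ h hD hn hy => (HopfPair.HopfData.isPairedWreath h hD hn hy).1.bimonad,
    fun _ h hD hn hy => HopfPair.HopfData.isPairedWreath h hD hn hy,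
    fun _ h hP hn hy => HopfPair.PairedData.isHopfDatum h hP hn hy⟩
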